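/- **Setting.** Fix a finite relational signature $\sigma$ (arities in $\mathbb N$, arity $0$ allowed), a collection $\mathbb S$ of (unital) rings and/or abelian groups, a finite set $\mathbf W$ of weight symbols $\mathtt w$, each with an arity $\mathrm{ar}(\mathtt w)\ge 1$ and a type $\mathrm{type}(\mathtt w)\in\mathbb S$, and a countable set $\mathbb P$ of predicate names $\mathsf P$, each with an arity $m\ge 1$, a type $(S_1,\dots,S_m)\in\mathbb S^m$ and a semantics $[\![\mathsf P]\!]\subseteq S_1\times\cdots\times S_m$. A $(\sigma,\mathbf W)$-structure $\mathcal A$ is a $\sigma$-structure with finite non-empty universe $A$, together with functions $\mathtt w^{\mathcal A}:A^{\mathrm{ar}(\mathtt w)}\to\mathrm{type}(\mathtt w)$ such that $\mathtt w^{\mathcal A}(a_1,\dots,a_k)\neq 0$ implies that $k=1$, or $a_1=\dots=a_k$, or all $a_i$ occur in a common tuple of some relation of $\mathcal A$. Variables are taken from a countably infinite set. Terms are: constants $s\in S$ (type $S\in\mathbb S$); $\mathtt w(x_1,\dots,x_k)$ with pairwise distinct variables; $t_1+t_2$ and $t_1-t_2$ for terms of the same type; and $t_1\cdot t_2$ if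 this type is a ring. Formulas of $\mathrm{FOW}_1$ are built from $x=y$; $R(\bar x)$ with $R\in\sigma$; $(s=\mathtt w(\bar x))$ with $s\in\mathrm{type}(\mathtt w)$ and $\bar x$ pairwise distinct; and $\mathsf P(t_1,\dots,t_m)$ with terms $t_i$ of the right types in which altogether at most one variable occurs; by $\neg$, $\vee$, $\exists y$, and, for $\mathtt w$ of *finite* type $S$, $s\in S$ and pairwise distinct variables $\bar y$, the construct $\big(s=\sum\mathtt w(\bar y).\varphi\big)$, which binds $\bar y$ and says that the sum in $S$ of $\mathtt w^{\mathcal A}(\bar a)$ over all tuples $\bar a$ satisfying $\varphi$ (as values of $\bar y$) equals $s$. Two formulas are equivalent if they have the same truth value in every $(\sigma,\mathbf W)$-structure under every assignment. Distances are measured in the Gaifman graph of $\mathcal A$ (distinct elements are adjacent iff they occur in a common tuple of a relation), and $\mathcal N_r^{\mathcal A}(\bar a)$ is the restriction of the relations and weights of $\mathcal A$ to the set of elements at distance at most $r$ from some $a_i$. For a non-empty tuple $\bar x$ of variables containing the free variables of $\varphi$, the formula $\varphi(\bar x)$ is *$r$-local around $\bar x$* if for every $(\sigma,\mathbf W)$-structure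 $\mathcal A$ and all $\bar a$, $\mathcal A\models\varphi[\bar a]\iff\mathcal N_r^{\mathcal A}(\bar a)\models\varphi[\bar a]$; it is *local* if it has at least one free variable and is $r$-local around its free variables for some $r\in\mathbb N$. A *basic-local sentence* has the form $\exists x_1\cdots\exists x_\ell\big(\bigwedge_{i<j}\mathrm{dist}(x_i,x_j)>2r\wedge\bigwedge_i\lambda(x_i)\big)$ with $\ell\ge1$, $r\in\mathbb N$, pairwise distinct $x_i$, $\lambda(x)$ a $\mathrm{FOW}_1$-formula that is $r$-local around $x$, and $\mathrm{dist}(x_i,x_j)>2r$ the negation of a first-order formula over $\sigma$ that defines $\mathrm{dist}(x_i,x_j)\le 2r$. A *local aggregation sentence* has the form $\big(s=\sum\mathtt w(\bar y).\lambda(\bar y)\big)$ with $\mathtt w$ of finite type and $\lambda(\bar y)$ a $\mathrm{FOW}_1$-formula that is $r$-local around $\bar y$ for some $r$. A formula is in *Gaifman normal form* if it is a Boolean combination (by $\neg$ and $\vee$) of local $\mathrm{FOW}_1$-formulas, basic-local sentences and local aggregation sentences. **Theorem (Gaifman normal form for $\mathrm{FOW}_1$).** Every $\mathrm{FOW}_1$-formula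 $\varphi$ is equivalent to a $\mathrm{FOW}_1$-formula $\gamma$ in Gaifman normal form with $\mathrm{free}(\gamma)=\mathrm{free}(\varphi)$. Furthermore, there is an algorithm that computes $\gamma$ upon input of $\varphi$: there is such a map $\varphi\mapsto\gamma$ so that, for every coding of the predicate names and constants by natural numbers in which distinct predicate names have distinct codes, the zero of each $S\in\mathbb S$ has a code shared by no other element of $S$, and the elements of each finite $S\in\mathbb S$ have pairwise distinct codes, some computable function $\mathbb N\to\mathbb N$ sends the resulting code of the syntax tree of $\varphi$ to that of $\gamma$, for all $\varphi$. -/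

import Mathlib

universe u v w

/-- An abelian group or a (unital, not necessarily commutative) ring. -/
inductive Coeff : Type (u + 1)
  | group (S : Type u) (inst : AddCommGroup S) : Coeff
  | ring (S : Type u) (inst : Ring S) : Coeff

namespace Coeff

def Carrier : Coeff.{u} → Type u
  | group S _ => S
  | ring S _ => S

def IsRing : Coeff.{u} → Prop
  | group _ _ => False
  | ring _ _ => True

instance instAddCommGroup : (S : Coeff.{u}) → AddCommGroup S.Carrier
  | group _ inst => inst
  | ring _ inst => inst.toAddCommGroup

/-- Multiplication, available for rings only. -/
def mul : (S : Coeff.{u}) → S.IsRing → S.Carrier → S.Carrier → S.Carrier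
  | group _ _, h, _, _ => h.elim
  | ring _ inst, _, a, b => inst.mul a b

end Coeff

/-- The data over which the logic is built: a finite relational signature, a collection of
rings and/or abelian groups (indexed by `Ix`), a finite set of weight symbols, and a countable
predicate collection. -/
structure Vocabulary : Type (max (u + 1) (v + 1) (w + 1)) where
  numRel : ℕ
  relArity : Fin numRel → ℕ
  Ix : Type v
  coeff : Ix → Coeff.{u}
  numWt : ℕ
  wtArity : Fin numWt → ℕ
  wtArity_pos : ∀ a, 1 ≤ wtArity a
  wtType : Fin numWt → Ix
  Pred : Type w
  pred_countable : Countable Pred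
  predArity : Pred → ℕ
  predArity_pos : ∀ P, 1 ≤ predArity P
  predType : (P : Pred) → Fin (predArity P) → Ix
  predSem : (P : Pred) → Set ((j : Fin (predArity P)) → (coeff (predType P j)).Carrier)

namespace Vocabulary

/-- The set of elements of the `i`-th ring or group. -/
abbrev Elem (V : Vocabulary.{u, v, w}) (i : V.Ix) : Type u := (V.coeff i).Carrier

end Vocabulary

/-! ### Weighted structures -/

/-- A finite non-empty relational structure in which every weight symbol is interpreted by a
function. The locality condition on the weights is the separate predicate `IsWeighted`, because
it may fail in an induced substructure. As universes are finite, those in `Type` represent all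
structures up to isomorphism. -/
structure PreStructure (V : Vocabulary.{u, v, w}) : Type (max 1 u) where
  Univ : Type
  finite_univ : Finite Univ
  nonempty_univ : Nonempty Univ
  rel : (R : Fin V.numRel) → Set (Fin (V.relArity R) → Univ)
  wt : (a : Fin V.numWt) → (Fin (V.wtArity a) → Univ) → V.Elem (V.wtType a)

namespace PreStructure

variable {V : Vocabulary.{u, v, w}}

/-- The locality condition: `A` is a `(σ, W)`-structure. -/
def IsWeighted (A : PreStructure V) : Prop :=
  ∀ (a : Fin V.numWt) (t : Fin (V.wtArity a) → A.Univ), A.wt a t ≠ 0 →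
    V.wtArity a = 1 ∨ (∀ i j, t i = t j) ∨
      ∃ R, ∃ b ∈ A.rel R, Set.range t ⊆ Set.range b

/-- The Gaifman graph. -/
def gaifman (A : PreStructure V) : SimpleGraph A.Univ where
  Adj a b := a ≠ b ∧ ∃ R, ∃ t ∈ A.rel R, a ∈ Set.range t ∧ b ∈ Set.range t
  symm := ⟨fun _ _ h => ⟨h.1.symm, h.2.imp fun _ ⟨t, ht, ha, hb⟩ => ⟨t, ht, hb, ha⟩⟩⟩
  loopless := ⟨fun _ h => h.1 rfl⟩

/-- The `r`-ball around a set of elements. -/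
def ball (A : PreStructure V) (r : ℕ) (X : Set A.Univ) : Set A.Univ :=
  {b | ∃ a ∈ X, A.gaifman.edist a b ≤ r}

/-- The substructure induced on a non-empty set: relations and weights are restricted. -/
def induce (A : PreStructure V) (B : Set A.Univ) (hB : B.Nonempty) : PreStructure V where
  Univ := B
  finite_univ := by
    have := A.finite_univ
    infer_instance
  nonempty_univ := hB.to_subtype
  rel R := {t | (fun j => (t j : A.Univ)) ∈ A.rel R}
  wt a t := A.wt a fun j => (t j : A.Univ)

end PreStructure

/-! ### Syntax of the logic -/

/-- Terms; variables are natural numbers. Aggregation terms are not available in this logic. -/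
inductive WTerm (V : Vocabulary.{u, v, w}) : V.Ix → Type (max u v)
  | const {i : V.Ix} (s : V.Elem i) : WTerm V i
  | wt (a : Fin V.numWt) (xs : Fin (V.wtArity a) ↪ ℕ) : WTerm V (V.wtType a)
  | add {i : V.Ix} (t₁ t₂ : WTerm V i) : WTerm V i
  | sub {i : V.Ix} (t₁ t₂ : WTerm V i) : WTerm V i
  | mul {i : V.Ix} (h : (V.coeff i).IsRing) (t₁ t₂ : WTerm V i) : WTerm V i

namespace WTerm

variable {V : Vocabulary.{u, v, w}}

def free : {i : V.Ix} → WTerm V i → Finset ℕ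
  | _, const _ => ∅
  | _, wt _ xs => Finset.univ.image xs
  | _, add t₁ t₂ => t₁.free ∪ t₂.free
  | _, sub t₁ t₂ => t₁.free ∪ t₂.free
  | _, mul _ t₁ t₂ => t₁.free ∪ t₂.free

def eval (A : PreStructure V) (β : ℕ → A.Univ) : {i : V.Ix} → WTerm V i → V.Elem i
  | _, const s => s
  | _, wt a xs => A.wt a fun j => β (xs j)
  | _, add t₁ t₂ => t₁.eval A β + t₂.eval A β
  | _, sub t₁ t₂ => t₁.eval A β - t₂.eval A β
  | _, mul h t₁ t₂ => Coeff.mul _ h (t₁.eval A β) (t₂.eval A β)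

/-- Renaming of the variables by a permutation. -/
def rename (π : Equiv.Perm ℕ) : {i : V.Ix} → WTerm V i → WTerm V i
  | _, const s => const s
  | _, wt a xs => wt a (xs.trans π.toEmbedding)
  | _, add t₁ t₂ => add (t₁.rename π) (t₂.rename π)
  | _, sub t₁ t₂ => sub (t₁.rename π) (t₂.rename π)
  | _, mul h t₁ t₂ => mul h (t₁.rename π) (t₂.rename π)

theorem free_rename (π : Equiv.Perm ℕ) {i : V.Ix} (t : WTerm V i) :
    (t.rename π).free = t.free.image π := by
  induction t with
  | const s => simp [rename, free]
  | wt a xs =>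
    ext y
    simp [rename, free]
  | add t₁ t₂ h₁ h₂ => simp [rename, free, h₁, h₂, Finset.image_union]
  | sub t₁ t₂ h₁ h₂ => simp [rename, free, h₁, h₂, Finset.image_union]
  | mul h t₁ t₂ h₁ h₂ => simp [rename, free, h₁, h₂, Finset.image_union]

end WTerm

/-- Formulas of `FOW₁`. An embedding `Fin k ↪ ℕ` is a `k`-tuple of pairwise distinct variables.
* `wtEq a s xs` is `(s = a(xs))`;
* `sumEq a hfin s ys φ` is `(s = ∑ a(ys).φ)`, for a weight symbol whose type is finite;
* `pred P ts h` is `P(ts)`, where at most one variable is free in `ts`. -/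
inductive WFormula (V : Vocabulary.{u, v, w}) : Type (max u v w)
  | eq (x y : ℕ) : WFormula V
  | rel (R : Fin V.numRel) (xs : Fin (V.relArity R) → ℕ) : WFormula V
  | wtEq (a : Fin V.numWt) (s : V.Elem (V.wtType a)) (xs : Fin (V.wtArity a) ↪ ℕ) : WFormula V
  | not (φ : WFormula V) : WFormula V
  | or (φ ψ : WFormula V) : WFormula V
  | ex (y : ℕ) (φ : WFormula V) : WFormula V
  | sumEq (a : Fin V.numWt) (hfin : Finite (V.Elem (V.wtType a))) (s : V.Elem (V.wtType a))
      (ys : Fin (V.wtArity a) ↪ ℕ) (φ : WFormula V) : WFormula V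
  | pred (P : V.Pred) (ts : (j : Fin (V.predArity P)) → WTerm V (V.predType P j))
      (h : (Finset.univ.biUnion fun j => (ts j).free).card ≤ 1) : WFormula V

namespace WFormula

variable {V : Vocabulary.{u, v, w}}

def free : WFormula V → Finset ℕ
  | eq x y => {x, y}
  | rel _ xs => Finset.univ.image xs
  | wtEq _ _ xs => Finset.univ.image xs
  | not φ => φ.free
  | or φ ψ => φ.free ∪ ψ.free
  | ex y φ => φ.free \ {y}
  | sumEq _ _ _ ys φ => φ.free \ Finset.univ.image ys
  | pred _ ts _ => Finset.univ.biUnion fun j => (ts j).free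

/-- Satisfaction. `Function.extend ys b β` is the assignment that sends `ys j` to `b j` and
agrees with `β` elsewhere. -/
def Sat (A : PreStructure V) : WFormula V → (ℕ → A.Univ) → Prop
  | eq x y, β => β x = β y
  | rel R xs, β => (fun j => β (xs j)) ∈ A.rel R
  | wtEq a s xs, β => s = A.wt a fun j => β (xs j)
  | not φ, β => ¬ φ.Sat A β
  | or φ ψ, β => φ.Sat A β ∨ ψ.Sat A β
  | ex y φ, β => ∃ b : A.Univ, φ.Sat A (Function.update β y b)
  | sumEq a _ s ys φ, β =>
      s = ∑ᶠ b ∈ {b : Fin (V.wtArity a) → A.Univ | φ.Sat A (Function.extend ys b β)}, A.wt a b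
  | pred P ts _, β => (fun j => (ts j).eval A β) ∈ V.predSem P

/-- Equivalence: the same truth value in every `(σ, W)`-structure under every assignment. -/
def Equivalent (φ ψ : WFormula V) : Prop :=
  ∀ A : PreStructure V, A.IsWeighted → ∀ β : ℕ → A.Univ, φ.Sat A β ↔ ψ.Sat A β

/-- Renaming of all variables, free and bound, by a permutation. -/
def rename (π : Equiv.Perm ℕ) : WFormula V → WFormula V
  | eq x y => eq (π x) (π y)
  | rel R xs => rel R (fun j => π (xs j))
  | wtEq a s xs => wtEq a s (xs.trans π.toEmbedding)
  | not φ => not (φ.rename π)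
  | or φ ψ => or (φ.rename π) (ψ.rename π)
  | ex y φ => ex (π y) (φ.rename π)
  | sumEq a hfin s ys φ => sumEq a hfin s (ys.trans π.toEmbedding) (φ.rename π)
  | pred P ts h => pred P (fun j => (ts j).rename π) (by
      simp only [WTerm.free_rename, ← Finset.biUnion_image]
      exact Finset.card_image_le.trans h)

/-- The first-order formulas. -/
def IsFO : WFormula V → Prop
  | eq _ _ => True
  | rel _ _ => True
  | wtEq _ _ _ => False
  | not φ => φ.IsFO
  | or φ ψ => φ.IsFO ∧ ψ.IsFO
  | ex _ φ => φ.IsFO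
  | sumEq _ _ _ _ _ => False
  | pred _ _ _ => False

def and (φ ψ : WFormula V) : WFormula V := not (or (not φ) (not ψ))

/-- Conjunction of a list of formulas (a tautology for the empty list). -/
def conj : List (WFormula V) → WFormula V
  | [] => not (ex 0 (not (eq 0 0)))
  | [φ] => φ
  | φ :: ψ :: l => and φ (conj (ψ :: l))

/-- `∃ y₁ ⋯ ∃ yₗ φ`. -/
def exs (ys : List ℕ) (φ : WFormula V) : WFormula V := ys.foldr ex φ

/-! ### Locality and Gaifman normal form -/

/-- `φ` is `r`-local around the non-empty set `X` of variables, which contains its free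
variables: for all values of these variables, `φ` holds in the structure iff it holds in the
`r`-neighbourhood of the values. -/
def IsLocalAround (r : ℕ) (X : Finset ℕ) (φ : WFormula V) : Prop :=
  X.Nonempty ∧ φ.free ⊆ X ∧
    ∀ A : PreStructure V, A.IsWeighted → ∀ β : ℕ → A.Univ,
      ∀ (hB : (A.ball r (β '' X)).Nonempty) (β' : ℕ → (A.induce (A.ball r (β '' X)) hB).Univ),
        (∀ x ∈ X, (β' x).val = β x) →
          (φ.Sat A β ↔ φ.Sat (A.induce (A.ball r (β '' X)) hB) β')

/-- `φ` is local around its free variables (there has to be at least one). -/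
def IsLocal (φ : WFormula V) : Prop := ∃ r, φ.IsLocalAround r φ.free

/-- `δ` is a first-order formula `dist(x, y) ≤ r`. -/
def IsDistLE (r x y : ℕ) (δ : WFormula V) : Prop :=
  δ.IsFO ∧ δ.free ⊆ {x, y} ∧
    ∀ A : PreStructure V, A.IsWeighted → ∀ β : ℕ → A.Univ,
      (δ.Sat A β ↔ A.gaifman.edist (β x) (β y) ≤ r)

/-- The list of the formulas `¬ δ yᵢ yⱼ` for `i < j`. -/
def farApart (δ : ℕ → ℕ → WFormula V) : List ℕ → List (WFormula V)
  | [] => []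
  | y :: ys => ys.map (fun z => not (δ y z)) ++ farApart δ ys

/-- Basic-local sentences `∃ y₁ ⋯ ∃ yₗ (⋀_{i<j} dist(yᵢ, yⱼ) > 2r ∧ ⋀ᵢ lam(yᵢ))`. Since no variable
but `x` is free in `lam`, swapping `x` and `yᵢ` throughout `lam` is a capture-avoiding
substitution of `yᵢ` for `x`. -/
def IsBasicLocal (χ : WFormula V) : Prop :=
  ∃ (r x : ℕ) (lam : WFormula V) (ys : List ℕ) (δ : ℕ → ℕ → WFormula V),
    ys ≠ [] ∧ ys.Nodup ∧ lam.IsLocalAround r {x} ∧ (∀ y z, (δ y z).IsDistLE (2 * r) y z) ∧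
      χ = exs ys (conj (farApart δ ys ++ ys.map fun y => lam.rename (Equiv.swap x y)))

/-- Local aggregation sentences `(s = ∑ a(ys).lam(ys))`. -/
def IsLocalAggregation (χ : WFormula V) : Prop :=
  ∃ (a : Fin V.numWt) (hfin : Finite (V.Elem (V.wtType a))) (s : V.Elem (V.wtType a))
    (ys : Fin (V.wtArity a) ↪ ℕ) (lam : WFormula V) (r : ℕ),
      lam.IsLocalAround r (Finset.univ.image ys) ∧ χ = sumEq a hfin s ys lam

/-- Gaifman normal form: Boolean combinations of local formulas, basic-local sentences and local
aggregation sentences. -/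
inductive IsGaifmanNF : WFormula V → Prop
  | loc {φ : WFormula V} : φ.IsLocal → IsGaifmanNF φ
  | basicLocal {φ : WFormula V} : φ.IsBasicLocal → IsGaifmanNF φ
  | aggregation {φ : WFormula V} : φ.IsLocalAggregation → IsGaifmanNF φ
  | not {φ : WFormula V} : IsGaifmanNF φ → IsGaifmanNF (WFormula.not φ)
  | or {φ ψ : WFormula V} : IsGaifmanNF φ → IsGaifmanNF ψ → IsGaifmanNF (WFormula.or φ ψ)

end WFormula

/-! ### Coding of formulas for algorithms -/

/-- A coding of predicate names and constants by natural numbers. Since a ring or group may be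
uncountable, the constants need not be coded injectively; an algorithm only has to be able to
recognise the constant zero and to tell the elements of a finite ring or group apart. Every
injective coding has these properties. -/
structure SymbolCoding (V : Vocabulary.{u, v, w}) where
  pred : V.Pred → ℕ
  pred_injective : Function.Injective pred
  const : (i : V.Ix) → V.Elem i → ℕ
  const_zero : ∀ (i : V.Ix) (s : V.Elem i), const i s = const i 0 → s = 0
  const_injective : ∀ i : V.Ix, Finite (V.Elem i) → Function.Injective (const i)

namespace SymbolCoding

variable {V : Vocabulary.{u, v, w}}

/-- The code of a term: its syntax tree as a natural number. -/
def termCode (c : SymbolCoding V) : {i : V.Ix} → WTerm V i → ℕ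
  | i, .const s => Nat.pair 0 (c.const i s)
  | _, .wt a xs => Nat.pair 1 (Nat.pair a (Encodable.encode (List.ofFn fun j => xs j)))
  | _, .add t₁ t₂ => Nat.pair 2 (Nat.pair (c.termCode t₁) (c.termCode t₂))
  | _, .sub t₁ t₂ => Nat.pair 3 (Nat.pair (c.termCode t₁) (c.termCode t₂))
  | _, .mul _ t₁ t₂ => Nat.pair 4 (Nat.pair (c.termCode t₁) (c.termCode t₂))

/-- The code of a formula: its syntax tree as a natural number. -/
def code (c : SymbolCoding V) : WFormula V → ℕ
  | .eq x y => Nat.pair 0 (Nat.pair x y)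
  | .rel R xs => Nat.pair 1 (Nat.pair R (Encodable.encode (List.ofFn xs)))
  | .wtEq a s xs => Nat.pair 2 (Nat.pair a
      (Nat.pair (c.const _ s) (Encodable.encode (List.ofFn fun j => xs j))))
  | .not φ => Nat.pair 3 (c.code φ)
  | .or φ ψ => Nat.pair 4 (Nat.pair (c.code φ) (c.code ψ))
  | .ex y φ => Nat.pair 5 (Nat.pair y (c.code φ))
  | .sumEq a _ s ys φ => Nat.pair 6 (Nat.pair a (Nat.pair (c.const _ s)
      (Nat.pair (Encodable.encode (List.ofFn fun j => ys j)) (c.code φ))))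
  | .pred P ts _ => Nat.pair 7 (Nat.pair (c.pred P)
      (Encodable.encode (List.ofFn fun j => c.termCode (ts j))))

end SymbolCoding

/-!
Every formula is equivalent to a case distinction whose guards are sentences in Gaifman normal form
and whose bodies are local. Connectives act on the bodies, so it remains to eliminate a binder in
front of one local formula `λ(x, y)`, with tuples of variables `x` and `y`.

If the values of `y` are far from those of `x`, then the truth of `λ` depends on two separated
balls. No tuple of a relation and, by the condition on weights, no tuple of non-zero weight meets
both balls. Hence `λ` decomposes in the manner of Feferman and Vaught: an aggregate over the union
is the sum of two aggregates with values in the same finite group. This leaves formulas `θ(y)` that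
do not mention `x`.

A witness near `x` is found locally. A witness very far from `x` extends every scattered set of
witnesses near `x`. Such a set has at most as many members as `x` has entries, since no entry is
near two of them. Conversely, a scattered set of witnesses that is larger than all those near `x`
has a member far from `x`. So one compares the sizes of the scattered sets of witnesses of `θ` in
the whole structure, which basic-local sentences express, with the sizes of those near `x`.

A sum is the sum of `θ` over all tuples, which is a local aggregation sentence, minus the sum of
`θ` over the tuples near `x`, plus the sum of `λ` over the tuples near `x`. The last two are local,
and tuples of non-zero weight are near or far as a whole.

All constructions are structural recursions, so they are primitive recursive on codes.
-/

open Function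

/-! ### Assignments and graph distances -/

theorem extend_apply_congr {ι κ α : Type*} (f : ι → κ) (b : ι → α) {β β' : κ → α} {x : κ}
    (h : x ∉ Set.range f → β x = β' x) : extend f b β x = extend f b β' x := by
  by_cases hx : ∃ j, f j = x
  · simp only [extend, dif_pos hx]
  · rw [extend_apply' _ _ _ hx, extend_apply' _ _ _ hx, h hx]

theorem update_apply_congr {κ α : Type*} [DecidableEq κ] {y : κ} {b : α} {β β' : κ → α} {x : κ}
    (h : x ≠ y → β x = β' x) : update β y b x = update β' y b x := by
  by_cases hx : x = y <;> simp [hx, h]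

theorem extend_trans_comp {ι κ κ' α : Type*} (f : ι ↪ κ) (e : κ ≃ κ') (b : ι → α)
    (β : κ' → α) : extend (f.trans e.toEmbedding) b β ∘ e = extend f b (β ∘ e) := by
  ext x
  by_cases hx : ∃ j, f j = x
  · obtain ⟨j, rfl⟩ := hx
    rw [f.injective.extend_apply]
    exact (f.trans e.toEmbedding).injective.extend_apply _ _ j
  · rw [extend_apply' _ _ _ hx, comp_apply, extend_apply' _ _ _ (by simpa using hx), comp_apply]

theorem image_update_of_notMem {κ α : Type*} [DecidableEq κ] {β : κ → α} {y : κ} {b : α}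
    {X : Set κ} (hy : y ∉ X) : update β y b '' X = β '' X :=
  Set.image_congr fun _ hx => update_of_ne (ne_of_mem_of_not_mem hx hy) _ _

theorem image_extend_of_notMem {ι κ α : Type*} {f : ι → κ} {b : ι → α} {β : κ → α} {X : Set κ}
    (hf : ∀ j, f j ∉ X) : extend f b β '' X = β '' X :=
  Set.image_congr fun _ hx => extend_apply' _ _ _ fun ⟨j, hj⟩ => hf j (hj ▸ hx)

theorem edist_le_succ_iff {α : Type*} (G : SimpleGraph α) {a b : α} {r : ℕ} :
    G.edist a b ≤ (r + 1 : ℕ) ↔ ∃ z, G.edist a z ≤ r ∧ (z = b ∨ G.Adj z b) := by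
  constructor
  · intro h
    rw [SimpleGraph.edist_comm] at h
    obtain ⟨p, hp⟩ := SimpleGraph.exists_walk_of_edist_ne_top
      (ne_top_of_le_ne_top (ENat.natCast_ne_top _) h)
    rw [← hp] at h
    cases p with
    | nil => exact ⟨a, by simp, .inl rfl⟩
    | @cons _ z _ hadj q =>
      have hq : q.length ≤ r := Nat.le_of_succ_le_succ (by exact_mod_cast h)
      exact ⟨z, SimpleGraph.edist_comm.le.trans (q.edist_le.trans (by exact_mod_cast hq)),
        .inr hadj.symm⟩
  · rintro ⟨z, hz, rfl | hadj⟩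
    · exact hz.trans (by exact_mod_cast Nat.le_succ r)
    · have hzb : G.edist z b ≤ 1 := (SimpleGraph.edist_eq_one_iff_adj.2 hadj).le
      exact G.edist_triangle.trans ((add_le_add hz hzb).trans (by exact_mod_cast le_rfl))

theorem edist_le_of_add_le {α : Type*} {G : SimpleGraph α} {a b c : α} {m n k : ℕ}
    (hab : G.edist a b ≤ m) (hbc : G.edist b c ≤ n) (h : m + n ≤ k) : G.edist a c ≤ k :=
  G.edist_triangle.trans ((add_le_add hab hbc).trans (by exact_mod_cast h))

/-! ### Relativized satisfaction -/

namespace PreStructure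

variable {V : Vocabulary.{u, v, w}}

/-- The aggregate `∑ a(b)` over the tuples `b ∈ P`: the semantic counterpart of `sumEq`. -/
noncomputable def wsum (A : PreStructure V) (a : Fin V.numWt)
    (P : Set (Fin (V.wtArity a) → A.Univ)) : V.Elem (V.wtType a) :=
  ∑ᶠ b ∈ P, A.wt a b

variable {A : PreStructure V} {a : Fin V.numWt} {P Q : Set (Fin (V.wtArity a) → A.Univ)}

theorem finite_tuples (A : PreStructure V) {k : ℕ} (P : Set (Fin k → A.Univ)) : P.Finite := by
  have := A.finite_univ
  exact Set.toFinite P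

theorem wsum_congr (h : ∀ b, A.wt a b ≠ 0 → (b ∈ P ↔ b ∈ Q)) : A.wsum a P = A.wsum a Q :=
  finsum_mem_inter_support_eq' _ _ _ h

theorem wsum_inter_add_sdiff (P Q : Set (Fin (V.wtArity a) → A.Univ)) :
    A.wsum a (P ∩ Q) + A.wsum a (P \ Q) = A.wsum a P :=
  finsum_mem_inter_add_sdiff Q (A.finite_tuples P)

theorem wsum_union (h : Disjoint P Q) : A.wsum a (P ∪ Q) = A.wsum a P + A.wsum a Q :=
  finsum_mem_union h (A.finite_tuples P) (A.finite_tuples Q)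

theorem wsum_eq_sub_add {N : Set (Fin (V.wtArity a) → A.Univ)}
    (h : ∀ b ∉ N, A.wt a b ≠ 0 → (b ∈ P ↔ b ∈ Q)) :
    A.wsum a P = A.wsum a Q - A.wsum a (N ∩ Q) + A.wsum a (N ∩ P) := by
  have hout : A.wsum a (P \ N) = A.wsum a (Q \ N) :=
    wsum_congr fun b hb => and_congr_left fun hbN => h b hbN hb
  rw [← wsum_inter_add_sdiff P N, ← wsum_inter_add_sdiff Q N, hout, Set.inter_comm N,
    Set.inter_comm N]
  abel

end PreStructure

namespace WTerm

variable {V : Vocabulary.{u, v, w}} {A : PreStructure V} {i : V.Ix}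

theorem eval_congr (t : WTerm V i) {β β' : ℕ → A.Univ} (h : ∀ x ∈ t.free, β x = β' x) :
    t.eval A β = t.eval A β' := by
  induction t with
  | const s => rfl
  | wt a xs =>
    simp only [eval]
    congr 1
    ext j
    exact h _ (by simp [free])
  | add t₁ t₂ h₁ h₂ | sub t₁ t₂ h₁ h₂ | mul _ t₁ t₂ h₁ h₂ =>
    simp only [free, Finset.mem_union] at h
    simp only [eval]
    rw [h₁ fun x hx => h x (.inl hx), h₂ fun x hx => h x (.inr hx)]

theorem eval_rename (π : Equiv.Perm ℕ) (t : WTerm V i) (β : ℕ → A.Univ) :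
    (t.rename π).eval A β = t.eval A (β ∘ π) := by
  induction t with
  | const s => rfl
  | wt a xs => rfl
  | add t₁ t₂ h₁ h₂ | sub t₁ t₂ h₁ h₂ | mul _ t₁ t₂ h₁ h₂ => simp only [rename, eval, h₁, h₂]

theorem rename_refl (t : WTerm V i) : t.rename (Equiv.refl ℕ) = t := by
  induction t with
  | const s | wt a xs => rfl
  | add t₁ t₂ h₁ h₂ | sub t₁ t₂ h₁ h₂ | mul _ t₁ t₂ h₁ h₂ => simp only [rename, h₁, h₂]

theorem eval_induce {D : Set A.Univ} (hD : D.Nonempty) (t : WTerm V i)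
    (β : ℕ → (A.induce D hD).Univ) : t.eval (A.induce D hD) β = t.eval A (fun x => (β x).val) := by
  induction t with
  | const s => rfl
  | wt a xs => rfl
  | add t₁ t₂ h₁ h₂ | sub t₁ t₂ h₁ h₂ | mul _ t₁ t₂ h₁ h₂ => simp only [eval, h₁, h₂]

end WTerm

namespace WFormula

variable {V : Vocabulary.{u, v, w}} {A : PreStructure V} {D : Set A.Univ}

/-- Satisfaction in the part of `A` induced on `D`. Assignments take values in the whole of `A`:
this avoids the subtypes of `PreStructure.induce` and makes sense for every `D`. -/
def SatIn (A : PreStructure V) (D : Set A.Univ) : WFormula V → (ℕ → A.Univ) → Prop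
  | eq x y, β => β x = β y
  | rel R xs, β => (fun j => β (xs j)) ∈ A.rel R
  | wtEq a s xs, β => s = A.wt a fun j => β (xs j)
  | not φ, β => ¬ φ.SatIn A D β
  | or φ ψ, β => φ.SatIn A D β ∨ ψ.SatIn A D β
  | ex y φ, β => ∃ b ∈ D, φ.SatIn A D (update β y b)
  | sumEq a _ s ys φ, β =>
      s = A.wsum a {b | (∀ j, b j ∈ D) ∧ φ.SatIn A D (extend ys b β)}
  | pred P ts _, β => (fun j => (ts j).eval A β) ∈ V.predSem P

theorem satIn_univ (φ : WFormula V) (β : ℕ → A.Univ) :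
    φ.SatIn A Set.univ β ↔ φ.Sat A β := by
  induction φ generalizing β with
  | eq x y => rfl
  | rel R xs => rfl
  | wtEq a s xs => rfl
  | not φ ih => simp only [SatIn, Sat, ih]
  | or φ ψ ih₁ ih₂ => simp only [SatIn, Sat, ih₁, ih₂]
  | ex y φ ih => simp only [SatIn, Sat, ih, Set.mem_univ, true_and]
  | sumEq a hfin s ys φ ih =>
    simp only [SatIn, Sat, ih, Set.mem_univ, implies_true, true_and, PreStructure.wsum]
  | pred P ts h => rfl

theorem satIn_congr (φ : WFormula V) {β β' : ℕ → A.Univ} (h : ∀ x ∈ φ.free, β x = β' x) :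
    φ.SatIn A D β ↔ φ.SatIn A D β' := by
  induction φ generalizing β β' with
  | eq x y => simp only [SatIn]; rw [h x (by simp [free]), h y (by simp [free])]
  | rel R xs =>
    simp only [SatIn]
    rw [funext fun j => h (xs j) (by simp [free])]
  | wtEq a s xs =>
    simp only [SatIn]
    rw [funext fun j => h (xs j) (by simp [free])]
  | not φ ih => simp only [SatIn, ih h]
  | or φ ψ ih₁ ih₂ =>
    simp only [free, Finset.mem_union] at h
    simp only [SatIn, ih₁ fun x hx => h x (.inl hx), ih₂ fun x hx => h x (.inr hx)]
  | ex y φ ih =>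
    simp only [SatIn]
    exact exists_congr fun b => and_congr_right fun _ => ih fun x hx =>
      update_apply_congr fun hxy => h x (by simp [free, hx, hxy])
  | sumEq a hfin s ys φ ih =>
    simp only [SatIn]
    have : ∀ b, φ.SatIn A D (extend ys b β) ↔ φ.SatIn A D (extend ys b β') := fun b =>
      ih fun x hx => extend_apply_congr ys b fun hxys =>
        h x (by simpa [free, hx] using hxys)
    simp only [this]
  | pred P ts hP =>
    simp only [SatIn]
    rw [funext fun j => (ts j).eval_congr fun x hx => h x (by
      simp only [free, Finset.mem_biUnion]; exact ⟨j, Finset.mem_univ _, hx⟩)]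

theorem satIn_rename (π : Equiv.Perm ℕ) (φ : WFormula V) (β : ℕ → A.Univ) :
    (φ.rename π).SatIn A D β ↔ φ.SatIn A D (β ∘ π) := by
  induction φ generalizing β with
  | eq x y => rfl
  | rel R xs => rfl
  | wtEq a s xs => rfl
  | not φ ih => simp only [SatIn, rename, ih]
  | or φ ψ ih₁ ih₂ => simp only [SatIn, rename, ih₁, ih₂]
  | ex y φ ih =>
    simp only [SatIn, rename, ih]
    simp only [update_comp_eq_of_injective _ π.injective]
  | sumEq a hfin s ys φ ih =>
    simp only [SatIn, rename, ih, extend_trans_comp]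
  | pred P ts h => simp only [SatIn, rename, WTerm.eval_rename]

theorem wsum_induce (hD : D.Nonempty) (a : Fin V.numWt) {P : Set (Fin (V.wtArity a) → A.Univ)}
    (hP : ∀ b ∈ P, ∀ j, b j ∈ D) :
    (A.induce D hD).wsum a {b | (fun j => (b j).val) ∈ P} = A.wsum a P := by
  refine finsum_mem_eq_of_bijOn (fun b j => (b j).val) ⟨fun b hb => hb, ?_, ?_⟩ fun _ _ => rfl
  · exact fun b _ b' _ h => funext fun j => Subtype.ext (congrFun h j)
  · exact fun b hb => ⟨fun j => ⟨b j, hP b hb j⟩, hb, rfl⟩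

theorem sat_induce (hD : D.Nonempty) (φ : WFormula V) (β : ℕ → (A.induce D hD).Univ) :
    φ.Sat (A.induce D hD) β ↔ φ.SatIn A D (fun x => (β x).val) := by
  induction φ generalizing β with
  | eq x y => exact Subtype.ext_iff
  | rel R xs => rfl
  | wtEq a s xs => rfl
  | not φ ih => simp only [SatIn, Sat, ih]
  | or φ ψ ih₁ ih₂ => simp only [SatIn, Sat, ih₁, ih₂]
  | ex y φ ih =>
    have hupdate (b : (A.induce D hD).Univ) : (fun x => (update β y b x).val) =
        update (fun x => (β x).val) y b.val := comp_update Subtype.val β y b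
    simp only [SatIn, Sat, ih, hupdate]
    exact ⟨fun ⟨b, hb⟩ => ⟨b.val, b.property, hb⟩, fun ⟨b, hb, h⟩ => ⟨⟨b, hb⟩, h⟩⟩
  | sumEq a hfin s ys φ ih =>
    have hextend (b : Fin (V.wtArity a) → (A.induce D hD).Univ) :
        (fun x => (extend ys b β x).val) = extend ys (fun j => (b j).val) (fun x => (β x).val) :=
      funext fun x => apply_extend Subtype.val _ _ x
    simp only [SatIn, Sat, ih, hextend]
    rw [← wsum_induce hD a fun b hb => hb.1]
    have hmem (b : Fin (V.wtArity a) → (A.induce D hD).Univ) (j) : (b j).val ∈ D := (b j).property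
    simp only [Set.mem_ofPred_eq, hmem, implies_true, true_and, PreStructure.wsum]
  | pred P ts h => simp only [SatIn, Sat, WTerm.eval_induce]

theorem free_rename (π : Equiv.Perm ℕ) (φ : WFormula V) :
    (φ.rename π).free = φ.free.image π := by
  induction φ with
  | eq x y => simp [rename, free, Finset.image_insert]
  | rel R xs => ext y; simp [rename, free]
  | wtEq a s xs => ext y; simp [rename, free]
  | not φ ih => simp [rename, free, ih]
  | or φ ψ ih₁ ih₂ => simp [rename, free, ih₁, ih₂, Finset.image_union]
  | ex y φ ih => simp [rename, free, ih, Finset.image_sdiff _ _ π.injective]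
  | sumEq a hfin s ys φ ih =>
    simp only [rename, free, ih, Finset.image_sdiff _ _ π.injective, Finset.image_image]
    rfl
  | pred P ts h =>
    simp only [rename, free, WTerm.free_rename, Finset.biUnion_image]

/-! ### Connectives -/

/-- A valid sentence. -/
def tt : WFormula V := conj []

/-- An unsatisfiable sentence. -/
def ff : WFormula V := not tt

/-- Disjunction of a list of formulas (`ff` for the empty list). -/
def disj (l : List (WFormula V)) : WFormula V := l.foldr or ff

variable {β : ℕ → A.Univ} {φ ψ : WFormula V}

@[simp] theorem satIn_not : (not φ).SatIn A D β ↔ ¬ φ.SatIn A D β := Iff.rfl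

@[simp] theorem satIn_or : (or φ ψ).SatIn A D β ↔ φ.SatIn A D β ∨ ψ.SatIn A D β := Iff.rfl

theorem satIn_ex {y : ℕ} :
    (ex y φ).SatIn A D β ↔ ∃ b ∈ D, φ.SatIn A D (update β y b) := Iff.rfl

@[simp] theorem satIn_and : (and φ ψ).SatIn A D β ↔ φ.SatIn A D β ∧ ψ.SatIn A D β := by
  simp [and]

@[simp] theorem satIn_tt : (tt : WFormula V).SatIn A D β := by
  simp [tt, conj, SatIn]

@[simp] theorem satIn_ff : ¬ (ff : WFormula V).SatIn A D β := by
  simp [ff]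

@[simp] theorem satIn_disj {l : List (WFormula V)} :
    (disj l).SatIn A D β ↔ ∃ φ ∈ l, φ.SatIn A D β := by
  induction l with
  | nil => simp [disj]
  | cons φ l ih => simpa [disj] using or_congr Iff.rfl ih

@[simp] theorem satIn_conj {l : List (WFormula V)} :
    (conj l).SatIn A D β ↔ ∀ φ ∈ l, φ.SatIn A D β := by
  induction l with
  | nil => exact iff_of_true satIn_tt (by simp)
  | cons φ l ih =>
    cases l with
    | nil => simp [conj]
    | cons ψ l => simp only [conj, satIn_and, ih, List.forall_mem_cons]

@[simp] theorem free_and : (and φ ψ).free = φ.free ∪ ψ.free := rfl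

@[simp] theorem free_tt : (tt : WFormula V).free = ∅ := by simp [tt, conj, free]

@[simp] theorem free_ff : (ff : WFormula V).free = ∅ := free_tt

theorem mem_free_disj {l : List (WFormula V)} {x : ℕ} :
    x ∈ (disj l).free ↔ ∃ φ ∈ l, x ∈ φ.free := by
  induction l with
  | nil => simp [disj]
  | cons φ l ih =>
    simp only [disj, List.foldr_cons, free, Finset.mem_union, List.exists_mem_cons_iff] at ih ⊢
    rw [ih]

theorem mem_free_conj {l : List (WFormula V)} {x : ℕ} :
    x ∈ (conj l).free ↔ ∃ φ ∈ l, x ∈ φ.free := by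
  induction l with
  | nil => exact iff_of_false (by simp [conj, free]) (by simp)
  | cons φ l ih =>
    cases l with
    | nil => simp [conj]
    | cons ψ l => simp only [conj, free_and, Finset.mem_union, ih, List.exists_mem_cons_iff]

theorem mem_free_exs {l : List ℕ} {x : ℕ} : x ∈ (exs l φ).free ↔ x ∈ φ.free ∧ x ∉ l := by
  induction l with
  | nil => simp [exs]
  | cons y l ih =>
    simp only [exs, List.foldr_cons, free, Finset.mem_sdiff, Finset.mem_singleton,
      List.mem_cons, not_or] at ih ⊢
    rw [ih]; tauto

theorem satIn_exs {l : List ℕ} :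
    (exs l φ).SatIn A D β ↔
      ∃ β' : ℕ → A.Univ, (∀ x ∉ l, β' x = β x) ∧ (∀ x ∈ l, β' x ∈ D) ∧ φ.SatIn A D β' := by
  induction l generalizing β with
  | nil =>
    simp only [exs, List.foldr_nil, List.not_mem_nil, not_false_eq_true, true_imp_iff,
      false_imp_iff, implies_true, true_and]
    exact ⟨fun h => ⟨β, fun _ => rfl, h⟩, fun ⟨β', h, h'⟩ => (funext h : β' = β) ▸ h'⟩
  | cons y l ih =>
    change (∃ b ∈ D, (exs l φ).SatIn A D (update β y b)) ↔ _
    simp only [ih]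
    constructor
    · rintro ⟨b, hb, β', h₁, h₂, h₃⟩
      refine ⟨β', fun x hx => ?_, fun x hx => ?_, h₃⟩
      · simp only [List.mem_cons, not_or] at hx
        rw [h₁ x hx.2, update_of_ne hx.1]
      · by_cases hl : x ∈ l
        · exact h₂ x hl
        · obtain rfl : x = y := by simpa [hl] using hx
          rw [h₁ x hl, update_self]; exact hb
    · rintro ⟨β', h₁, h₂, h₃⟩
      refine ⟨β' y, h₂ y (by simp), β', fun x hx => ?_, fun x hx => h₂ x (by simp [hx]), h₃⟩
      by_cases hxy : x = y
      · subst hxy; simp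
      · rw [update_of_ne hxy]; exact h₁ x (by simp [hxy, hx])

end WFormula

/-- The assignment that sends `N, …, N + k - 1` to the entries of `t` and agrees with `β`
elsewhere. -/
def assignBlock {α : Type*} (β : ℕ → α) (N : ℕ) {k : ℕ} (t : Fin k → α) (v : ℕ) : α :=
  if h : N ≤ v ∧ v < N + k then t ⟨v - N, by omega⟩ else β v

theorem assignBlock_add {α : Type*} (β : ℕ → α) (N : ℕ) {k : ℕ} (t : Fin k → α) (l : Fin k) :
    assignBlock β N t (N + l) = t l := by
  rw [assignBlock, dif_pos (by omega)]
  congr 1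
  ext; simp

theorem assignBlock_of_not_mem {α : Type*} {β : ℕ → α} {N : ℕ} {k : ℕ} {t : Fin k → α} {v : ℕ}
    (h : ¬ (N ≤ v ∧ v < N + k)) : assignBlock β N t v = β v :=
  dif_neg h

namespace PreStructure

variable {V : Vocabulary.{u, v, w}} {A : PreStructure V}

theorem edist_le_one_of_mem_rel {R : Fin V.numRel} {t : Fin (V.relArity R) → A.Univ}
    (ht : t ∈ A.rel R) (i j : Fin (V.relArity R)) : A.gaifman.edist (t i) (t j) ≤ (1 : ℕ) := by
  by_cases h : t i = t j
  · simp [h]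
  · have hadj : A.gaifman.Adj (t i) (t j) := ⟨h, R, t, ht, ⟨i, rfl⟩, ⟨j, rfl⟩⟩
    exact (SimpleGraph.edist_eq_one_iff_adj.2 hadj).le

theorem ball_mono {r s : ℕ} {X Y : Set A.Univ} (hr : r ≤ s) (hX : X ⊆ Y) :
    A.ball r X ⊆ A.ball s Y :=
  fun _ ⟨a, ha, h⟩ => ⟨a, hX ha, h.trans (by exact_mod_cast hr)⟩

theorem subset_ball (r : ℕ) (X : Set A.Univ) : X ⊆ A.ball r X :=
  fun a ha => ⟨a, ha, by simp⟩

theorem ball_union (r : ℕ) (X Y : Set A.Univ) : A.ball r (X ∪ Y) = A.ball r X ∪ A.ball r Y := by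
  ext b
  simp only [ball, Set.mem_ofPred_eq, Set.mem_union, or_and_right, exists_or]

theorem ball_ball_subset {r s k : ℕ} {X Y : Set A.Univ} (h : r + s ≤ k) (hY : Y ⊆ A.ball r X) :
    A.ball s Y ⊆ A.ball k X := by
  rintro b ⟨a, ha, hab⟩
  obtain ⟨x, hx, hxa⟩ := hY ha
  exact ⟨x, hx, edist_le_of_add_le hxa hab h⟩

end PreStructure

namespace WFormula

variable {V : Vocabulary.{u, v, w}} {A : PreStructure V} {D : Set A.Univ}
  {β : ℕ → A.Univ} {φ ψ : WFormula V}

/-! ### Distance formulas -/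

/-- `z` and `y` occur in a common tuple of `R`. The bound variables start above `z` and `y`. -/
def link (R : Fin V.numRel) (z y : ℕ) : WFormula V :=
  exs (List.range' (z + y + 1) (V.relArity R)) (and (rel R fun l => z + y + 1 + l)
    (and (disj ((List.range (V.relArity R)).map fun l => eq (z + y + 1 + l) z))
      (disj ((List.range (V.relArity R)).map fun l => eq (z + y + 1 + l) y))))

/-- `z` and `y` are equal or adjacent. -/
def distLEOne (z y : ℕ) : WFormula V :=
  or (eq z y) (disj ((List.finRange V.numRel).map fun R => link R z y))

/-- The distance from `x` to `y` is at most `r`; the bound variable is above `x` and `y`. -/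
def distLE : ℕ → ℕ → ℕ → WFormula V
  | 0, x, y => eq x y
  | r + 1, x, y => ex (x + y + 1) (and (distLE r x (x + y + 1)) (distLEOne (x + y + 1) y))

theorem isFO_exs (l : List ℕ) : (exs l φ).IsFO ↔ φ.IsFO := by
  induction l with
  | nil => rfl
  | cons _ _ ih => exact ih

theorem isFO_disj {l : List (WFormula V)} (h : ∀ φ ∈ l, φ.IsFO) : (disj l).IsFO := by
  induction l with
  | nil => simp [disj, ff, tt, conj, IsFO]
  | cons φ l ih => exact ⟨h φ (by simp), ih fun ψ hψ => h ψ (by simp [hψ])⟩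

theorem isFO_distLE (r x y : ℕ) : (distLE r x y : WFormula V).IsFO := by
  induction r generalizing y with
  | zero => trivial
  | succ r ih =>
    refine ⟨ih _, trivial, isFO_disj fun φ hφ => ?_⟩
    simp only [List.mem_map, List.mem_finRange, true_and] at hφ
    obtain ⟨R, rfl⟩ := hφ
    rw [link, isFO_exs]
    refine ⟨trivial, isFO_disj ?_, isFO_disj ?_⟩ <;>
    · intro φ hφ
      simp only [List.mem_map] at hφ
      obtain ⟨l, -, rfl⟩ := hφ
      trivial

theorem free_link_subset (R : Fin V.numRel) (z y : ℕ) :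
    (link R z y : WFormula V).free ⊆ {z, y} := by
  intro x hx
  rw [link, mem_free_exs] at hx
  obtain ⟨hx, hx'⟩ := hx
  simp only [free_and, Finset.mem_union, mem_free_disj, List.mem_map, List.mem_range,
    exists_exists_and_eq_and, free, Finset.mem_insert, Finset.mem_singleton, Finset.mem_image,
    Finset.mem_univ, true_and] at hx
  simp only [List.mem_range'_1] at hx'
  simp only [Finset.mem_insert, Finset.mem_singleton]
  rcases hx with ⟨l, hl⟩ | ⟨l, hl, h⟩ | ⟨l, hl, h⟩
  · have := l.2
    omega
  all_goals omega

theorem free_distLEOne_subset (z y : ℕ) : (distLEOne z y : WFormula V).free ⊆ {z, y} := by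
  intro x hx
  simp only [distLEOne, free, Finset.mem_union, mem_free_disj, List.mem_map, List.mem_finRange,
    true_and, exists_exists_eq_and] at hx
  exact hx.elim id fun ⟨R, hR⟩ => free_link_subset R _ _ hR

theorem free_distLE_subset (r x y : ℕ) : (distLE r x y : WFormula V).free ⊆ {x, y} := by
  induction r generalizing y with
  | zero => exact Finset.Subset.refl _
  | succ r ih =>
    simp only [distLE, free, free_and]
    have h₁ := ih (x + y + 1)
    have h₂ := free_distLEOne_subset (V := V) (x + y + 1) y
    grind

theorem satIn_link {R : Fin V.numRel} {z y : ℕ} :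
    (link R z y).SatIn A D β ↔
      ∃ t ∈ A.rel R, (∀ i, t i ∈ D) ∧ β z ∈ Set.range t ∧ β y ∈ Set.range t := by
  rw [link, satIn_exs]
  simp only [satIn_and, satIn_disj, List.mem_map, List.mem_range, exists_exists_and_eq_and,
    List.mem_range'_1, SatIn]
  constructor
  · rintro ⟨β', h₁, h₂, h₃, ⟨i, hi, hiz⟩, ⟨j, hj, hjy⟩⟩
    refine ⟨_, h₃, fun l => h₂ _ (by omega), ⟨⟨i, hi⟩, ?_⟩, ⟨⟨j, hj⟩, ?_⟩⟩
    · exact hiz.trans (h₁ z (by omega))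
    · exact hjy.trans (h₁ y (by omega))
  · rintro ⟨t, ht, hD, ⟨i, hi⟩, ⟨j, hj⟩⟩
    refine ⟨assignBlock β (z + y + 1) t, fun v hv => assignBlock_of_not_mem hv, fun v hv => ?_,
      ?_, ⟨i, i.2, ?_⟩, ⟨j, j.2, ?_⟩⟩
    · obtain ⟨l, hl⟩ := Nat.exists_eq_add_of_le hv.1
      rw [hl, assignBlock_add _ _ _ ⟨l, by omega⟩]; exact hD _
    · simpa only [assignBlock_add] using ht
    · rw [assignBlock_add, assignBlock_of_not_mem (by omega), hi]
    · rw [assignBlock_add, assignBlock_of_not_mem (by omega), hj]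

theorem satIn_distLEOne {z y : ℕ} :
    (distLEOne z y).SatIn A D β ↔
      β z = β y ∨ ∃ R, (link R z y).SatIn A D β := by
  simp only [distLEOne, satIn_or, satIn_disj, List.mem_map, List.mem_finRange, true_and,
    exists_exists_eq_and, SatIn]

theorem eq_or_adj_of_satIn_distLEOne {z y : ℕ} (h : (distLEOne z y).SatIn A D β) :
    β z = β y ∨ A.gaifman.Adj (β z) (β y) := by
  simp only [satIn_distLEOne, satIn_link] at h
  rcases h with h | ⟨R, t, ht, -, hz, hy⟩
  · exact .inl h
  · exact or_iff_not_imp_left.2 fun he => ⟨he, R, t, ht, hz, hy⟩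

theorem edist_le_of_satIn_distLE {r x y : ℕ} (h : (distLE r x y).SatIn A D β) :
    A.gaifman.edist (β x) (β y) ≤ r := by
  induction r generalizing y β with
  | zero =>
    simp only [distLE, SatIn] at h
    simp [h]
  | succ r ih =>
    simp only [distLE, SatIn, satIn_and] at h
    obtain ⟨b, -, h₁, h₂⟩ := h
    have h₁ := ih h₁
    have h₂ := eq_or_adj_of_satIn_distLEOne h₂
    rw [update_self, update_of_ne (by omega)] at h₁ h₂
    exact (edist_le_succ_iff _).2 ⟨b, h₁, h₂⟩

theorem satIn_distLE {r x y : ℕ} (hD : A.ball r {β x} ⊆ D) :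
    (distLE r x y).SatIn A D β ↔ A.gaifman.edist (β x) (β y) ≤ r := by
  refine ⟨edist_le_of_satIn_distLE, fun h => ?_⟩
  induction r generalizing y β with
  | zero => simpa [distLE, SatIn] using h
  | succ r ih =>
    obtain ⟨z, hz, hzy⟩ := (edist_le_succ_iff _).1 h
    simp only [distLE, SatIn, satIn_and]
    have hx : update β (x + y + 1) z x = β x := update_of_ne (by omega) _ _
    have hy : update β (x + y + 1) z y = β y := update_of_ne (by omega) _ _
    refine ⟨z, hD ⟨_, rfl, hz.trans (by exact_mod_cast Nat.le_succ r)⟩, ih ?_ ?_, ?_⟩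
    · rw [hx]
      exact (PreStructure.ball_mono (Nat.le_succ r) subset_rfl).trans hD
    · rw [hx, update_self]; exact hz
    · simp only [satIn_distLEOne, satIn_link, hy, update_self]
      refine hzy.imp_right fun ⟨_, R, t, ht, htz, hty⟩ => ⟨R, t, ht, fun i => ?_, htz, hty⟩
      obtain ⟨j, rfl⟩ := htz
      exact hD ⟨_, rfl, edist_le_of_add_le hz
        (PreStructure.edist_le_one_of_mem_rel ht j i) le_rfl⟩

theorem isDistLE_distLE (r x y : ℕ) : (distLE r x y : WFormula V).IsDistLE r x y :=
  ⟨isFO_distLE r x y, free_distLE_subset r x y, fun _ _ _ =>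
    (satIn_univ _ _).symm.trans (satIn_distLE (Set.subset_univ _))⟩

/-- `y` is at distance at most `r` from one of the variables in `X`. -/
def near (r : ℕ) (X : List ℕ) (y : ℕ) : WFormula V := disj (X.map fun x => distLE r x y)

theorem satIn_near {r y : ℕ} {X : List ℕ} (hD : A.ball r (β '' {x | x ∈ X}) ⊆ D) :
    (near r X y).SatIn A D β ↔ β y ∈ A.ball r (β '' {x | x ∈ X}) := by
  simp only [near, satIn_disj, List.mem_map, exists_exists_and_eq_and, PreStructure.ball,
    Set.mem_ofPred_eq, Set.exists_mem_image]
  refine exists_congr fun x => and_congr_right fun hx => satIn_distLE ?_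
  exact (PreStructure.ball_mono le_rfl (by simpa using ⟨x, hx, rfl⟩)).trans hD

theorem eq_or_mem_of_mem_free_near {r y v : ℕ} {X : List ℕ}
    (hv : v ∈ (near r X y : WFormula V).free) : v = y ∨ v ∈ X := by
  simp only [near, mem_free_disj, List.mem_map, exists_exists_and_eq_and] at hv
  obtain ⟨x, hx, hv⟩ := hv
  have := free_distLE_subset r x y hv
  simp only [Finset.mem_insert, Finset.mem_singleton] at this
  rcases this with rfl | rfl
  exacts [.inr hx, .inl rfl]

/-- All variables in `Y` are at distance at most `r` from one of the variables in `X`. -/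
def allNear (r : ℕ) (X Y : List ℕ) : WFormula V := conj (Y.map (near r X))

theorem satIn_allNear {r : ℕ} {X Y : List ℕ} (hD : A.ball r (β '' {x | x ∈ X}) ⊆ D) :
    (allNear r X Y).SatIn A D β ↔ ∀ y ∈ Y, β y ∈ A.ball r (β '' {x | x ∈ X}) := by
  simp only [allNear, satIn_conj, List.forall_mem_map, satIn_near hD]

theorem mem_or_mem_of_mem_free_allNear {r v : ℕ} {X Y : List ℕ}
    (hv : v ∈ (allNear r X Y : WFormula V).free) : v ∈ Y ∨ v ∈ X := by
  simp only [allNear, mem_free_conj, List.mem_map, exists_exists_and_eq_and] at hv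
  obtain ⟨y, hy, hv⟩ := hv
  exact (eq_or_mem_of_mem_free_near hv).imp_left fun h => by rwa [h]

/-! ### Strong locality -/

/-- A form of locality that passes through the inductive constructions: the set `X` may be empty,
`φ` has the same truth value in all parts of the structure that contain the `r`-ball around `X`,
and the weights need not satisfy the locality condition. -/
def StronglyLocal (r : ℕ) (X : Set ℕ) (φ : WFormula V) : Prop :=
  ↑φ.free ⊆ X ∧ ∀ (A : PreStructure V) (D : Set A.Univ) (β : ℕ → A.Univ),
    A.ball r (β '' X) ⊆ D → (φ.SatIn A D β ↔ φ.SatIn A Set.univ β)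

namespace StronglyLocal

variable {r s : ℕ} {X Y : Set ℕ}

theorem mono (h : φ.StronglyLocal r X) (hr : r ≤ s) (hX : X ⊆ Y) : φ.StronglyLocal s Y :=
  ⟨h.1.trans hX, fun A D β hD =>
    h.2 A D β ((PreStructure.ball_mono hr (Set.image_mono hX)).trans hD)⟩

protected theorem not (h : φ.StronglyLocal r X) : φ.not.StronglyLocal r X :=
  ⟨h.1, fun A D β hD => not_congr (h.2 A D β hD)⟩

protected theorem or (h : φ.StronglyLocal r X) (h' : ψ.StronglyLocal r X) :
    (φ.or ψ).StronglyLocal r X :=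
  ⟨by simpa [free] using ⟨h.1, h'.1⟩,
    fun A D β hD => or_congr (h.2 A D β hD) (h'.2 A D β hD)⟩

protected theorem and (h : φ.StronglyLocal r X) (h' : ψ.StronglyLocal r X) :
    (φ.and ψ).StronglyLocal r X :=
  (h.not.or h'.not).not

protected theorem tt : (tt : WFormula V).StronglyLocal r X :=
  ⟨by simp, by simp⟩

protected theorem ff : (ff : WFormula V).StronglyLocal r X :=
  StronglyLocal.tt.not

protected theorem conj {l : List (WFormula V)} (h : ∀ φ ∈ l, φ.StronglyLocal r X) :
    (conj l).StronglyLocal r X := by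
  induction l with
  | nil => exact .tt
  | cons φ l ih =>
    cases l with
    | nil => exact h φ (by simp)
    | cons ψ l => exact (h φ (by simp)).and (ih fun ψ hψ => h ψ (List.mem_cons_of_mem _ hψ))

protected theorem disj {l : List (WFormula V)} (h : ∀ φ ∈ l, φ.StronglyLocal r X) :
    (disj l).StronglyLocal r X := by
  induction l with
  | nil => exact .ff
  | cons φ l ih => exact (h φ (by simp)).or (ih fun ψ hψ => h ψ (by simp [hψ]))

protected theorem rename (h : φ.StronglyLocal r X) (e : Equiv.Perm ℕ) :
    (φ.rename e).StronglyLocal r (e '' X) := by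
  refine ⟨?_, fun A D β hD => ?_⟩
  · rw [free_rename, Finset.coe_image]
    exact Set.image_mono h.1
  · rw [satIn_rename, satIn_rename]
    exact h.2 A D _ (by rwa [Set.image_comp])

theorem isLocalAround {X : Finset ℕ} (h : φ.StronglyLocal r X) (hX : X.Nonempty) :
    φ.IsLocalAround r X := by
  refine ⟨hX, by exact_mod_cast h.1, fun A _ β hB β' hβ => ?_⟩
  rw [← satIn_univ, sat_induce, ← h.2 A _ β subset_rfl]
  exact satIn_congr φ fun x hx => (hβ x (h.1 hx)).symm

theorem congr (h : φ.StronglyLocal r X) {β β' : ℕ → A.Univ} (hβ : ∀ x ∈ X, β x = β' x) :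
    φ.SatIn A D β ↔ φ.SatIn A D β' :=
  satIn_congr φ fun x hx => hβ x (h.1 hx)

end StronglyLocal

end WFormula

/-- A strict upper bound for the entries of a list. -/
def listBound (l : List ℕ) : ℕ := l.foldr max 0 + 1

theorem lt_listBound {l : List ℕ} {x : ℕ} (h : x ∈ l) : x < listBound l := by
  induction l with
  | nil => simp at h
  | cons y l ih =>
    simp only [listBound, List.foldr_cons] at ih ⊢
    rcases List.mem_cons.1 h with rfl | h
    · omega
    · have := ih h
      omega

/-- The list of the variables that occur in a term. -/
def WTerm.vars {V : Vocabulary.{u, v, w}} : {i : V.Ix} → WTerm V i → List ℕ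
  | _, const _ => []
  | _, wt _ xs => List.ofFn xs
  | _, add t₁ t₂ => t₁.vars ++ t₂.vars
  | _, sub t₁ t₂ => t₁.vars ++ t₂.vars
  | _, mul _ t₁ t₂ => t₁.vars ++ t₂.vars

theorem WTerm.mem_vars {V : Vocabulary.{u, v, w}} {i : V.Ix} (t : WTerm V i) {x : ℕ} :
    x ∈ t.vars ↔ x ∈ t.free := by
  induction t with
  | const s => simp [vars, free]
  | wt a xs => simp [vars, free, List.mem_ofFn]
  | add t₁ t₂ h₁ h₂ | sub t₁ t₂ h₁ h₂ | mul _ t₁ t₂ h₁ h₂ => simp [vars, free, h₁, h₂]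

namespace WFormula

variable {V : Vocabulary.{u, v, w}} {A : PreStructure V} {D : Set A.Univ}
  {β : ℕ → A.Univ} {φ ψ : WFormula V}

/-- The variables of an atomic formula (none for other formulas). -/
def leafVars : WFormula V → List ℕ
  | eq x y => [x, y]
  | rel _ xs => List.ofFn xs
  | wtEq _ _ xs => List.ofFn xs
  | pred _ ts _ => (List.ofFn fun j => (ts j).vars).flatten
  | _ => []

/-- The free variables as a list. -/
def freeList : WFormula V → List ℕ
  | not φ => φ.freeList
  | or φ ψ => φ.freeList ++ ψ.freeList
  | ex y φ => φ.freeList.filter fun x => decide (x ∉ [y])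
  | sumEq _ _ _ ys φ => φ.freeList.filter fun x => decide (x ∉ List.ofFn ys)
  | φ => φ.leafVars

/-- A strict upper bound for all variables that occur in a formula. -/
def bound : WFormula V → ℕ
  | not φ => φ.bound
  | or φ ψ => max φ.bound ψ.bound
  | ex y φ => max (listBound [y]) φ.bound
  | sumEq _ _ _ ys φ => max (listBound (List.ofFn ys)) φ.bound
  | φ => listBound φ.leafVars

theorem lt_bound_ex {y : ℕ} : y < (ex y φ).bound :=
  (lt_listBound (List.mem_singleton_self y)).trans_le (le_max_left _ _)

theorem lt_bound_sumEq {a : Fin V.numWt} {hfin : Finite (V.Elem (V.wtType a))}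
    {s : V.Elem (V.wtType a)} {ys : Fin (V.wtArity a) ↪ ℕ} (j : Fin (V.wtArity a)) :
    ys j < (sumEq a hfin s ys φ).bound :=
  (lt_listBound (List.mem_ofFn.2 ⟨j, rfl⟩)).trans_le (le_max_left _ _)

theorem mem_leafVars_pred {P : V.Pred} {ts : (j : Fin (V.predArity P)) → WTerm V (V.predType P j)}
    {h : (Finset.univ.biUnion fun j => (ts j).free).card ≤ 1} {x : ℕ} :
    x ∈ (pred P ts h).leafVars ↔ x ∈ (pred P ts h).free := by
  simp [leafVars, free, List.mem_flatten, List.mem_ofFn, WTerm.mem_vars]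

theorem mem_freeList (φ : WFormula V) {x : ℕ} : x ∈ φ.freeList ↔ x ∈ φ.free := by
  induction φ with
  | eq x y => simp [freeList, leafVars, free]
  | rel R xs => simp [freeList, leafVars, free, List.mem_ofFn]
  | wtEq a s xs => simp [freeList, leafVars, free, List.mem_ofFn]
  | not φ ih => simpa [freeList, free] using ih
  | or φ ψ ih₁ ih₂ => simp [freeList, free, ih₁, ih₂]
  | ex y φ ih => simp [freeList, free, ih]
  | sumEq a hfin s ys φ ih => simp [freeList, free, ih, List.mem_ofFn]
  | pred P ts h => exact mem_leafVars_pred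

theorem toFinset_freeList (φ : WFormula V) : φ.freeList.toFinset = φ.free := by
  ext x; simp [mem_freeList]

/-! ### Relativization to balls -/

/-- Relativization of all quantifiers and sums to the `r`-ball around the variables in `C`,
which must not be bound in the formula. -/
def relat (C : List ℕ) (r : ℕ) : WFormula V → WFormula V
  | not φ => not (φ.relat C r)
  | or φ ψ => or (φ.relat C r) (ψ.relat C r)
  | ex y φ => ex y (and (allNear r C [y]) (φ.relat C r))
  | sumEq a hfin s ys φ => sumEq a hfin s ys (and (allNear r C (List.ofFn ys)) (φ.relat C r))
  | φ => φ

theorem satIn_relat {C : List ℕ} {r : ℕ} {B : Set A.Univ} (φ : WFormula V)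
    (hC : ∀ x ∈ C, φ.bound ≤ x) (hB : A.ball r (β '' {x | x ∈ C}) = B) (hD : B ⊆ D) :
    (φ.relat C r).SatIn A D β ↔ φ.SatIn A B β := by
  induction φ generalizing β with
  | eq x y | rel R xs | wtEq a s xs | pred P ts h => rfl
  | not φ ih => exact not_congr (ih hC hB)
  | or φ ψ ih₁ ih₂ =>
    exact or_congr (ih₁ (fun x hx => (le_max_left _ _).trans (hC x hx)) hB)
      (ih₂ (fun x hx => (le_max_right _ _).trans (hC x hx)) hB)
  | ex y φ ih =>
    have hB' b : A.ball r (update β y b '' {x | x ∈ C}) = B := by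
      rw [image_update_of_notMem (X := {x | x ∈ C}) fun h => (hC y h).not_gt lt_bound_ex, hB]
    have hφ b := ih (β := update β y b) (fun x hx => (le_max_right _ _).trans (hC x hx)) (hB' b)
    have hnear b : (allNear r C [y]).SatIn A D (update β y b) ↔ b ∈ B := by
      rw [satIn_allNear ((hB' b).trans_subset hD), hB', List.forall_mem_singleton, update_self]
    simp only [relat, SatIn, satIn_and, hφ, hnear]
    exact exists_congr fun b => and_iff_right_of_imp fun h => hD h.1
  | sumEq a hfin s ys φ ih =>
    have hB' b : A.ball r (extend ys b β '' {x | x ∈ C}) = B := by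
      rw [image_extend_of_notMem (X := {x | x ∈ C}) fun j h =>
        (hC (ys j) h).not_gt (lt_bound_sumEq j), hB]
    have hφ b := ih (β := extend ys b β)
      (fun x hx => (le_max_right _ _).trans (hC x hx)) (hB' b)
    have hnear b : (allNear r C (List.ofFn ys)).SatIn A D (extend ys b β) ↔ ∀ j, b j ∈ B := by
      simp only [satIn_allNear ((hB' b).trans_subset hD), hB', List.forall_mem_ofFn_iff,
        ys.injective.extend_apply]
    simp only [relat, SatIn, satIn_and, hφ, hnear]
    exact Eq.congr_right (congrArg _ (Set.ext fun b =>
      and_iff_right_of_imp fun h j => hD (h.1 j)))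

theorem mem_or_mem_of_mem_free_relat {C : List ℕ} {r x : ℕ} (hx : x ∈ (φ.relat C r).free) :
    x ∈ φ.free ∨ x ∈ C := by
  induction φ with
  | eq | rel | wtEq | pred => exact .inl hx
  | not φ ih => exact ih hx
  | or φ ψ ih₁ ih₂ =>
    simp only [relat, free, Finset.mem_union] at hx ⊢
    tauto
  | ex y φ ih =>
    simp only [relat, free, free_and, Finset.mem_sdiff, Finset.mem_union,
      Finset.mem_singleton] at hx ⊢
    obtain ⟨h | h, hxy⟩ := hx
    · exact .inr ((mem_or_mem_of_mem_free_allNear h).resolve_left (by simpa using hxy))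
    · exact (ih h).imp_left fun h => ⟨h, hxy⟩
  | sumEq a hfin s ys φ ih =>
    simp only [relat, free, free_and, Finset.mem_sdiff, Finset.mem_union, Finset.mem_image,
      Finset.mem_univ, true_and] at hx ⊢
    obtain ⟨h | h, hxs⟩ := hx
    · exact .inr ((mem_or_mem_of_mem_free_allNear h).resolve_left
        (by simpa only [List.mem_ofFn] using hxs))
    · exact (ih h).imp_left fun h => ⟨h, hxs⟩

/-- `∃ x̂ (x̂ = x ∧ φ)` for all `x` in `X`, where `x̂ = x + N`. -/
def withCopies (X : List ℕ) (N : ℕ) (φ : WFormula V) : WFormula V :=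
  X.foldr (fun x ψ => ex (x + N) (and (eq (x + N) x) ψ)) φ

/-- The assignment that sends the copy `x + N` of each `x` in `X` to the value of `x` and agrees
with `β` elsewhere. -/
def copyValues {α : Type*} (X : List ℕ) (N : ℕ) (β : ℕ → α) (v : ℕ) : α :=
  if v ∈ X.map (· + N) then β (v - N) else β v

theorem copyValues_add {α : Type*} {X : List ℕ} {N x : ℕ} (hx : x ∈ X) (β : ℕ → α) :
    copyValues X N β (x + N) = β x := by
  rw [copyValues, if_pos (List.mem_map_of_mem hx), Nat.add_sub_cancel]

theorem copyValues_of_lt {α : Type*} {X : List ℕ} {N x : ℕ} (hx : x < N) (β : ℕ → α) :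
    copyValues X N β x = β x := by
  refine if_neg fun h => ?_
  obtain ⟨z, -, h⟩ := List.mem_map.1 h
  omega

theorem image_copyValues {α : Type*} (X : List ℕ) (N : ℕ) (β : ℕ → α) :
    copyValues X N β '' {x | x ∈ X.map (· + N)} = β '' {x | x ∈ X} := by
  ext a
  simp only [Set.mem_image, Set.mem_ofPred_eq, List.mem_map, exists_exists_and_eq_and]
  exact exists_congr fun x => and_congr_right fun hx => by rw [copyValues_add hx]

theorem copyValues_update {α : Type*} {x : ℕ} {X : List ℕ} {N : ℕ} (hX : ∀ z ∈ X, z < N)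
    (β : ℕ → α) : copyValues X N (update β (x + N) (β x)) = copyValues (x :: X) N β := by
  ext v
  by_cases hv : v ∈ X.map (· + N)
  · obtain ⟨z, hz, rfl⟩ := List.mem_map.1 hv
    have := hX z hz
    rw [copyValues_add hz, copyValues_add (.tail _ hz), update_of_ne (by omega)]
  · by_cases hvx : v = x + N
    · subst hvx
      rw [copyValues_add List.mem_cons_self, copyValues, if_neg hv, update_self]
    · simp [copyValues, hv, hvx]

theorem satIn_withCopies {X : List ℕ} {N : ℕ} (hX : ∀ x ∈ X, x < N) (hD : ∀ x ∈ X, β x ∈ D) :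
    (withCopies X N φ).SatIn A D β ↔ φ.SatIn A D (copyValues X N β) := by
  induction X generalizing β with
  | nil => exact satIn_congr φ fun v _ => (if_neg List.not_mem_nil).symm
  | cons x X ih =>
    have hX' : ∀ z ∈ X, z < N := fun z hz => hX z (by simp [hz])
    have hx b : update β (x + N) b x = β x := update_of_ne (by have := hX x (by simp); omega) _ _
    have hD' b : ∀ z ∈ X, update β (x + N) b z ∈ D := fun z hz => by
      rw [update_of_ne (by have := hX' z hz; omega)]
      exact hD z (by simp [hz])
    change (∃ b ∈ D, (and (eq (x + N) x) (withCopies X N φ)).SatIn A D _) ↔ _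
    simp only [satIn_and, ih hX' (hD' _), SatIn, update_self, hx, ← copyValues_update hX']
    exact ⟨fun ⟨_, _, hb, h⟩ => hb ▸ h, fun h => ⟨β x, hD x (by simp), rfl, h⟩⟩

theorem mem_of_mem_free_withCopies {X : List ℕ} {N v : ℕ} (hv : v ∈ (withCopies X N φ).free) :
    v ∈ φ.free ∧ v ∉ X.map (· + N) ∨ v ∈ X := by
  induction X with
  | nil => simpa [withCopies] using hv
  | cons x X ih =>
    change v ∈ (ex (x + N) (and (eq (x + N) x) (withCopies X N φ))).free at hv
    simp only [free, free_and, Finset.mem_sdiff, Finset.mem_union, Finset.mem_insert,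
      Finset.mem_singleton] at hv
    obtain ⟨(h | h) | h, hv⟩ := hv
    · exact absurd h hv
    · simp [h]
    · have := ih h
      simp only [List.map_cons, List.mem_cons]
      tauto

/-- The formula that says that `φ` holds in the `r`-ball around the variables in `X`. As the
quantifiers of `φ` may bind variables of `X`, the ball is described by fresh copies of them. -/
def inBall (r : ℕ) (X : List ℕ) (φ : WFormula V) : WFormula V :=
  withCopies X (max φ.bound (listBound X))
    (φ.relat (X.map (· + max φ.bound (listBound X))) r)

theorem free_inBall_subset {r : ℕ} {X : List ℕ} (h : φ.free ⊆ X.toFinset) :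
    (inBall r X φ).free ⊆ X.toFinset := by
  intro v hv
  rcases mem_of_mem_free_withCopies hv with ⟨hv, hvX⟩ | hv
  · exact h ((mem_or_mem_of_mem_free_relat hv).resolve_right hvX)
  · exact List.mem_toFinset.2 hv

theorem satIn_inBall {r : ℕ} {X : List ℕ} (hφ : φ.free ⊆ X.toFinset)
    (hD : A.ball r (β '' {x | x ∈ X}) ⊆ D) :
    (inBall r X φ).SatIn A D β ↔ φ.SatIn A (A.ball r (β '' {x | x ∈ X})) β := by
  have hlt : ∀ x ∈ X, x < max φ.bound (listBound X) := fun x hx =>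
    (lt_listBound hx).trans_le (le_max_right _ _)
  rw [inBall, satIn_withCopies hlt fun x hx => hD (PreStructure.subset_ball _ _ ⟨x, hx, rfl⟩),
    satIn_relat φ _ (congrArg _ (image_copyValues _ _ _)) hD]
  · exact satIn_congr φ fun x hx => copyValues_of_lt (hlt x (List.mem_toFinset.1 (hφ hx))) β
  · intro x hx
    obtain ⟨z, -, rfl⟩ := List.mem_map.1 hx
    exact (le_max_left _ _).trans (Nat.le_add_left _ _)

theorem stronglyLocal_inBall {r : ℕ} {X : List ℕ} (hφ : φ.free ⊆ X.toFinset) :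
    (inBall r X φ).StronglyLocal r {x | x ∈ X} := by
  refine ⟨fun x hx => by simpa using free_inBall_subset hφ hx, fun A D β hD => ?_⟩
  rw [satIn_inBall hφ hD, satIn_inBall hφ (Set.subset_univ _)]

end WFormula

namespace WFormula

variable {V : Vocabulary.{u, v, w}} {A : PreStructure V} {D D₁ D₂ : Set A.Univ}
  {β β' : ℕ → A.Univ} {φ ψ : WFormula V}

/-! ### Case distinctions -/

/-- A case distinction: a list of pairs of a guard and a body. -/
abbrev Cases (V : Vocabulary.{u, v, w}) : Type (max u v w) := List (WFormula V × WFormula V)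

namespace Cases

/-- One of the guards holds in `D`. -/
def Exhaustive (l : Cases V) (A : PreStructure V) (D : Set A.Univ) (β : ℕ → A.Univ) : Prop :=
  ∃ c ∈ l, c.1.SatIn A D β

/-- The guards (evaluated in `D₁`) exhaust all cases, and under each of them the truth value `T`
is that of the body (evaluated in `D₂`). -/
def Decides (l : Cases V) (A : PreStructure V) (D₁ D₂ : Set A.Univ) (β : ℕ → A.Univ)
    (T : Prop) : Prop :=
  l.Exhaustive A D₁ β ∧ ∀ c ∈ l, c.1.SatIn A D₁ β → (T ↔ c.2.SatIn A D₂ β)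

/-- Turns the disjunction of `base` and of all `μ ∧ θ` with `(μ, θ)` in the list into a case
distinction: the guards say which of the formulas `θ` hold, and the body is the disjunction of
`base` and of the corresponding formulas `μ`. -/
def expand (base : WFormula V) (l : Cases V) : Cases V :=
  l.foldr (fun c acc => acc.flatMap fun d =>
    [(and c.2 d.1, or c.1 d.2), (and (not c.2) d.1, d.2)]) [(tt, base)]

/-- Exchange of the roles of guards and bodies. -/
def swap (l : Cases V) : Cases V := expand ff l

/-- The negation of what is decided. -/
def neg (l : Cases V) : Cases V := l.map fun c => (c.1, not c.2)

/-- All pairs of a case of `l` and a case of `m`, their bodies being combined by `op`. -/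
def combine (op : WFormula V → WFormula V → WFormula V) (l m : Cases V) : Cases V :=
  l.flatMap fun c => m.map fun d => (and c.1 d.1, op c.2 d.2)

/-- The conjunction of what is decided. -/
def both (l m : Cases V) : Cases V := combine and l m

/-- The disjunction of what is decided. -/
def either (l m : Cases V) : Cases V := combine or l m

/-- The disjunction of what the members of a list decide. -/
def any (ls : List (Cases V)) : Cases V := ls.foldr either [(tt, ff)]

/-- Applies a syntactic operation, such as a binder, to the bodies. -/
def mapBody (f : WFormula V → WFormula V) (l : Cases V) : Cases V := l.map fun c => (c.1, f c.2)

/-- Applies a syntactic operation to the guards. They need not remain exhaustive, so the roles of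
guards and bodies are exchanged before and after. -/
def mapGuard (f : WFormula V → WFormula V) (l : Cases V) : Cases V := (l.swap.mapBody f).swap

variable {l m : Cases V} {T S : Prop}

theorem mem_combine {op : WFormula V → WFormula V → WFormula V} {d : WFormula V × WFormula V} :
    d ∈ combine op l m ↔ ∃ c ∈ l, ∃ e ∈ m, (and c.1 e.1, op c.2 e.2) = d := by
  simp [combine, List.mem_flatMap]

theorem exhaustive_expand (base : WFormula V) (l : Cases V) :
    (expand base l).Exhaustive A D β := by
  induction l with
  | nil => exact ⟨_, List.mem_singleton_self _, satIn_tt⟩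
  | cons c l ih =>
    obtain ⟨d, hd, h⟩ := ih
    by_cases hc : c.2.SatIn A D β
    · exact ⟨(and c.2 d.1, or c.1 d.2), List.mem_flatMap.2 ⟨d, hd, by simp⟩, by simp [hc, h]⟩
    · exact ⟨(and (not c.2) d.1, d.2), List.mem_flatMap.2 ⟨d, hd, by simp⟩, by simp [hc, h]⟩

theorem satIn_expand {base : WFormula V} {d : WFormula V × WFormula V}
    (hd : d ∈ expand base l) (h : d.1.SatIn A D₂ β) :
    d.2.SatIn A D₁ β' ↔
      base.SatIn A D₁ β' ∨ ∃ c ∈ l, c.2.SatIn A D₂ β ∧ c.1.SatIn A D₁ β' := by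
  induction l generalizing d with
  | nil =>
    obtain rfl := List.mem_singleton.1 hd
    simp
  | cons c l ih =>
    obtain ⟨e, he, hd⟩ := List.mem_flatMap.1 hd
    simp only [List.mem_cons, List.not_mem_nil, or_false] at hd
    simp only [List.exists_mem_cons_iff]
    rcases hd with rfl | rfl
    · simp only [satIn_and] at h
      simp only [satIn_or, ih he h.2, h.1, true_and]
      tauto
    · simp only [satIn_and, satIn_not] at h
      simp only [ih he h.2, h.1, false_and, false_or]

theorem mem_free_fst_expand {base : WFormula V} {d : WFormula V × WFormula V}
    (hd : d ∈ expand base l) {x : ℕ} (hx : x ∈ d.1.free) : ∃ c ∈ l, x ∈ c.2.free := by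
  induction l generalizing d with
  | nil =>
    obtain rfl := List.mem_singleton.1 hd
    simp at hx
  | cons c l ih =>
    obtain ⟨e, he, hd⟩ := List.mem_flatMap.1 hd
    simp only [List.mem_cons, List.not_mem_nil, or_false] at hd
    simp only [List.exists_mem_cons_iff]
    rcases hd with rfl | rfl <;> simp only [free_and, free, Finset.mem_union] at hx <;>
      exact hx.imp id (ih he)

theorem mem_free_snd_expand {base : WFormula V} {d : WFormula V × WFormula V}
    (hd : d ∈ expand base l) {x : ℕ} (hx : x ∈ d.2.free) :
    x ∈ base.free ∨ ∃ c ∈ l, x ∈ c.1.free := by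
  induction l generalizing d with
  | nil =>
    obtain rfl := List.mem_singleton.1 hd
    exact .inl hx
  | cons c l ih =>
    obtain ⟨e, he, hd⟩ := List.mem_flatMap.1 hd
    simp only [List.mem_cons, List.not_mem_nil, or_false] at hd
    simp only [List.exists_mem_cons_iff]
    rcases hd with rfl | rfl
    · simp only [free, Finset.mem_union] at hx
      rcases hx with hx | hx
      · exact .inr (.inl hx)
      · exact (ih he hx).imp id .inr
    · exact (ih he hx).imp id .inr

theorem Decides.iff_exists (h : l.Decides A D₁ D₂ β T) :
    T ↔ ∃ c ∈ l, c.1.SatIn A D₁ β ∧ c.2.SatIn A D₂ β := by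
  obtain ⟨⟨c, hc, h₁⟩, h⟩ := h
  exact ⟨fun hT => ⟨c, hc, h₁, (h c hc h₁).1 hT⟩, fun ⟨d, hd, h₁, h₂⟩ => (h d hd h₁).2 h₂⟩

theorem Exhaustive.iff_or_exists {B : Prop} {F : WFormula V × WFormula V → Prop}
    (hl : l.Exhaustive A D β) (h : ∀ c ∈ l, c.1.SatIn A D β → (T ↔ B ∨ F c)) :
    T ↔ B ∨ ∃ c ∈ l, c.1.SatIn A D β ∧ F c := by
  obtain ⟨c, hc, h₁⟩ := hl
  constructor
  · intro hT
    exact ((h c hc h₁).1 hT).imp id fun hF => ⟨c, hc, h₁, hF⟩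
  · rintro (hB | ⟨d, hd, hd₁, hF⟩)
    exacts [(h c hc h₁).2 (.inl hB), (h d hd hd₁).2 (.inr hF)]

theorem Exhaustive.combine {op : WFormula V → WFormula V → WFormula V}
    (h : l.Exhaustive A D β) (h' : m.Exhaustive A D β) : (combine op l m).Exhaustive A D β := by
  obtain ⟨c, hc, h⟩ := h
  obtain ⟨d, hd, h'⟩ := h'
  exact ⟨_, mem_combine.2 ⟨c, hc, d, hd, rfl⟩, satIn_and.2 ⟨h, h'⟩⟩

theorem Exhaustive.any {ls : List (Cases V)} (h : ∀ l ∈ ls, l.Exhaustive A D β) :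
    (any ls).Exhaustive A D β := by
  induction ls with
  | nil => exact ⟨_, List.mem_singleton_self _, satIn_tt⟩
  | cons l ls ih => exact (h l (by simp)).combine (ih fun m hm => h m (by simp [hm]))

theorem Exhaustive.mapBody {f : WFormula V → WFormula V} (h : l.Exhaustive A D β) :
    (l.mapBody f).Exhaustive A D β := by
  obtain ⟨c, hc, h⟩ := h
  exact ⟨_, List.mem_map_of_mem hc, h⟩

theorem Decides.swap (h : l.Decides A D₁ D₂ β T) : l.swap.Decides A D₂ D₁ β T := by
  refine ⟨exhaustive_expand _ _, fun d hd h₁ => ?_⟩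
  rw [satIn_expand hd h₁, h.iff_exists]
  simp [and_comm]

theorem Decides.neg (h : l.Decides A D₁ D₂ β T) : l.neg.Decides A D₁ D₂ β (¬ T) := by
  obtain ⟨⟨c, hc, h₁⟩, h⟩ := h
  refine ⟨⟨_, List.mem_map_of_mem hc, h₁⟩, fun d hd h₁ => ?_⟩
  obtain ⟨c, hc, rfl⟩ := List.mem_map.1 hd
  exact not_congr (h c hc h₁)

theorem Decides.combine {op : WFormula V → WFormula V → WFormula V} {Op : Prop → Prop → Prop}
    (hop : ∀ φ ψ, (op φ ψ).SatIn A D₂ β ↔ Op (φ.SatIn A D₂ β) (ψ.SatIn A D₂ β))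
    (h : l.Decides A D₁ D₂ β T) (h' : m.Decides A D₁ D₂ β S) :
    (combine op l m).Decides A D₁ D₂ β (Op T S) := by
  refine ⟨h.1.combine h'.1, fun d hd hd₁ => ?_⟩
  obtain ⟨c, hc, c', hc', rfl⟩ := mem_combine.1 hd
  rw [satIn_and] at hd₁
  rw [h.2 c hc hd₁.1, h'.2 c' hc' hd₁.2, hop]

theorem Decides.both (h : l.Decides A D₁ D₂ β T) (h' : m.Decides A D₁ D₂ β S) :
    (l.both m).Decides A D₁ D₂ β (T ∧ S) :=
  h.combine (fun _ _ => satIn_and) h'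

theorem Decides.either (h : l.Decides A D₁ D₂ β T) (h' : m.Decides A D₁ D₂ β S) :
    (l.either m).Decides A D₁ D₂ β (T ∨ S) :=
  h.combine (fun _ _ => satIn_or) h'

theorem Decides.any {ι : Type*} {L : List ι} {f : ι → Cases V} {T : ι → Prop}
    (h : ∀ i ∈ L, (f i).Decides A D₁ D₂ β (T i)) :
    (any (L.map f)).Decides A D₁ D₂ β (∃ i ∈ L, T i) := by
  induction L with
  | nil => exact ⟨⟨_, List.mem_singleton_self _, satIn_tt⟩, by simp [Cases.any]⟩
  | cons i L ih =>
    simp only [List.exists_mem_cons_iff]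
    exact (h i (by simp)).either (ih fun j hj => h j (by simp [hj]))

theorem Decides.mapBody {f : WFormula V → WFormula V} (hl : l.Exhaustive A D₁ β)
    (h : ∀ c ∈ l, c.1.SatIn A D₁ β → (T ↔ (f c.2).SatIn A D₂ β)) :
    (l.mapBody f).Decides A D₁ D₂ β T := by
  refine ⟨hl.mapBody, fun d hd h₁ => ?_⟩
  obtain ⟨c, hc, rfl⟩ := List.mem_map.1 hd
  exact h c hc h₁

/-- The free variables of the guards lie in `X`, those of the bodies in `Y`. -/
def FreeIn (l : Cases V) (X Y : Set ℕ) : Prop :=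
  ∀ c ∈ l, (∀ x ∈ c.1.free, x ∈ X) ∧ ∀ x ∈ c.2.free, x ∈ Y

variable {X Y : Set ℕ}

theorem FreeIn.swap (h : l.FreeIn X Y) : l.swap.FreeIn Y X := fun d hd =>
  ⟨fun x hx => by
    obtain ⟨c, hc, hx⟩ := mem_free_fst_expand hd hx
    exact (h c hc).2 x hx,
   fun x hx => by
    obtain hx | ⟨c, hc, hx⟩ := mem_free_snd_expand hd hx
    · simp at hx
    · exact (h c hc).1 x hx⟩

theorem FreeIn.mono {X' Y' : Set ℕ} (h : l.FreeIn X Y) (hX : X ⊆ X') (hY : Y ⊆ Y') :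
    l.FreeIn X' Y' :=
  fun c hc => ⟨fun x hx => hX ((h c hc).1 x hx), fun x hx => hY ((h c hc).2 x hx)⟩

theorem FreeIn.combine {op : WFormula V → WFormula V → WFormula V}
    (hop : ∀ φ ψ, (op φ ψ).free = φ.free ∪ ψ.free) (h : l.FreeIn X Y) (h' : m.FreeIn X Y) :
    (combine op l m).FreeIn X Y := by
  intro d hd
  obtain ⟨c, hc, e, he, rfl⟩ := mem_combine.1 hd
  have := h c hc
  have := h' e he
  simp only [hop, free_and, Finset.mem_union]
  grind

theorem FreeIn.both (h : l.FreeIn X Y) (h' : m.FreeIn X Y) : (l.both m).FreeIn X Y :=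
  h.combine (fun _ _ => rfl) h'

theorem FreeIn.either (h : l.FreeIn X Y) (h' : m.FreeIn X Y) : (l.either m).FreeIn X Y :=
  h.combine (fun _ _ => rfl) h'

theorem FreeIn.any {ι : Type*} {L : List ι} {f : ι → Cases V}
    (h : ∀ i ∈ L, (f i).FreeIn X Y) : (any (L.map f)).FreeIn X Y := by
  induction L with
  | nil =>
    intro c hc
    obtain rfl := List.mem_singleton.1 hc
    simp
  | cons i L ih => exact (h i (by simp)).either (ih fun j hj => h j (by simp [hj]))

theorem FreeIn.neg (h : l.FreeIn X Y) : l.neg.FreeIn X Y := by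
  intro d hd
  obtain ⟨c, hc, rfl⟩ := List.mem_map.1 hd
  exact h c hc

theorem FreeIn.mapBody_ex (h : l.FreeIn X Y) (y : ℕ) : (l.mapBody (ex y)).FreeIn X (Y \ {y}) := by
  intro d hd
  obtain ⟨c, hc, rfl⟩ := List.mem_map.1 hd
  simp only [free, Finset.mem_sdiff, Finset.mem_singleton]
  exact ⟨(h c hc).1, fun x hx => ⟨(h c hc).2 x hx.1, hx.2⟩⟩

theorem Decides.mapBody_ex {y : ℕ} {T : A.Univ → Prop} (hl : l.Exhaustive A D₁ β)
    (hy : l.FreeIn {y}ᶜ Y) (h : ∀ b ∈ D₂, l.Decides A D₁ D₂ (update β y b) (T b)) :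
    (l.mapBody (ex y)).Decides A D₁ D₂ β (∃ b ∈ D₂, T b) :=
  .mapBody hl fun c hc hc₁ => exists_congr fun b => and_congr_right fun hb => (h b hb).2 c hc <|
    (satIn_congr _ fun x hx => (update_of_ne ((hy c hc).1 x hx) _ _).symm).1 hc₁

variable {a : Fin V.numWt} {hfin : Finite (V.Elem (V.wtType a))} {s : V.Elem (V.wtType a)}
  {ys : Fin (V.wtArity a) ↪ ℕ}

theorem FreeIn.mapBody_sumEq (h : l.FreeIn X Y) :
    (l.mapBody (sumEq a hfin s ys)).FreeIn X (Y \ Set.range ys) := by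
  intro d hd
  obtain ⟨c, hc, rfl⟩ := List.mem_map.1 hd
  simp only [free, Finset.mem_sdiff, Finset.mem_image, Finset.mem_univ, true_and]
  exact ⟨(h c hc).1, fun x hx => ⟨(h c hc).2 x hx.1, hx.2⟩⟩

theorem Decides.mapBody_sumEq {T : (Fin (V.wtArity a) → A.Univ) → Prop}
    (hl : l.Exhaustive A D₁ β) (hys : l.FreeIn (Set.range ys)ᶜ Y)
    (h : ∀ b, (∀ j, b j ∈ D₂) → l.Decides A D₁ D₂ (extend ys b β) (T b)) :
    (l.mapBody (sumEq a hfin s ys)).Decides A D₁ D₂ β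
      (s = A.wsum a {b | (∀ j, b j ∈ D₂) ∧ T b}) :=
  .mapBody hl fun c hc hc₁ => Eq.congr_right <| congrArg _ <| Set.ext fun b =>
    and_congr_right fun hb => (h b hb).2 c hc <|
      (satIn_congr _ fun x hx => (extend_apply' _ _ _ ((hys c hc).1 x hx)).symm).1 hc₁

end Cases

/-! ### Decomposition over two separated parts -/

/-- No tuple of a relation, and no tuple of non-zero weight, meets both parts. -/
structure Separated (A : PreStructure V) (D₁ D₂ : Set A.Univ) : Prop where
  disjoint : Disjoint D₁ D₂
  rel : ∀ R, ∀ t ∈ A.rel R, ∀ i j, t i ∈ D₁ → t j ∉ D₂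
  wt : ∀ a t, A.wt a t ≠ 0 → ∀ i j, t i ∈ D₁ → t j ∉ D₂

theorem Separated.wsum_union (hsep : Separated A D₁ D₂) (a : Fin V.numWt)
    (T : (Fin (V.wtArity a) → A.Univ) → Prop) :
    A.wsum a {b | (∀ j, b j ∈ D₁ ∪ D₂) ∧ T b} =
      A.wsum a {b | (∀ j, b j ∈ D₁) ∧ T b} + A.wsum a {b | (∀ j, b j ∈ D₂) ∧ T b} := by
  rw [← PreStructure.wsum_union]
  · refine PreStructure.wsum_congr fun b hb => ?_
    simp only [Set.mem_union, Set.mem_ofPred_eq, ← or_and_right]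
    refine and_congr_left fun _ => ⟨fun h => ?_, ?_⟩
    · by_contra! hmixed
      obtain ⟨⟨i, hi⟩, j, hj⟩ := hmixed
      exact hsep.wt a b hb j i ((h j).resolve_right hj) ((h i).resolve_left hi)
    · rintro (h | h) j
      exacts [.inl (h j), .inr (h j)]
  · exact Set.disjoint_left.2 fun b hb hb' => Set.disjoint_left.1 hsep.disjoint
      (hb.1 ⟨0, V.wtArity_pos a⟩) (hb'.1 ⟨0, V.wtArity_pos a⟩)

/-- The formulas `(s₁ = ∑ …)`, `(s₂ = ∑ …)` with `s₁ + s₂ = s`, for a formula `(s = ∑ …)`. -/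
noncomputable def sumSplits : WFormula V → List (WFormula V × WFormula V)
  | sumEq a hfin s ys φ =>
      have := Fintype.ofFinite (V.Elem (V.wtType a))
      Finset.univ.toList.map fun s₁ =>
        (sumEq a hfin s₁ ys φ, sumEq a hfin (s - s₁) ys φ)
  | _ => []

/-- Replaces the immediate subformula of a formula that starts with `¬` or a binder. -/
def setBody : WFormula V → WFormula V → WFormula V
  | not _, ψ => not ψ
  | ex y _, ψ => ex y ψ
  | sumEq a hfin s ys _, ψ => sumEq a hfin s ys ψ
  | φ, _ => φ

open Classical in
/-- The formula `0 = w(x)`. -/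
noncomputable def isWtEqZero : WFormula V → Bool
  | wtEq _ s _ => decide (s = 0)
  | _ => false

/-- The cases for an atomic formula. If its variables range over both parts, then it is false
unless it says that a weight is zero. -/
noncomputable def splitLeaf (L : List ℕ) (φ : WFormula V) : Cases V :=
  if ∀ x ∈ φ.leafVars, x ∈ L then [(φ, tt), (not φ, ff)]
  else if ∀ x ∈ φ.leafVars, x ∉ L then [(tt, φ)]
  else [(tt, if φ.isWtEqZero then tt else ff)]

/-- The cases for an existential formula `φ`, from the cases `l` and `m` for its body where the
bound variable ranges over the first and over the second part, respectively. -/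
noncomputable def splitEx (φ : WFormula V) (l m : Cases V) : Cases V :=
  (l.mapGuard φ.setBody).either (m.mapBody φ.setBody)

/-- The cases for an aggregation `φ`, from the cases `l` and `m` for its body where all bound
variables range over the first and over the second part, respectively. Tuples that meet both
parts have weight zero. -/
noncomputable def splitSum (φ : WFormula V) (l m : Cases V) : Cases V :=
  Cases.any (φ.sumSplits.map fun p =>
    (l.mapGuard p.1.setBody).both (m.mapBody p.2.setBody))

/-- The decomposition of a formula over two separated parts of a structure: the variables in `L`
range over the first part, the others over the second part. -/
noncomputable def split : WFormula V → List ℕ → Cases V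
  | not φ, L => (φ.split L).neg
  | or φ ψ, L => (φ.split L).either (ψ.split L)
  | ex y φ, L => splitEx (ex y φ) (φ.split ([y] ++ L))
      (φ.split (L.filter fun x => decide (x ∉ [y])))
  | sumEq a hfin s ys φ, L => splitSum (sumEq a hfin s ys φ) (φ.split (List.ofFn ys ++ L))
      (φ.split (L.filter fun x => decide (x ∉ List.ofFn ys)))
  | φ, L => φ.splitLeaf L

theorem freeIn_splitLeaf {L : List ℕ} (h : ∀ x, x ∈ φ.leafVars ↔ x ∈ φ.free) :
    (φ.splitLeaf L).FreeIn {x | x ∈ φ.free ∧ x ∈ L} {x | x ∈ φ.free ∧ x ∉ L} := by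
  intro c hc
  simp only [splitLeaf, h] at hc
  split_ifs at hc with h₁ h₂ <;>
    simp only [List.mem_cons, List.not_mem_nil, or_false] at hc
  · rcases hc with rfl | rfl <;> simpa [free] using fun x hx => ⟨hx, h₁ x hx⟩
  · subst hc; simpa using fun x hx => ⟨hx, h₂ x hx⟩
  all_goals subst hc; simp

theorem freeIn_split (φ : WFormula V) (L : List ℕ) :
    (φ.split L).FreeIn {x | x ∈ φ.free ∧ x ∈ L} {x | x ∈ φ.free ∧ x ∉ L} := by
  induction φ generalizing L with
  | eq x y => exact freeIn_splitLeaf fun x => mem_freeList (eq _ _)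
  | rel R xs => exact freeIn_splitLeaf fun x => mem_freeList (rel _ _)
  | wtEq a s xs => exact freeIn_splitLeaf fun x => mem_freeList (wtEq _ _ _)
  | pred P ts h => exact freeIn_splitLeaf fun x => mem_freeList (pred _ _ _)
  | not φ ih => exact (ih L).neg
  | or φ ψ ih₁ ih₂ =>
    refine ((ih₁ L).mono ?_ ?_).either ((ih₂ L).mono ?_ ?_) <;> intro x <;>
      simp +contextual [free]
  | ex y φ ih =>
    refine (((ih _).swap.mapBody_ex y).swap.mono ?_ ?_).either
      (((ih _).mapBody_ex y).mono ?_ ?_) <;>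
    · intro x
      simp only [free]
      grind
  | sumEq a hfin s ys φ ih =>
    simp only [split, splitSum, sumSplits, List.map_map]
    refine .any fun s₁ _ => .both ((ih _).swap.mapBody_sumEq.swap.mono ?_ ?_)
      ((ih _).mapBody_sumEq.mono ?_ ?_) <;>
    · intro x
      simp only [free, List.mem_append, List.mem_filter, List.mem_ofFn]
      grind

theorem exhaustive_splitLeaf (L : List ℕ) (φ : WFormula V) :
    (φ.splitLeaf L).Exhaustive A D β := by
  unfold splitLeaf
  split_ifs
  · by_cases h : φ.SatIn A D β
    · exact ⟨(φ, tt), by simp, h⟩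
    · exact ⟨(not φ, ff), by simp, h⟩
  all_goals exact ⟨_, List.mem_singleton_self _, satIn_tt⟩

theorem exhaustive_split (φ : WFormula V) (L : List ℕ) : (φ.split L).Exhaustive A D β := by
  induction φ generalizing L with
  | eq | rel | wtEq | pred => exact exhaustive_splitLeaf _ _
  | not φ ih => exact (ih L).mapBody
  | or φ ψ ih₁ ih₂ => exact (ih₁ L).combine (ih₂ L)
  | ex y φ ih => exact (Cases.exhaustive_expand _ _).combine (ih _).mapBody
  | sumEq a hfin s ys φ ih =>
    refine .any fun l hl => ?_
    obtain ⟨p, -, rfl⟩ := List.mem_map.1 hl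
    exact (Cases.exhaustive_expand _ _).combine (ih _).mapBody

/-- The values of the variables in `X` lie in `D₁` for those in `L`, and in `D₂` for the others. -/
def AssignsParts {α : Type*} (β : ℕ → α) (X : Finset ℕ) (L : List ℕ) (D₁ D₂ : Set α) : Prop :=
  ∀ x ∈ X, (x ∈ L → β x ∈ D₁) ∧ (x ∉ L → β x ∈ D₂)

namespace AssignsParts

variable {α : Type*} {γ γ' : ℕ → α} {X X' : Finset ℕ} {L Y : List ℕ} {E₁ E₂ : Set α}

theorem rebind_fst (h : AssignsParts γ X' L E₁ E₂) (hX : ∀ x ∈ X, x ∉ Y → x ∈ X')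
    (hγ : ∀ x ∉ Y, γ' x = γ x) (hY : ∀ x ∈ Y, γ' x ∈ E₁) :
    AssignsParts γ' X (Y ++ L) E₁ E₂ := by
  intro x hx
  by_cases hxY : x ∈ Y
  · simpa [hxY] using hY x hxY
  · simpa [hxY, hγ x hxY] using h x (hX x hx hxY)

theorem rebind_snd (h : AssignsParts γ X' L E₁ E₂) (hX : ∀ x ∈ X, x ∉ Y → x ∈ X')
    (hγ : ∀ x ∉ Y, γ' x = γ x) (hY : ∀ x ∈ Y, γ' x ∈ E₂) :
    AssignsParts γ' X (L.filter fun x => decide (x ∉ Y)) E₁ E₂ := by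
  intro x hx
  by_cases hxY : x ∈ Y
  · simpa [hxY] using hY x hxY
  · simpa [hxY, hγ x hxY] using h x (hX x hx hxY)

end AssignsParts

variable {L : List ℕ}

theorem decides_splitLeaf (hβ : AssignsParts β φ.free L D₁ D₂)
    (hleaf : ∀ x, x ∈ φ.leafVars ↔ x ∈ φ.free)
    (hatom : ∀ D D', φ.SatIn A D β ↔ φ.SatIn A D' β)
    (hmixed : ∀ x ∈ φ.free, β x ∈ D₁ → ∀ y ∈ φ.free, β y ∈ D₂ →
      (φ.SatIn A (D₁ ∪ D₂) β ↔ φ.isWtEqZero = true)) :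
    (φ.splitLeaf L).Decides A D₁ D₂ β (φ.SatIn A (D₁ ∪ D₂) β) := by
  refine ⟨exhaustive_splitLeaf _ _, fun c hc h₁ => ?_⟩
  simp only [splitLeaf, hleaf] at hc
  split_ifs at hc with hall hnone hzero <;>
    simp only [List.mem_cons, List.not_mem_nil, or_false] at hc
  · rw [hatom _ D₁]
    rcases hc with rfl | rfl <;> simpa using h₁
  · subst hc
    exact hatom _ _
  all_goals
    push Not at hall hnone
    obtain ⟨y, hy, hyL⟩ := hall
    obtain ⟨x, hx, hxL⟩ := hnone
    subst hc
    simpa [hzero] using hmixed x hx ((hβ x hx).1 hxL) y hy ((hβ y hy).2 hyL)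

theorem decides_split_eq (hsep : Separated A D₁ D₂) (x y : ℕ)
    (hβ : AssignsParts β (eq x y : WFormula V).free L D₁ D₂) :
    ((eq x y).split L).Decides A D₁ D₂ β ((eq x y).SatIn A (D₁ ∪ D₂) β) := by
  refine decides_splitLeaf hβ (fun _ => mem_freeList (eq _ _)) (fun _ _ => Iff.rfl) ?_
  intro x' hx' hx₁ y' hy' hy₂
  simp only [SatIn, isWtEqZero, Bool.false_eq_true, iff_false]
  intro hxy
  refine Set.disjoint_left.1 hsep.disjoint hx₁ ?_
  simp only [free, Finset.mem_insert, Finset.mem_singleton] at hx' hy'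
  grind

theorem decides_split_rel (hsep : Separated A D₁ D₂) (R : Fin V.numRel)
    (xs : Fin (V.relArity R) → ℕ) (hβ : AssignsParts β (rel R xs : WFormula V).free L D₁ D₂) :
    ((rel R xs).split L).Decides A D₁ D₂ β ((rel R xs).SatIn A (D₁ ∪ D₂) β) := by
  refine decides_splitLeaf hβ (fun _ => mem_freeList (rel _ _)) (fun _ _ => Iff.rfl) ?_
  simp only [free, Finset.mem_image, Finset.mem_univ, true_and]
  rintro _ ⟨i, rfl⟩ hi _ ⟨j, rfl⟩ hj
  simpa [SatIn, isWtEqZero] using fun h => hsep.rel R _ h i j hi hj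

theorem decides_split_wtEq (hsep : Separated A D₁ D₂) (a : Fin V.numWt)
    (s : V.Elem (V.wtType a)) (xs : Fin (V.wtArity a) ↪ ℕ)
    (hβ : AssignsParts β (wtEq a s xs : WFormula V).free L D₁ D₂) :
    ((wtEq a s xs).split L).Decides A D₁ D₂ β ((wtEq a s xs).SatIn A (D₁ ∪ D₂) β) := by
  refine decides_splitLeaf hβ (fun _ => mem_freeList (wtEq _ _ _)) (fun _ _ => Iff.rfl) ?_
  simp only [free, Finset.mem_image, Finset.mem_univ, true_and]
  rintro _ ⟨i, rfl⟩ hi _ ⟨j, rfl⟩ hj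
  have : A.wt a (fun j => β (xs j)) = 0 := by
    by_contra hne
    exact hsep.wt a _ hne i j hi hj
  simp [SatIn, isWtEqZero, this]

theorem decides_split_ex {y : ℕ} {T : A.Univ → Prop}
    (h₁ : ∀ b ∈ D₁, (φ.split ([y] ++ L)).Decides A D₁ D₂ (update β y b) (T b))
    (h₂ : ∀ b ∈ D₂, (φ.split (L.filter fun x => decide (x ∉ [y]))).Decides A D₁ D₂
      (update β y b) (T b)) :
    ((ex y φ).split L).Decides A D₁ D₂ β (∃ b ∈ D₁ ∪ D₂, T b) := by
  simp only [Set.mem_union, or_and_right, exists_or]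
  refine .either (Cases.Decides.mapBody_ex (Cases.exhaustive_expand _ _)
      ((freeIn_split φ _).swap.mono ?_ fun _ => id) fun b hb => (h₁ b hb).swap).swap
    (.mapBody_ex (exhaustive_split _ _) ((freeIn_split φ _).mono ?_ fun _ => id) h₂)
  · grind
  · grind

theorem decides_split_sumEq (hsep : Separated A D₁ D₂) {a : Fin V.numWt}
    {hfin : Finite (V.Elem (V.wtType a))} {s : V.Elem (V.wtType a)}
    {ys : Fin (V.wtArity a) ↪ ℕ} {T : (Fin (V.wtArity a) → A.Univ) → Prop}
    (h₁ : ∀ b, (∀ j, b j ∈ D₁) → (φ.split (List.ofFn ys ++ L)).Decides A D₁ D₂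
      (extend ys b β) (T b))
    (h₂ : ∀ b, (∀ j, b j ∈ D₂) → (φ.split (L.filter fun x => decide (x ∉ List.ofFn ys))).Decides
      A D₁ D₂ (extend ys b β) (T b)) :
    ((sumEq a hfin s ys φ).split L).Decides A D₁ D₂ β
      (s = A.wsum a {b | (∀ j, b j ∈ D₁ ∪ D₂) ∧ T b}) := by
  let := Fintype.ofFinite (V.Elem (V.wtType a))
  have hsplit : (s = A.wsum a {b | (∀ j, b j ∈ D₁ ∪ D₂) ∧ T b}) ↔
      ∃ s₁ ∈ (Finset.univ : Finset (V.Elem (V.wtType a))).toList,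
        s₁ = A.wsum a {b | (∀ j, b j ∈ D₁) ∧ T b} ∧
        s - s₁ = A.wsum a {b | (∀ j, b j ∈ D₂) ∧ T b} := by
    rw [hsep.wsum_union]
    simp [sub_eq_iff_eq_add']
  rw [hsplit]
  simp only [split, splitSum, sumSplits, List.map_map]
  refine .any fun s₁ _ => .both (Cases.Decides.mapBody_sumEq (Cases.exhaustive_expand _ _)
      ((freeIn_split φ _).swap.mono ?_ fun _ => id) fun b hb => (h₁ b hb).swap).swap
    (.mapBody_sumEq (exhaustive_split _ _) ((freeIn_split φ _).mono ?_ fun _ => id) h₂)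
  · intro x; simp +contextual
  · intro x; simp +contextual

/-- The analogue for `FOW₁` of the Feferman–Vaught theorem for disjoint unions. -/
theorem decides_split (hsep : Separated A D₁ D₂) (φ : WFormula V) (L : List ℕ)
    (hβ : AssignsParts β φ.free L D₁ D₂) :
    (φ.split L).Decides A D₁ D₂ β (φ.SatIn A (D₁ ∪ D₂) β) := by
  induction φ generalizing L β with
  | eq x y => exact decides_split_eq hsep x y hβ
  | rel R xs => exact decides_split_rel hsep R xs hβ
  | wtEq a s xs => exact decides_split_wtEq hsep a s xs hβ
  | pred P ts h =>
    refine decides_splitLeaf hβ (fun _ => mem_freeList (pred _ _ _)) (fun _ _ => Iff.rfl) ?_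
    intro x hx hx₁ y hy hy₂
    obtain rfl : x = y := Finset.card_le_one.1 h _ hx _ hy
    exact absurd hy₂ (Set.disjoint_left.1 hsep.disjoint hx₁)
  | not φ ih => exact (ih L hβ).neg
  | or φ ψ ih₁ ih₂ =>
    exact (ih₁ L fun x hx => hβ x (Finset.mem_union_left _ hx)).either
      (ih₂ L fun x hx => hβ x (Finset.mem_union_right _ hx))
  | ex y φ ih =>
    have hX : ∀ x ∈ φ.free, x ∉ [y] → x ∈ (ex y φ).free := by simp +contextual [free]
    have hγ (b : A.Univ) : ∀ x ∉ [y], update β y b x = β x := by simp +contextual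
    exact decides_split_ex
      (fun b hb => ih _ (hβ.rebind_fst hX (hγ b) (by simpa using hb)))
      (fun b hb => ih _ (hβ.rebind_snd hX (hγ b) (by simpa using hb)))
  | sumEq a hfin s ys φ ih =>
    have hX : ∀ x ∈ φ.free, x ∉ List.ofFn ys → x ∈ (sumEq a hfin s ys φ).free := by
      simp +contextual [free, List.mem_ofFn]
    have hγ (b : Fin (V.wtArity a) → A.Univ) : ∀ x ∉ List.ofFn ys, extend ys b β x = β x :=
      fun x hx => extend_apply' _ _ _ (by simpa [List.mem_ofFn] using hx)
    have hY (b : Fin (V.wtArity a) → A.Univ) (D : Set A.Univ) (hb : ∀ j, b j ∈ D) :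
        ∀ x ∈ List.ofFn ys, extend ys b β x ∈ D := by
      simpa [List.mem_ofFn, ys.injective.extend_apply] using hb
    exact decides_split_sumEq hsep
      (fun b hb => ih _ (hβ.rebind_fst hX (hγ b) (hY b _ hb)))
      (fun b hb => ih _ (hβ.rebind_snd hX (hγ b) (hY b _ hb)))

end WFormula

namespace PreStructure

variable {V : Vocabulary.{u, v, w}} {A : PreStructure V}

theorem IsWeighted.edist_le_one (hA : A.IsWeighted) {a : Fin V.numWt}
    {t : Fin (V.wtArity a) → A.Univ} (h : A.wt a t ≠ 0) (i j : Fin (V.wtArity a)) :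
    A.gaifman.edist (t i) (t j) ≤ (1 : ℕ) := by
  rcases hA a t h with h | h | ⟨R, b, hb, h⟩
  · have : i = j := by ext; omega
    simp [this]
  · simp [h i j]
  · obtain ⟨i', hi⟩ := h ⟨i, rfl⟩
    obtain ⟨j', hj⟩ := h ⟨j, rfl⟩
    rw [← hi, ← hj]
    exact edist_le_one_of_mem_rel hb i' j'

theorem IsWeighted.separated (hA : A.IsWeighted) {r : ℕ} {X Y : Set A.Univ}
    (h : ∀ y ∈ Y, y ∉ A.ball (2 * r + 1) X) :
    WFormula.Separated A (A.ball r X) (A.ball r Y) := by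
  have hfar : ∀ u ∈ A.ball r X, ∀ v ∈ A.ball r Y, ¬ A.gaifman.edist u v ≤ (1 : ℕ) := by
    rintro u ⟨x, hx, hxu⟩ v ⟨y, hy, hyv⟩ huv
    rw [SimpleGraph.edist_comm] at hyv
    exact h y hy ⟨x, hx, edist_le_of_add_le (edist_le_of_add_le hxu huv le_rfl) hyv (by omega)⟩
  exact ⟨Set.disjoint_left.2 fun u hu hu' => hfar u hu u hu' (by simp),
    fun R t ht i j hi hj => hfar _ hi _ hj (edist_le_one_of_mem_rel ht i j),
    fun a t ht i j hi hj => hfar _ hi _ hj (hA.edist_le_one ht i j)⟩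

end PreStructure

namespace WFormula

variable {V : Vocabulary.{u, v, w}} {A : PreStructure V} {D : Set A.Univ}
  {β β' : ℕ → A.Univ} {φ ψ lam : WFormula V} {r R k : ℕ} {X Y : List ℕ}

/-- The decomposition of a formula that is `r`-local around `X` and `Y` into formulas that are
`r`-local around `X` and formulas that are `r`-local around `Y`. It is correct where the values
of `Y` are far from those of `X`. -/
noncomputable def splitBalls (r : ℕ) (X Y : List ℕ) (lam : WFormula V) : Cases V :=
  (lam.split X).map fun c => (inBall r X c.1, inBall r Y c.2)

theorem exhaustive_splitBalls :
    (splitBalls r X Y lam).Exhaustive A Set.univ β := by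
  obtain ⟨c, hc, h⟩ := exhaustive_split (A := A) (D := A.ball r (β '' {x | x ∈ X})) (β := β) lam X
  refine ⟨_, List.mem_map_of_mem hc, (satIn_inBall ?_ (Set.subset_univ _)).2 h⟩
  intro x hx
  simpa using ((freeIn_split lam X c hc).1 x hx).2

theorem free_subset_of_mem_split (hlam : lam.StronglyLocal r {x | x ∈ X ∨ x ∈ Y})
    {c : WFormula V × WFormula V} (hc : c ∈ lam.split X) :
    c.1.free ⊆ X.toFinset ∧ c.2.free ⊆ Y.toFinset := by
  refine ⟨fun x hx => by simpa using ((freeIn_split lam X c hc).1 x hx).2, fun x hx => ?_⟩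
  have hx' := (freeIn_split lam X c hc).2 x hx
  exact List.mem_toFinset.2 ((hlam.1 hx'.1).resolve_left hx'.2)

theorem stronglyLocal_splitBalls (hlam : lam.StronglyLocal r {x | x ∈ X ∨ x ∈ Y})
    {c : WFormula V × WFormula V} (hc : c ∈ splitBalls r X Y lam) :
    c.1.StronglyLocal r {x | x ∈ X} ∧ c.2.StronglyLocal r {x | x ∈ Y} := by
  obtain ⟨c, hc', rfl⟩ := List.mem_map.1 hc
  obtain ⟨h₁, h₂⟩ := free_subset_of_mem_split hlam hc'
  exact ⟨stronglyLocal_inBall h₁, stronglyLocal_inBall h₂⟩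

theorem satIn_splitBalls (hA : A.IsWeighted) (hlam : lam.StronglyLocal r {x | x ∈ X ∨ x ∈ Y})
    {c : WFormula V × WFormula V} (hc : c ∈ splitBalls r X Y lam)
    (h : c.1.SatIn A Set.univ β) (hβ' : ∀ x ∈ X, β' x = β x)
    (hfar : ∀ y ∈ Y, β' y ∉ A.ball (2 * r + 1) (β '' {x | x ∈ X})) :
    lam.SatIn A Set.univ β' ↔ c.2.SatIn A Set.univ β' := by
  rw [← (stronglyLocal_splitBalls hlam hc).1.congr hβ'] at h
  obtain ⟨c, hc', rfl⟩ := List.mem_map.1 hc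
  obtain ⟨h₁, h₂⟩ := free_subset_of_mem_split hlam hc'
  rw [satIn_inBall h₁ (Set.subset_univ _)] at h
  rw [satIn_inBall h₂ (Set.subset_univ _)]
  have hsep : Separated A (A.ball r (β' '' {x | x ∈ X})) (A.ball r (β' '' {x | x ∈ Y})) := by
    refine hA.separated (Set.forall_mem_image.2 ?_)
    rwa [show β' '' {x | x ∈ X} = β '' {x | x ∈ X} from Set.image_congr hβ']
  have hparts : AssignsParts β' lam.free X (A.ball r (β' '' {x | x ∈ X}))
      (A.ball r (β' '' {x | x ∈ Y})) := fun x hx =>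
    ⟨fun hX => PreStructure.subset_ball _ _ ⟨x, hX, rfl⟩,
      fun hX => PreStructure.subset_ball _ _ ⟨x, (hlam.1 hx).resolve_left hX, rfl⟩⟩
  rw [← (decides_split hsep lam X hparts).2 c hc' h, ← PreStructure.ball_union,
    ← Set.image_union]
  exact (hlam.2 A _ β' subset_rfl).symm

/-! ### Binders restricted to neighbourhoods -/

theorem stronglyLocal_distLE (r x y : ℕ) :
    (distLE r x y : WFormula V).StronglyLocal r {x, y} := by
  refine ⟨fun v hv => by simpa using free_distLE_subset r x y hv, fun A D β hD => ?_⟩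
  rw [satIn_distLE, satIn_distLE (Set.subset_univ _)]
  exact (PreStructure.ball_mono le_rfl (by simp)).trans hD

theorem stronglyLocal_near (r : ℕ) (X : List ℕ) (y : ℕ) :
    (near r X y : WFormula V).StronglyLocal r {x | x ∈ X ∨ x ∈ [y]} := by
  refine .disj fun φ hφ => ?_
  obtain ⟨x, hx, rfl⟩ := List.mem_map.1 hφ
  refine (stronglyLocal_distLE r x y).mono le_rfl ?_
  rintro v (rfl | rfl)
  exacts [.inl hx, .inr List.mem_cons_self]

/-- Restricting the values of `Y` to a neighbourhood of `X` in `φ` makes both the range of the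
bound variables `Y` and the truth value of `φ` independent of the part `D` of the structure. -/
theorem StronglyLocal.satIn_allNear_and (h : φ.StronglyLocal r {x | x ∈ X ∨ x ∈ Y})
    (hk : R + r ≤ k) (hD : A.ball k (β '' {x | x ∈ X}) ⊆ D) :
    (∀ y ∈ Y, β y ∈ D) ∧ (and (allNear R X Y) φ).SatIn A D β ↔
      (and (allNear R X Y) φ).SatIn A Set.univ β := by
  have hball : A.ball R (β '' {x | x ∈ X}) ⊆ D :=
    (PreStructure.ball_mono (by omega) subset_rfl).trans hD
  rw [satIn_and, satIn_and, satIn_allNear hball, satIn_allNear (Set.subset_univ _)]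
  have hφ (hY : ∀ y ∈ Y, β y ∈ A.ball R (β '' {x | x ∈ X})) :
      φ.SatIn A D β ↔ φ.SatIn A Set.univ β := by
    refine h.2 A D β ((PreStructure.ball_ball_subset hk ?_).trans hD)
    rintro _ ⟨x, hx | hx, rfl⟩
    exacts [PreStructure.subset_ball _ _ ⟨x, hx, rfl⟩, hY x hx]
  exact ⟨fun h => ⟨h.2.1, (hφ h.2.1).1 h.2.2⟩,
    fun h => ⟨fun y hy => hball (h.1 y hy), h.1, (hφ h.1).2 h.2⟩⟩

theorem StronglyLocal.mem_of_mem_free_allNear_and (h : φ.StronglyLocal r {x | x ∈ X ∨ x ∈ Y})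
    {x : ℕ} (hx : x ∈ (and (allNear R X Y) φ).free) (hxY : x ∉ Y) : x ∈ X := by
  rw [free_and, Finset.mem_union] at hx
  exact hx.elim (fun hx => (mem_or_mem_of_mem_free_allNear hx).resolve_left hxY)
    fun hx => (h.1 hx).resolve_right hxY

theorem StronglyLocal.exs_near (h : φ.StronglyLocal r {x | x ∈ X ∨ x ∈ Y})
    (hY : ∀ y ∈ Y, y ∉ X) (hk : R + r ≤ k) :
    (exs Y (and (allNear R X Y) φ)).StronglyLocal k {x | x ∈ X} := by
  refine ⟨fun x hx => ?_, fun A D β hD => ?_⟩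
  · obtain ⟨hx, hxY⟩ := mem_free_exs.1 hx
    exact h.mem_of_mem_free_allNear_and hx hxY
  · rw [satIn_exs, satIn_exs]
    refine exists_congr fun β' => and_congr_right fun hβ' => ?_
    have himg : β' '' {x | x ∈ X} = β '' {x | x ∈ X} :=
      Set.image_congr fun x hx => hβ' x fun hxY => hY x hxY hx
    rw [h.satIn_allNear_and hk (by rwa [himg])]
    simp

theorem StronglyLocal.ex_near {y : ℕ} (h : φ.StronglyLocal r {x | x ∈ X ∨ x ∈ [y]})
    (hy : y ∉ X) (hk : R + r ≤ k) :
    (ex y (and (near R X y) φ)).StronglyLocal k {x | x ∈ X} :=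
  h.exs_near (by simpa using hy) hk

theorem StronglyLocal.sumEq_near {a : Fin V.numWt} {hfin : Finite (V.Elem (V.wtType a))}
    {s : V.Elem (V.wtType a)} {ys : Fin (V.wtArity a) ↪ ℕ}
    (h : φ.StronglyLocal r {x | x ∈ X ∨ x ∈ List.ofFn ys})
    (hy : ∀ j, ys j ∉ X) (hk : R + r ≤ k) :
    (sumEq a hfin s ys (and (allNear R X (List.ofFn ys)) φ)).StronglyLocal k {x | x ∈ X} := by
  refine ⟨fun x hx => ?_, fun A D β hD => ?_⟩
  · obtain ⟨hx, hxY⟩ := Finset.mem_sdiff.1 hx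
    exact h.mem_of_mem_free_allNear_and hx (by simpa [List.mem_ofFn] using hxY)
  · refine Eq.congr_right (congrArg _ (Set.ext fun b => ?_))
    have himg : extend ys b β '' {x | x ∈ X} = β '' {x | x ∈ X} := image_extend_of_notMem hy
    have hb (E : Set A.Univ) :
        (∀ y ∈ List.ofFn ys, extend ys b β y ∈ E) ↔ ∀ j, b j ∈ E := by
      simp only [List.forall_mem_ofFn_iff, ys.injective.extend_apply]
    have hiff := h.satIn_allNear_and hk (himg ▸ hD)
    rw [hb] at hiff
    simpa only [Set.mem_univ, implies_true, true_and, Set.mem_ofPred_eq] using hiff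

end WFormula

/-! ### Scattered sets -/

section Scattered

variable {α : Type*} {G : SimpleGraph α} {R n : ℕ} {C : Set α} {l : List α} {P Q : α → Prop}

/-- Some element of `C` is at distance at most `r` from `b`. In the Gaifman graph this is
membership in `PreStructure.ball`. -/
def IsNear (G : SimpleGraph α) (r : ℕ) (C : Set α) (b : α) : Prop :=
  ∃ c ∈ C, G.edist c b ≤ r

/-- The entries of `l` are at pairwise distance more than `2 * R`. -/
def IsScattered (G : SimpleGraph α) (R : ℕ) (l : List α) : Prop :=
  l.Pairwise fun a b => ¬ G.edist a b ≤ (2 * R : ℕ)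

/-- There is a scattered set of size `k` in `Q`. -/
def HasScattered (G : SimpleGraph α) (R k : ℕ) (Q : α → Prop) : Prop :=
  ∃ l : List α, l.length = k ∧ IsScattered G R l ∧ ∀ b ∈ l, Q b

/-- Every element of `C` is within distance `R` of at most one entry. -/
theorem IsScattered.length_le (hl : IsScattered G R l) (hnear : ∀ b ∈ l, IsNear G R C b)
    (hC : C.encard ≤ n) : l.length ≤ n := by
  classical
  choose! f hfC hf using hnear
  have hnodup : (l.map f).Nodup := List.pairwise_map.2 <| hl.imp_of_mem
    fun {a b} ha hb hab heq => hab <|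
      edist_le_of_add_le (SimpleGraph.edist_comm ▸ hf a ha) (heq ▸ hf b hb) (by omega)
  have hsub : ((l.map f).toFinset : Set α) ⊆ C := fun c hc => by
    obtain ⟨b, hb, rfl⟩ := List.mem_map.1 (List.mem_toFinset.1 hc)
    exact hfC b hb
  have hcard := (Set.encard_le_encard hsub).trans hC
  rw [Set.encard_coe_eq_coe_finsetCard, List.toFinset_card_of_nodup hnodup,
    List.length_map] at hcard
  exact_mod_cast hcard

theorem IsScattered.cons (hl : IsScattered G R l) (hnear : ∀ b ∈ l, IsNear G R C b) {b : α}
    (hb : ¬ IsNear G (3 * R) C b) : IsScattered G R (b :: l) := by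
  refine List.pairwise_cons.2 ⟨fun a ha hab => hb ?_, hl⟩
  obtain ⟨c, hc, hca⟩ := hnear a ha
  rw [SimpleGraph.edist_comm] at hab
  exact ⟨c, hc, edist_le_of_add_le hca hab (by omega)⟩

/-- A far element extends every scattered set near `C`, so the largest one near `C`, of size at
most `|C|`, is not the largest one. -/
theorem exists_hasScattered_not_near (hC : C.encard ≤ n) {b : α} (hb : Q b)
    (hfar : ¬ IsNear G (3 * R) C b) :
    ∃ k < n + 1, HasScattered G R (k + 1) Q ∧
      ¬ HasScattered G R (k + 1) fun b => IsNear G R C b ∧ Q b := by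
  by_contra! hcon
  have hall : ∀ k ≤ n + 1, HasScattered G R k fun b => IsNear G R C b ∧ Q b := by
    intro k
    induction k with
    | zero => exact fun _ => ⟨[], by simp [IsScattered]⟩
    | succ k ih =>
      intro hk
      obtain ⟨l, hl, hscat, hQ⟩ := ih (by omega)
      exact hcon k (by omega) ⟨b :: l, by simp [hl], hscat.cons (fun a ha => (hQ a ha).1) hfar,
        List.forall_mem_cons.2 ⟨hb, fun a ha => (hQ a ha).2⟩⟩
  obtain ⟨l, hl, hscat, hQ⟩ := hall (n + 1) le_rfl
  have := hscat.length_le (fun b hb => (hQ b hb).1) hC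
  omega

theorem exists_iff_near_or_hasScattered (hC : C.encard ≤ n)
    (hPQ : ∀ b, ¬ IsNear G R C b → (P b ↔ Q b)) :
    (∃ b, P b) ↔ (∃ b, IsNear G R C b ∧ P b) ∨
      (∃ b, IsNear G (3 * R) C b ∧ ¬ IsNear G R C b ∧ Q b) ∨
      ∃ k < n + 1, HasScattered G R (k + 1) Q ∧
        ¬ HasScattered G R (k + 1) fun b => IsNear G R C b ∧ Q b := by
  constructor
  · rintro ⟨b, hb⟩
    by_cases hR : IsNear G R C b
    · exact .inl ⟨b, hR, hb⟩
    by_cases h3R : IsNear G (3 * R) C b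
    · exact .inr (.inl ⟨b, h3R, hR, (hPQ b hR).1 hb⟩)
    · exact .inr (.inr (exists_hasScattered_not_near hC ((hPQ b hR).1 hb) h3R))
  · rintro (⟨b, -, hb⟩ | ⟨b, -, hR, hb⟩ | ⟨k, -, ⟨l, hl, hscat, hQ⟩, hnot⟩)
    · exact ⟨b, hb⟩
    · exact ⟨b, (hPQ b hR).2 hb⟩
    · by_contra! hP
      refine hnot ⟨l, hl, hscat, fun b hb => ⟨?_, hQ b hb⟩⟩
      by_contra hR
      exact hP b ((hPQ b hR).2 (hQ b hb))

end Scattered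

namespace WFormula

variable {V : Vocabulary.{u, v, w}} {A : PreStructure V} {β γ : ℕ → A.Univ}
  {φ lam : WFormula V} {r R N k y : ℕ} {X zs : List ℕ}

/-- The variables in `zs` are at pairwise distance more than `2 * R` and satisfy `lam`, a formula
in the variable `y`. -/
def scatteredBody (R : ℕ) (lam : WFormula V) (y : ℕ) (zs : List ℕ) : WFormula V :=
  conj (farApart (distLE (2 * R)) zs ++ zs.map fun z => lam.rename (Equiv.swap y z))

/-- There is a scattered set of size `k` of elements that satisfy `lam`. -/
def scattered (R : ℕ) (lam : WFormula V) (y N k : ℕ) : WFormula V :=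
  exs (List.range' N k) (scatteredBody R lam y (List.range' N k))

/-- There is a scattered set of size `k` of elements near `X` that satisfy `lam`. -/
def scatteredNear (R : ℕ) (X : List ℕ) (lam : WFormula V) (y N k : ℕ) : WFormula V :=
  exs (List.range' N k)
    (and (allNear R X (List.range' N k)) (scatteredBody R lam y (List.range' N k)))

theorem forall_mem_farApart {D : Set A.Univ} {δ : ℕ → ℕ → WFormula V} :
    (∀ φ ∈ farApart δ zs, φ.SatIn A D β) ↔ zs.Pairwise fun y z => ¬ (δ y z).SatIn A D β := by
  induction zs with
  | nil => simp [farApart]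
  | cons z zs ih =>
    simp only [farApart, List.mem_append, or_imp, forall_and, ih, List.pairwise_cons,
      List.forall_mem_map, satIn_not]

theorem exists_eq_not_of_mem_farApart {δ : ℕ → ℕ → WFormula V} (hφ : φ ∈ farApart δ zs) :
    ∃ y ∈ zs, ∃ z ∈ zs, not (δ y z) = φ := by
  induction zs with
  | nil => simp [farApart] at hφ
  | cons z zs ih =>
    simp only [farApart, List.mem_append, List.mem_map] at hφ
    rcases hφ with ⟨y, hy, rfl⟩ | hφ
    · exact ⟨z, by simp, y, by simp [hy], rfl⟩
    · obtain ⟨y, hy, z', hz', rfl⟩ := ih hφ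
      exact ⟨y, by simp [hy], z', by simp [hz'], rfl⟩

theorem satIn_rename_swap {z : ℕ} (hlam : lam.free ⊆ {y}) :
    (lam.rename (Equiv.swap y z)).SatIn A Set.univ γ ↔
      lam.SatIn A Set.univ (update β y (γ z)) := by
  rw [satIn_rename]
  refine satIn_congr _ fun x hx => ?_
  obtain rfl := Finset.mem_singleton.1 (hlam hx)
  simp

theorem satIn_scatteredBody (hlam : lam.free ⊆ {y}) :
    (scatteredBody R lam y zs).SatIn A Set.univ γ ↔ IsScattered A.gaifman R (zs.map γ) ∧
      ∀ b ∈ zs.map γ, lam.SatIn A Set.univ (update β y b) := by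
  simp only [scatteredBody, IsScattered, satIn_conj, List.mem_append, or_imp, forall_and,
    forall_mem_farApart, satIn_distLE (Set.subset_univ _), List.forall_mem_map, List.pairwise_map]
  exact and_congr_right fun _ => forall₂_congr fun z _ => satIn_rename_swap hlam

theorem exists_assignment_iff_exists_list {α : Type*} {β : ℕ → α} {Q : List α → Prop} :
    (∃ β' : ℕ → α, (∀ x ∉ List.range' N k, β' x = β x) ∧ Q ((List.range' N k).map β')) ↔
      ∃ l : List α, l.length = k ∧ Q l := by
  constructor
  · rintro ⟨β', -, h⟩
    exact ⟨_, by simp, h⟩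
  · rintro ⟨l, rfl, h⟩
    refine ⟨assignBlock β N l.get, fun x hx => assignBlock_of_not_mem (by simpa using hx), ?_⟩
    convert h
    refine List.ext_getElem (by simp) fun i h₁ h₂ => ?_
    have := assignBlock_add β N l.get ⟨i, h₂⟩
    simpa using this

theorem satIn_scattered (hlam : lam.free ⊆ {y}) :
    (scattered R lam y N k).SatIn A Set.univ β ↔
      HasScattered A.gaifman R k fun b => lam.SatIn A Set.univ (update β y b) := by
  rw [scattered, satIn_exs, HasScattered,
    ← exists_assignment_iff_exists_list (N := N) (β := β)]
  simp only [Set.mem_univ, implies_true, true_and, satIn_scatteredBody (β := β) hlam]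

theorem notMem_of_mem_range' (hN : ∀ x ∈ X, x < N) : ∀ z ∈ List.range' N k, z ∉ X :=
  fun z hz hzX => (hN z hzX).not_ge (List.mem_range'_1.1 hz).1

theorem satIn_scatteredNear (hlam : lam.free ⊆ {y}) (hN : ∀ x ∈ X, x < N) :
    (scatteredNear R X lam y N k).SatIn A Set.univ β ↔ HasScattered A.gaifman R k fun b =>
      IsNear A.gaifman R (β '' {x | x ∈ X}) b ∧ lam.SatIn A Set.univ (update β y b) := by
  rw [scatteredNear, satIn_exs, HasScattered,
    ← exists_assignment_iff_exists_list (N := N) (β := β)]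
  refine exists_congr fun β' => and_congr_right fun hβ' => ?_
  have himg : β' '' {x | x ∈ X} = β '' {x | x ∈ X} :=
    Set.image_congr fun x hx => hβ' x fun hx' => notMem_of_mem_range' hN x hx' hx
  simp only [Set.mem_univ, implies_true, true_and, satIn_and, satIn_scatteredBody (β := β) hlam,
    satIn_allNear (Set.subset_univ _), himg, List.forall_mem_map, forall₂_and]
  exact and_left_comm

theorem stronglyLocal_scatteredBody (hlam : lam.StronglyLocal r {x | x ∈ [y]}) (hr : r ≤ 2 * R) :
    (scatteredBody R lam y zs).StronglyLocal (2 * R) {x | x ∈ zs} := by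
  refine .conj fun φ hφ => ?_
  rcases List.mem_append.1 hφ with hφ | hφ
  · obtain ⟨x, hx, z, hz, rfl⟩ := exists_eq_not_of_mem_farApart hφ
    refine ((stronglyLocal_distLE _ x z).mono le_rfl ?_).not
    rintro v (rfl | rfl) <;> assumption
  · obtain ⟨z, hz, rfl⟩ := List.mem_map.1 hφ
    refine (hlam.rename _).mono hr ?_
    rintro _ ⟨x, hx, rfl⟩
    obtain rfl := List.mem_singleton.1 hx
    simpa using hz

theorem stronglyLocal_scatteredNear (hlam : lam.StronglyLocal r {x | x ∈ [y]}) (hr : r ≤ 2 * R)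
    (hN : ∀ x ∈ X, x < N) : (scatteredNear R X lam y N k).StronglyLocal (3 * R) {x | x ∈ X} :=
  ((stronglyLocal_scatteredBody hlam hr).mono le_rfl fun _ => .inr).exs_near
    (notMem_of_mem_range' hN) (by omega)

theorem free_scattered (hlam : lam.StronglyLocal r {x | x ∈ [y]}) (hr : r ≤ 2 * R) :
    (scattered R lam y N k).free = ∅ := by
  refine Finset.eq_empty_of_forall_notMem fun x hx => ?_
  obtain ⟨hx, hxN⟩ := mem_free_exs.1 hx
  exact hxN ((stronglyLocal_scatteredBody hlam hr).1 hx)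

theorem isBasicLocal_scattered (hlam : lam.StronglyLocal r {x | x ∈ [y]}) (hr : r ≤ R)
    (hk : k ≠ 0) : (scattered R lam y N k).IsBasicLocal := by
  refine ⟨R, y, lam, List.range' N k, distLE (2 * R), by simpa using hk, List.nodup_range',
    ?_, fun y z => isDistLE_distLE _ _ _, rfl⟩
  exact (hlam.mono hr (by intro x; simp)).isLocalAround (Finset.singleton_nonempty y)

end WFormula

namespace WFormula

variable {V : Vocabulary.{u, v, w}} {A : PreStructure V} {D : Set A.Univ}
  {β : ℕ → A.Univ} {φ ψ lam : WFormula V} {r R : ℕ} {X Y : List ℕ}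

/-! ### Closure properties of normal forms -/

theorem rename_refl (φ : WFormula V) : φ.rename (Equiv.refl ℕ) = φ := by
  induction φ with
  | eq x y | rel R xs | wtEq a s xs => rfl
  | not φ ih => simp only [rename, ih]
  | or φ ψ ih₁ ih₂ => simp only [rename, ih₁, ih₂]
  | ex y φ ih => simp only [rename, ih, Equiv.refl_apply]
  | sumEq a hfin s ys φ ih => simp only [rename, ih]; rfl
  | pred P ts h => simp only [rename, WTerm.rename_refl]

theorem stronglyLocal_of_satIn_iff
    (h : ∀ (A : PreStructure V) (D : Set A.Univ) β, φ.SatIn A D β ↔ φ.SatIn A Set.univ β) :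
    φ.StronglyLocal 0 φ.free :=
  ⟨subset_rfl, fun A D β _ => h A D β⟩

theorem IsGaifmanNF.and (h : φ.IsGaifmanNF) (h' : ψ.IsGaifmanNF) : (and φ ψ).IsGaifmanNF :=
  (h.not.or h'.not).not

theorem isGaifmanNF_ex_zero (hloc : φ.StronglyLocal r {0}) : (ex 0 φ).IsGaifmanNF := by
  refine .basicLocal ⟨r, 0, φ, [0], distLE (2 * r), by simp, by simp, ?_,
    fun _ _ => isDistLE_distLE _ _ _, ?_⟩
  · exact (hloc.mono le_rfl (by simp)).isLocalAround (Finset.singleton_nonempty 0)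
  · simp [exs, farApart, conj, rename_refl]

theorem isGaifmanNF_tt : (tt : WFormula V).IsGaifmanNF :=
  have hloc : (eq 0 0 : WFormula V).StronglyLocal 0 (eq 0 0 : WFormula V).free :=
    stronglyLocal_of_satIn_iff fun _ _ _ => Iff.rfl
  .not (isGaifmanNF_ex_zero (hloc.mono le_rfl (by simp [free])).not)

theorem IsGaifmanNF.disj {l : List (WFormula V)} (h : ∀ φ ∈ l, φ.IsGaifmanNF) :
    (disj l).IsGaifmanNF := by
  induction l with
  | nil => exact isGaifmanNF_tt.not
  | cons φ l ih => exact (h φ (by simp)).or (ih fun ψ hψ => h ψ (by simp [hψ]))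

/-- Sentences in Gaifman normal form. -/
def IsNFSentence (φ : WFormula V) : Prop := φ.IsGaifmanNF ∧ φ.free = ∅

theorem isNFSentence_tt : (tt : WFormula V).IsNFSentence := ⟨isGaifmanNF_tt, free_tt⟩

theorem IsNFSentence.not (h : φ.IsNFSentence) : (not φ).IsNFSentence := ⟨h.1.not, h.2⟩

theorem IsNFSentence.and (h : φ.IsNFSentence) (h' : ψ.IsNFSentence) : (and φ ψ).IsNFSentence :=
  ⟨h.1.and h'.1, by rw [free_and, h.2, h'.2, Finset.empty_union]⟩

theorem isNFSentence_scattered {N k y : ℕ} (hlam : lam.StronglyLocal r {x | x ∈ [y]})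
    (hr : r ≤ R) (hk : k ≠ 0) : (scattered R lam y N k).IsNFSentence :=
  ⟨.basicLocal (isBasicLocal_scattered hlam hr hk), free_scattered hlam (by omega)⟩

theorem isNFSentence_sumEq {a : Fin V.numWt} {hfin : Finite (V.Elem (V.wtType a))}
    {s : V.Elem (V.wtType a)} {ys : Fin (V.wtArity a) ↪ ℕ}
    (hlam : lam.StronglyLocal r {x | x ∈ List.ofFn ys}) : (sumEq a hfin s ys lam).IsNFSentence := by
  have hys : {x | x ∈ List.ofFn ys} = (Finset.univ.image ys : Set ℕ) := by
    ext x
    simp [List.mem_ofFn]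
  rw [hys] at hlam
  refine ⟨.aggregation ⟨a, hfin, s, ys, lam, r, hlam.isLocalAround ?_, rfl⟩, ?_⟩
  · exact ⟨ys ⟨0, V.wtArity_pos a⟩, by simp⟩
  · exact Finset.sdiff_eq_empty_iff_subset.2 (by exact_mod_cast hlam.1)

namespace Cases

variable {l m : Cases V} {S : Set ℕ} {T : Prop}

/-- The guards are sentences in Gaifman normal form, and the bodies are `r`-local around `X`. -/
def IsNormal (l : Cases V) (r : ℕ) (X : Set ℕ) : Prop :=
  ∀ c ∈ l, c.1.IsNFSentence ∧ c.2.StronglyLocal r X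

theorem isNormal_singleton_tt (h : φ.StronglyLocal r S) : IsNormal [(tt, φ)] r S :=
  List.forall_mem_singleton.2 ⟨isNFSentence_tt, h⟩

theorem decides_singleton_tt :
    Decides [(tt, φ)] A Set.univ Set.univ β (φ.SatIn A Set.univ β) :=
  ⟨⟨_, List.mem_singleton_self _, satIn_tt⟩, List.forall_mem_singleton.2 fun _ => Iff.rfl⟩

theorem IsNormal.expand {base : WFormula V} (hbase : base.StronglyLocal r S)
    (h : ∀ c ∈ l, c.1.StronglyLocal r S ∧ c.2.IsNFSentence) :
    (expand base l).IsNormal r S := by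
  induction l with
  | nil => exact isNormal_singleton_tt hbase
  | cons c l ih =>
    intro d hd
    obtain ⟨e, he, hd⟩ := List.mem_flatMap.1 hd
    simp only [List.mem_cons, List.not_mem_nil, or_false] at hd
    obtain ⟨hμ, hθ⟩ := h c (by simp)
    obtain ⟨hguard, hbody⟩ := ih (fun c hc => h c (by simp [hc])) e he
    rcases hd with rfl | rfl
    exacts [⟨hθ.and hguard, hμ.or hbody⟩, ⟨hθ.not.and hguard, hbody⟩]

theorem Decides.expand {D₁ D₂ : Set A.Univ} {base : WFormula V}
    (h : T ↔ base.SatIn A D₂ β ∨ ∃ c ∈ l, c.2.SatIn A D₁ β ∧ c.1.SatIn A D₂ β) :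
    (expand base l).Decides A D₁ D₂ β T :=
  ⟨exhaustive_expand _ _, fun _ hd h₁ => h.trans (satIn_expand hd h₁).symm⟩

theorem IsNormal.mono {r' : ℕ} {S' : Set ℕ} (h : l.IsNormal r S) (hr : r ≤ r') (hS : S ⊆ S') :
    l.IsNormal r' S' :=
  fun c hc => ⟨(h c hc).1, (h c hc).2.mono hr hS⟩

theorem IsNormal.neg (h : l.IsNormal r S) : l.neg.IsNormal r S := by
  intro d hd
  obtain ⟨c, hc, rfl⟩ := List.mem_map.1 hd
  exact ⟨(h c hc).1, (h c hc).2.not⟩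

theorem IsNormal.either (h : l.IsNormal r S) (h' : m.IsNormal r S) :
    (l.either m).IsNormal r S := by
  intro d hd
  obtain ⟨c, hc, e, he, rfl⟩ := mem_combine.1 hd
  exact ⟨(h c hc).1.and (h' e he).1, (h c hc).2.or (h' e he).2⟩

/-- Continues each case with a case distinction that depends on its body. -/
def bind (l : Cases V) (f : WFormula V → Cases V) : Cases V :=
  l.flatMap fun c => (f c.2).map fun d => (and c.1 d.1, d.2)

theorem mem_bind {f : WFormula V → Cases V} {d : WFormula V × WFormula V} :
    d ∈ l.bind f ↔ ∃ c ∈ l, ∃ e ∈ f c.2, (and c.1 e.1, e.2) = d := by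
  simp [bind, List.mem_flatMap]

theorem IsNormal.bind {r' : ℕ} {S' : Set ℕ} {f : WFormula V → Cases V} (h : l.IsNormal r S)
    (hf : ∀ φ : WFormula V, φ.StronglyLocal r S → (f φ).IsNormal r' S') :
    (l.bind f).IsNormal r' S' := by
  intro d hd
  obtain ⟨c, hc, e, he, rfl⟩ := mem_bind.1 hd
  obtain ⟨hguard, hbody⟩ := hf _ (h c hc).2 e he
  exact ⟨(h c hc).1.and hguard, hbody⟩

theorem Decides.bind {D₁ D₂ : Set A.Univ} {f : WFormula V → Cases V}
    (hl : l.Exhaustive A D₁ β)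
    (h : ∀ c ∈ l, c.1.SatIn A D₁ β → (f c.2).Decides A D₁ D₂ β T) :
    (l.bind f).Decides A D₁ D₂ β T := by
  refine ⟨?_, fun d hd h₁ => ?_⟩
  · obtain ⟨c, hc, hc₁⟩ := hl
    obtain ⟨⟨e, he, he₁⟩, -⟩ := h c hc hc₁
    exact ⟨_, mem_bind.2 ⟨c, hc, e, he, rfl⟩, satIn_and.2 ⟨hc₁, he₁⟩⟩
  · obtain ⟨c, hc, e, he, rfl⟩ := mem_bind.1 hd
    rw [satIn_and] at h₁
    exact (h c hc h₁.1).2 e he h₁.2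

end Cases

/-! ### Elimination of a binder in front of a local formula -/

/-- The radius of locality after the elimination of a binder in front of an `r`-local formula.
Elements outside the ball of radius `R = 2 * r + 2` are so far that `r`-balls around them are
separated from `r`-balls around the free variables, and so are all the tuples of non-zero weight
with an entry outside this ball. The witnesses to look for have distance at most `3 * R`, and
what is said about them is `R`-local. -/
def nextRadius (r : ℕ) : ℕ := 4 * (2 * r + 2)

/-- Case distinction for `∃ y lam`, where `lam` is `r`-local around `X` and `y`. -/
noncomputable def exStep (r : ℕ) (X : List ℕ) (y : ℕ) (lam : WFormula V) : Cases V :=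
  Cases.expand
    (or (ex y (and (near (2 * r + 2) X y) lam))
      (disj ((splitBalls r X [y] lam).map fun c =>
        and c.1 (ex y (and (near (3 * (2 * r + 2)) X y)
          (and (not (near (2 * r + 2) X y)) c.2))))))
    ((splitBalls r X [y] lam).flatMap fun c => (List.range (X.length + 1)).map fun k =>
      (and c.1 (not (scatteredNear (2 * r + 2) X c.2 y (listBound X) (k + 1))),
        scattered (2 * r + 2) c.2 y (listBound X) (k + 1)))

/-- For a formula `(s = ∑ …)`, the formulas `(s₁ = ∑ …)`, `(s₂ = ∑ …)`, `(s₃ = ∑ …)` with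
`s = s₁ - s₂ + s₃`. -/
noncomputable def sumTriples : WFormula V → List (WFormula V × WFormula V × WFormula V)
  | sumEq a hfin s ys φ =>
      have := Fintype.ofFinite (V.Elem (V.wtType a))
      Finset.univ.toList.flatMap fun s₁ => Finset.univ.toList.map fun s₂ =>
        (sumEq a hfin s₁ ys φ, sumEq a hfin s₂ ys φ, sumEq a hfin (s - s₁ + s₂) ys φ)
  | _ => []

theorem mem_sumTriples {a : Fin V.numWt} {hfin : Finite (V.Elem (V.wtType a))}
    {s : V.Elem (V.wtType a)} {ys : Fin (V.wtArity a) ↪ ℕ}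
    {p : WFormula V × WFormula V × WFormula V} :
    p ∈ (sumEq a hfin s ys φ).sumTriples ↔ ∃ s₁ s₂,
      (sumEq a hfin s₁ ys φ, sumEq a hfin s₂ ys φ, sumEq a hfin (s - s₁ + s₂) ys φ) = p := by
  simp only [sumTriples, List.mem_flatMap, List.mem_map, Finset.mem_toList, Finset.mem_univ,
    true_and]

/-- Case distinction for `node`, a formula `(s = ∑ a(Y).…)`, with the body replaced by `lam`, which
is `r`-local around `X` and `Y`. The sum is computed from that of the part `c.2` of `lam` over all
tuples, the guard, by subtracting the contribution of the tuples near `X` and adding the sum of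
`lam` over these. -/
noncomputable def sumStep (r : ℕ) (X Y : List ℕ) (node lam : WFormula V) : Cases V :=
  Cases.expand ff ((splitBalls r X Y lam).flatMap fun c => node.sumTriples.map fun p =>
    (and c.1 (and (p.2.1.setBody (and (allNear (2 * r + 2) X Y) c.2))
      (p.2.2.setBody (and (allNear (2 * r + 2) X Y) lam))), p.1.setBody c.2))

theorem isNormal_exStep {y : ℕ} (hlam : lam.StronglyLocal r {x | x ∈ X ∨ x ∈ [y]})
    (hy : y ∉ X) : (exStep r X y lam).IsNormal (nextRadius r) {x | x ∈ X} := by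
  unfold exStep nextRadius
  refine Cases.IsNormal.expand (.or (hlam.ex_near hy (by omega)) (.disj fun φ hφ => ?_))
    fun c hc => ?_
  · obtain ⟨c, hc, rfl⟩ := List.mem_map.1 hφ
    obtain ⟨h₁, h₂⟩ := stronglyLocal_splitBalls hlam hc
    have hfar : (and (not (near (2 * r + 2) X y)) c.2).StronglyLocal (2 * r + 2)
        {x | x ∈ X ∨ x ∈ [y]} :=
      .and (stronglyLocal_near _ _ _).not (h₂.mono (by omega) fun x => .inr)
    exact .and (h₁.mono (by omega) subset_rfl) (hfar.ex_near hy (by omega))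
  · obtain ⟨c, hc', hc⟩ := List.mem_flatMap.1 hc
    obtain ⟨k, -, rfl⟩ := List.mem_map.1 hc
    obtain ⟨h₁, h₂⟩ := stronglyLocal_splitBalls hlam hc'
    have hscat := stronglyLocal_scatteredNear (R := 2 * r + 2) (k := k + 1) h₂ (by omega)
      fun x hx => lt_listBound (l := X) hx
    exact ⟨.and (h₁.mono (by omega) subset_rfl) (hscat.mono (by omega) subset_rfl).not,
      isNFSentence_scattered h₂ (by omega) (by omega)⟩

theorem encard_setOf_mem_le {α : Type*} (l : List α) : {x | x ∈ l}.encard ≤ l.length := by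
  classical
  rw [← List.coe_toFinset, Set.encard_coe_eq_coe_finsetCard]
  exact_mod_cast List.toFinset_card_le l

theorem decides_exStep (hA : A.IsWeighted) {y : ℕ}
    (hlam : lam.StronglyLocal r {x | x ∈ X ∨ x ∈ [y]}) (hy : y ∉ X) :
    (exStep r X y lam).Decides A Set.univ Set.univ β ((ex y lam).SatIn A Set.univ β) := by
  set C : Set A.Univ := β '' {x | x ∈ X}
  have hcard : C.encard ≤ X.length := (Set.encard_image_le _ _).trans (encard_setOf_mem_le X)
  have hnear (b : A.Univ) (s : ℕ) :
      (near s X y).SatIn A Set.univ (update β y b) ↔ IsNear A.gaifman s C b := by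
    rw [satIn_near (Set.subset_univ _), image_update_of_notMem (X := {x | x ∈ X}) hy, update_self]
    rfl
  have hfar : ∀ c ∈ splitBalls r X [y] lam, c.1.SatIn A Set.univ β →
      ∀ b, ¬ IsNear A.gaifman (2 * r + 2) C b →
      (lam.SatIn A Set.univ (update β y b) ↔ c.2.SatIn A Set.univ (update β y b)) := by
    intro c hc h b hb
    refine satIn_splitBalls hA hlam hc h (fun x hx => update_of_ne (ne_of_mem_of_not_mem hx hy) _ _)
      (List.forall_mem_singleton.2 fun hle => hb ?_)
    rw [update_self] at hle
    exact PreStructure.ball_mono (by omega) subset_rfl hle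
  have hfree : ∀ c ∈ splitBalls r X [y] lam, c.2.free ⊆ {y} := fun c hc x hx => by
    simpa using (stronglyLocal_splitBalls hlam hc).2.1 hx
  have hN : ∀ x ∈ X, x < listBound X := fun x => lt_listBound
  have hmain := exhaustive_splitBalls.iff_or_exists fun c hc h =>
    exists_iff_near_or_hasScattered hcard (hfar c hc h)
  refine Cases.Decides.expand ?_
  simp only [satIn_or, satIn_disj, List.mem_map, List.mem_flatMap, exists_exists_and_eq_and,
    satIn_and, satIn_ex, satIn_not, Set.mem_univ, true_and, hnear, List.mem_range]
  rw [hmain, or_assoc]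
  refine or_congr_right ?_
  constructor
  · rintro ⟨c, hc, hc₁, h | ⟨k, hk, hs, hn⟩⟩
    · exact .inl ⟨c, hc, hc₁, h⟩
    · exact .inr ⟨_, ⟨c, hc, k, hk, rfl⟩, (satIn_scattered (hfree c hc)).2 hs,
        satIn_and.2 ⟨hc₁, mt (satIn_scatteredNear (hfree c hc) hN).1 hn⟩⟩
  · rintro (⟨c, hc, hc₁, h⟩ | ⟨_, ⟨c, hc, k, hk, rfl⟩, hs, h⟩)
    · exact ⟨c, hc, hc₁, .inl h⟩
    · obtain ⟨hc₁, hn⟩ := satIn_and.1 h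
      exact ⟨c, hc, hc₁, .inr ⟨k, hk, (satIn_scattered (hfree c hc)).1 hs,
        mt (satIn_scatteredNear (hfree c hc) hN).2 hn⟩⟩

section SumStep

variable {a : Fin V.numWt} {hfin : Finite (V.Elem (V.wtType a))} {s : V.Elem (V.wtType a)}
  {ys : Fin (V.wtArity a) ↪ ℕ}

theorem isNormal_sumStep (hlam : lam.StronglyLocal r {x | x ∈ X ∨ x ∈ List.ofFn ys})
    (hy : ∀ j, ys j ∉ X) :
    (sumStep r X (List.ofFn ys) (sumEq a hfin s ys φ) lam).IsNormal (nextRadius r)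
      {x | x ∈ X} := by
  unfold sumStep nextRadius
  refine Cases.IsNormal.expand .ff fun c hc => ?_
  obtain ⟨c, hc', hc⟩ := List.mem_flatMap.1 hc
  obtain ⟨p, hp, rfl⟩ := List.mem_map.1 hc
  obtain ⟨s₁, s₂, rfl⟩ := mem_sumTriples.1 hp
  obtain ⟨h₁, h₂⟩ := stronglyLocal_splitBalls hlam hc'
  refine ⟨.and (h₁.mono (by omega) subset_rfl) (.and ?_ ?_), isNFSentence_sumEq h₂⟩
  · exact (h₂.mono le_rfl fun x => .inr).sumEq_near hy (by omega)
  · exact hlam.sumEq_near hy (by omega)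

/-- The tuples `b` for which `φ` holds with `b` as the values of `ys`. -/
def tuples (A : PreStructure V) (β : ℕ → A.Univ) (ys : Fin (V.wtArity a) ↪ ℕ) (φ : WFormula V) :
    Set (Fin (V.wtArity a) → A.Univ) :=
  {b | φ.SatIn A Set.univ (extend ys b β)}

theorem satIn_sumEq_univ :
    (sumEq a hfin s ys φ).SatIn A Set.univ β ↔ s = A.wsum a (tuples A β ys φ) := by
  simp [SatIn, tuples]

theorem tuples_allNear_and (hy : ∀ j, ys j ∉ X) :
    tuples A β ys (and (allNear R X (List.ofFn ys)) φ) =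
      {b | ∀ j, b j ∈ A.ball R (β '' {x | x ∈ X})} ∩ tuples A β ys φ := by
  ext b
  refine satIn_and.trans (and_congr_left fun _ => ?_)
  rw [satIn_allNear (Set.subset_univ _), image_extend_of_notMem (X := {x | x ∈ X}) hy]
  simp only [List.forall_mem_ofFn_iff, ys.injective.extend_apply, Set.mem_ofPred_eq]

/-- A tuple of non-zero weight has diameter at most one, so that it is far from `X` as a whole
unless it is near `X` as a whole. -/
theorem wsum_splitBalls (hA : A.IsWeighted)
    (hlam : lam.StronglyLocal r {x | x ∈ X ∨ x ∈ List.ofFn ys}) (hy : ∀ j, ys j ∉ X)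
    {c : WFormula V × WFormula V} (hc : c ∈ splitBalls r X (List.ofFn ys) lam)
    (h : c.1.SatIn A Set.univ β) :
    A.wsum a (tuples A β ys lam) = A.wsum a (tuples A β ys c.2) -
      A.wsum a (tuples A β ys (and (allNear (2 * r + 2) X (List.ofFn ys)) c.2)) +
      A.wsum a (tuples A β ys (and (allNear (2 * r + 2) X (List.ofFn ys)) lam)) := by
  rw [tuples_allNear_and hy, tuples_allNear_and hy]
  refine PreStructure.wsum_eq_sub_add fun b hb hwt => satIn_splitBalls hA hlam hc h
    (fun x hx => extend_apply' _ _ _ fun ⟨j, hj⟩ => hy j (hj ▸ hx)) ?_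
  simp only [Set.mem_ofPred_eq, not_forall] at hb
  obtain ⟨i, hi⟩ := hb
  rw [List.forall_mem_ofFn_iff]
  rintro j ⟨x, hx, hxj⟩
  rw [ys.injective.extend_apply] at hxj
  exact hi ⟨x, hx, edist_le_of_add_le hxj (hA.edist_le_one hwt j i) (by omega)⟩

theorem decides_sumStep (hA : A.IsWeighted)
    (hlam : lam.StronglyLocal r {x | x ∈ X ∨ x ∈ List.ofFn ys}) (hy : ∀ j, ys j ∉ X) :
    (sumStep r X (List.ofFn ys) (sumEq a hfin s ys φ) lam).Decides A Set.univ Set.univ β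
      ((sumEq a hfin s ys lam).SatIn A Set.univ β) := by
  refine Cases.Decides.expand ?_
  simp only [satIn_ff, false_or, List.mem_flatMap, List.mem_map, mem_sumTriples]
  let nearby := allNear (V := V) (2 * r + 2) X (List.ofFn ys)
  constructor
  · intro h
    obtain ⟨c, hc, hc₁⟩ := exhaustive_splitBalls (A := A) (β := β)
    refine ⟨_, ⟨c, hc, _, ⟨A.wsum a (tuples A β ys c.2),
      A.wsum a (tuples A β ys (and nearby c.2)), rfl⟩, rfl⟩, ?_⟩
    rw [satIn_sumEq_univ, wsum_splitBalls hA hlam hy hc hc₁] at h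
    simp only [setBody, satIn_and, satIn_sumEq_univ, true_and, hc₁, h, nearby]
    abel
  · rintro ⟨_, ⟨c, hc, _, ⟨s₁, s₂, rfl⟩, rfl⟩, h⟩
    simp only [setBody, satIn_and, satIn_sumEq_univ] at h
    obtain ⟨h₁, hc₁, h₂, h₃⟩ := h
    rw [satIn_sumEq_univ, wsum_splitBalls hA hlam hy hc hc₁, ← h₁, ← h₂, ← h₃]
    abel

end SumStep

/-! ### The normal form -/

/-- A radius `r` and a case distinction with sentences in normal form as guards and `r`-local
formulas as bodies. -/
noncomputable def gnf : WFormula V → ℕ × Cases V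
  | not φ => (φ.gnf.1, φ.gnf.2.neg)
  | or φ ψ => (max φ.gnf.1 ψ.gnf.1, φ.gnf.2.either ψ.gnf.2)
  | ex y φ => (nextRadius φ.gnf.1, φ.gnf.2.bind (exStep φ.gnf.1 (ex y φ).freeList y))
  | sumEq a hfin s ys φ => (nextRadius φ.gnf.1,
      φ.gnf.2.bind (sumStep φ.gnf.1 (sumEq a hfin s ys φ).freeList (List.ofFn ys)
        (sumEq a hfin s ys φ)))
  | φ => (0, [(tt, φ)])

theorem setOf_freeList_ex_subset (y : ℕ) (φ : WFormula V) :
    (φ.free : Set ℕ) ⊆ {x | x ∈ (ex y φ).freeList ∨ x ∈ [y]} := by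
  intro x hx
  simp only [Set.mem_ofPred_eq, mem_freeList, free, Finset.mem_sdiff, Finset.mem_singleton,
    List.mem_singleton]
  have : x ∈ φ.free := hx
  tauto

theorem setOf_freeList_sumEq_subset {a : Fin V.numWt} {hfin : Finite (V.Elem (V.wtType a))}
    {s : V.Elem (V.wtType a)} {ys : Fin (V.wtArity a) ↪ ℕ} (φ : WFormula V) :
    (φ.free : Set ℕ) ⊆ {x | x ∈ (sumEq a hfin s ys φ).freeList ∨ x ∈ List.ofFn ys} := by
  intro x hx
  simp only [Set.mem_ofPred_eq, mem_freeList, free, Finset.mem_sdiff, Finset.mem_image,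
    Finset.mem_univ, true_and, List.mem_ofFn]
  have : x ∈ φ.free := hx
  tauto

theorem setOf_freeList (φ : WFormula V) : {x | x ∈ φ.freeList} = (φ.free : Set ℕ) := by
  ext x
  exact mem_freeList φ

theorem isNormal_gnf (φ : WFormula V) : φ.gnf.2.IsNormal φ.gnf.1 φ.free := by
  induction φ with
  | eq x y | rel R xs | wtEq a s xs | pred P ts h =>
    exact Cases.isNormal_singleton_tt (stronglyLocal_of_satIn_iff fun _ _ _ => Iff.rfl)
  | not φ ih => exact ih.neg
  | or φ ψ ih₁ ih₂ =>
    exact (ih₁.mono (le_max_left _ _) (by simp [free])).either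
      (ih₂.mono (le_max_right _ _) (by simp [free]))
  | ex y φ ih =>
    refine ih.bind fun lam hlam => ?_
    rw [← setOf_freeList]
    exact isNormal_exStep (hlam.mono le_rfl (setOf_freeList_ex_subset y φ))
      (by simp [mem_freeList, free])
  | sumEq a hfin s ys φ ih =>
    refine ih.bind fun lam hlam => ?_
    rw [← setOf_freeList]
    exact isNormal_sumStep (hlam.mono le_rfl (setOf_freeList_sumEq_subset φ))
      (by simp [mem_freeList, free])

theorem decides_gnf (hA : A.IsWeighted) (φ : WFormula V) (β : ℕ → A.Univ) :
    φ.gnf.2.Decides A Set.univ Set.univ β (φ.SatIn A Set.univ β) := by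
  induction φ generalizing β with
  | eq x y | rel R xs | wtEq a s xs | pred P ts h => exact Cases.decides_singleton_tt
  | not φ ih => exact (ih β).neg
  | or φ ψ ih₁ ih₂ => exact (ih₁ β).either (ih₂ β)
  | ex y φ ih =>
    refine Cases.Decides.bind (ih β).1 fun c hc h₁ => ?_
    have hn := isNormal_gnf φ c hc
    have : (ex y φ).SatIn A Set.univ β ↔ (ex y c.2).SatIn A Set.univ β := by
      refine exists_congr fun b => and_congr_right fun _ => (ih _).2 c hc ?_
      exact (satIn_congr _ (by simp [hn.1.2])).1 h₁
    rw [this]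
    exact decides_exStep hA (hn.2.mono le_rfl (setOf_freeList_ex_subset y φ))
      (by simp [mem_freeList, free])
  | sumEq a hfin s ys φ ih =>
    refine Cases.Decides.bind (ih β).1 fun c hc h₁ => ?_
    have hn := isNormal_gnf φ c hc
    have : (sumEq a hfin s ys φ).SatIn A Set.univ β ↔
        (sumEq a hfin s ys c.2).SatIn A Set.univ β := by
      refine Eq.congr_right (congrArg _ (Set.ext fun b => ?_))
      refine and_congr_right fun _ => (ih _).2 c hc ?_
      exact (satIn_congr _ (by simp [hn.1.2])).1 h₁
    rw [this]
    exact decides_sumStep hA (hn.2.mono le_rfl (setOf_freeList_sumEq_subset φ))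
      (by simp [mem_freeList, free])

/-- A formula with free variables `X` that is equivalent to the local formula `lam`. -/
def pad (X : List ℕ) (lam : WFormula V) : WFormula V :=
  if X = [] then ex 0 lam else and (conj (X.map fun x => eq x x)) lam

/-- The Gaifman normal form of a formula. -/
noncomputable def gaifmanNF (φ : WFormula V) : WFormula V :=
  and (conj (φ.freeList.map fun x => eq x x))
    (disj (φ.gnf.2.map fun c => and c.1 (pad φ.freeList c.2)))

theorem satIn_conj_eq_self : (conj (X.map fun x => eq x x)).SatIn A D β := by
  simp only [satIn_conj, List.forall_mem_map, SatIn, implies_true]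

theorem free_conj_eq_self : (conj (X.map fun x => eq x x) : WFormula V).free = X.toFinset := by
  ext v
  simp [mem_free_conj, free]

theorem stronglyLocal_conj_eq_self :
    (conj (X.map fun x => eq x x) : WFormula V).StronglyLocal r X.toFinset :=
  ⟨by rw [free_conj_eq_self], fun _ _ _ _ => iff_of_true satIn_conj_eq_self satIn_conj_eq_self⟩

theorem isGaifmanNF_conj_eq_self :
    (conj (X.map fun x => eq x x) : WFormula V).IsGaifmanNF := by
  by_cases hX : X = []
  · subst hX
    exact isGaifmanNF_tt
  · refine .loc ⟨0, ?_⟩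
    rw [free_conj_eq_self]
    exact stronglyLocal_conj_eq_self.isLocalAround (List.toFinset_nonempty_iff X |>.2 hX)

theorem isGaifmanNF_pad (h : lam.StronglyLocal r X.toFinset) : (pad X lam).IsGaifmanNF := by
  unfold pad
  split_ifs with hX
  · exact isGaifmanNF_ex_zero (h.mono le_rfl (by simp [hX]))
  · have hfree : (and (conj (X.map fun x => eq x x)) lam).free = X.toFinset := by
      rw [free_and, free_conj_eq_self]
      exact Finset.union_eq_left.2 (by exact_mod_cast h.1)
    refine .loc ⟨r, ?_⟩
    rw [hfree]
    exact (stronglyLocal_conj_eq_self.and h).isLocalAround (List.toFinset_nonempty_iff X |>.2 hX)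

theorem free_pad_subset (h : lam.StronglyLocal r X.toFinset) : (pad X lam).free ⊆ X.toFinset := by
  have h : lam.free ⊆ X.toFinset := by exact_mod_cast h.1
  unfold pad
  split_ifs with hX
  · exact Finset.sdiff_subset.trans h
  · rw [free_and, free_conj_eq_self]
    exact Finset.union_subset subset_rfl h

theorem satIn_pad (h : lam.StronglyLocal r X.toFinset) :
    (pad X lam).SatIn A Set.univ β ↔ lam.SatIn A Set.univ β := by
  unfold pad
  split_ifs with hX
  · have hfree : ∀ b, lam.SatIn A Set.univ (update β 0 b) ↔ lam.SatIn A Set.univ β := fun b =>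
      h.congr (by simp [hX])
    have := A.nonempty_univ
    simp [SatIn, hfree]
  · simp only [satIn_and, satIn_conj_eq_self, true_and]

theorem isNormal_gnf_freeList (φ : WFormula V) :
    φ.gnf.2.IsNormal φ.gnf.1 φ.freeList.toFinset := by
  rw [toFinset_freeList]
  exact isNormal_gnf φ

theorem isGaifmanNF_gaifmanNF (φ : WFormula V) : φ.gaifmanNF.IsGaifmanNF := by
  refine isGaifmanNF_conj_eq_self.and (.disj (List.forall_mem_map.2 fun c hc => ?_))
  obtain ⟨hguard, hbody⟩ := isNormal_gnf_freeList φ c hc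
  exact hguard.1.and (isGaifmanNF_pad hbody)

theorem equivalent_gaifmanNF (φ : WFormula V) : φ.Equivalent φ.gaifmanNF := by
  intro A hA β
  rw [← satIn_univ, ← satIn_univ, (decides_gnf hA φ β).iff_exists]
  simp only [gaifmanNF, satIn_and, satIn_conj_eq_self, true_and, satIn_disj, List.mem_map,
    exists_exists_and_eq_and]
  exact exists_congr fun c => and_congr_right fun hc => and_congr_right fun _ =>
    (satIn_pad (isNormal_gnf_freeList φ c hc).2).symm

theorem free_gaifmanNF (φ : WFormula V) : φ.gaifmanNF.free = φ.free := by
  rw [gaifmanNF, free_and, free_conj_eq_self, toFinset_freeList]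
  refine Finset.union_eq_left.2 fun x hx => ?_
  simp only [mem_free_disj, List.mem_map, exists_exists_and_eq_and, free_and] at hx
  obtain ⟨c, hc, hx⟩ := hx
  obtain ⟨hguard, hbody⟩ := isNormal_gnf_freeList φ c hc
  rw [hguard.2, Finset.empty_union] at hx
  simpa [toFinset_freeList] using free_pad_subset hbody hx

end WFormula

/-! ### Functions that are computable on codes -/

theorem exists_list_getD_eq {K : Type*} [Finite K] (e g : K → ℕ) (he : Injective e) :
    ∃ l : List ℕ, ∀ k, l.getD (e k) 0 = g k := by
  obtain ⟨N, hN⟩ := (Set.finite_range e).bddAbove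
  refine ⟨(List.range (N + 1)).map (extend e g 0), fun k => ?_⟩
  have : e k < N + 1 := Nat.lt_succ_of_le (hN ⟨k, rfl⟩)
  rw [List.getD_eq_getElem _ _ (by simpa using this)]
  simp [he.extend_apply]

/-- The function whose value at `n` is `g` applied to `n` and to its values at the members of `l n`.
The numbers code pairs, and a recursive call which does not decrease the first component is
ignored. -/
def codeRec (l : ℕ → List ℕ) (g : ℕ → ℕ) (n : ℕ) : ℕ :=
  g (Nat.pair n (Encodable.encode
    (((l n).filter fun m => m.unpair.1 < n.unpair.1).attach.map fun m => codeRec l g m.1)))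
termination_by n.unpair.1
decreasing_by
  have := m.2
  simp only [List.mem_filter, decide_eq_true_eq] at this
  exact this.2

theorem codeRec_eq (l : ℕ → List ℕ) (g : ℕ → ℕ) (n : ℕ) :
    codeRec l g n = g (Nat.pair n (Encodable.encode
      (((l n).filter fun m => m.unpair.1 < n.unpair.1).map (codeRec l g)))) := by
  rw [codeRec, List.attach_map_val]

theorem primrec_codeRec {l : ℕ → List ℕ} {g : ℕ → ℕ} (hl : Primrec l) (hg : Primrec g) :
    Primrec (codeRec l g) := by
  have hlt : PrimrecRel fun m n : ℕ => m.unpair.1 < n.unpair.1 :=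
    Primrec.nat_lt.comp₂ (Primrec₂.mk (Primrec.fst.comp (Primrec.unpair.comp Primrec.fst)))
      (Primrec₂.mk (Primrec.fst.comp (Primrec.unpair.comp Primrec.snd)))
  refine Primrec.nat_omega_rec' (codeRec l g) (m := fun n => n.unpair.1)
    (l := fun n => (l n).filter fun m => m.unpair.1 < n.unpair.1)
    (g := fun n L => some (g (Nat.pair n (Encodable.encode L))))
    (Primrec.fst.comp Primrec.unpair) (hlt.listFilter.comp hl Primrec.id)
    (Primrec₂.mk (Primrec.option_some.comp (hg.comp (Primrec₂.natPair.comp Primrec.fst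
      (Primrec.encode.comp Primrec.snd))))) ?_ fun n =>
        congrArg some (codeRec_eq l g n).symm
  intro n m hm
  simpa using (List.mem_filter.1 hm).2

/-- A type whose elements have codes, which depend on a coding of the symbols of `V`. There is no
decoding, since distinct elements may have the same code: the constants of an uncountable ring
cannot be coded injectively. -/
class Coded (V : Vocabulary.{u, v, w}) (X : Type*) where
  /-- The code of an element. -/
  rep : SymbolCoding V → X → ℕ

namespace Coded

variable {V : Vocabulary.{u, v, w}} {X Y : Type*}

instance : Coded V ℕ := ⟨fun _ n => n⟩
instance : Coded V Bool := ⟨fun _ b => b.toNat⟩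
instance [Coded V X] [Coded V Y] : Coded V (X × Y) :=
  ⟨fun c p => Nat.pair (rep c p.1) (rep c p.2)⟩
instance [Coded V X] : Coded V (List X) := ⟨fun c l => Encodable.encode (l.map (rep c))⟩
instance : Coded V (WFormula V) := ⟨fun c φ => c.code φ⟩
instance : Coded V (Σ i, WTerm V i) := ⟨fun c t => c.termCode t.2⟩

end Coded

open Coded

/-- The function `F` is induced by a primitive recursive function on codes. That function is not
determined by `F`, and it may take any value at a number that is not a code. -/
@[fun_prop]
def Tracked {V : Vocabulary.{u, v, w}} (c : SymbolCoding V) {X Y : Type*} [Coded V X] [Coded V Y]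
    (F : X → Y) : Prop :=
  ∃ f : ℕ → ℕ, Primrec f ∧ ∀ x, f (rep c x) = rep c (F x)

namespace Tracked

variable {V : Vocabulary.{u, v, w}} {c : SymbolCoding V} {X Y Z P : Type*} [Coded V X] [Coded V Y]
  [Coded V Z] [Coded V P]

@[fun_prop]
theorem id' : Tracked c (fun x : X => x) := ⟨id, Primrec.id, fun _ => rfl⟩

@[fun_prop]
theorem const (y : Y) : Tracked c (fun _ : X => y) := ⟨_, Primrec.const (rep c y), fun _ => rfl⟩

@[fun_prop]
theorem comp {F : Y → Z} {G : X → Y} (hF : Tracked c F) (hG : Tracked c G) :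
    Tracked c fun x => F (G x) := by
  obtain ⟨f, hf, hf'⟩ := hF
  obtain ⟨g, hg, hg'⟩ := hG
  exact ⟨fun n => f (g n), hf.comp hg, fun x => by simp only [hg', hf']⟩

@[fun_prop]
theorem prodMk {F : X → Y} {G : X → Z} (hF : Tracked c F) (hG : Tracked c G) :
    Tracked c fun x => (F x, G x) := by
  obtain ⟨f, hf, hf'⟩ := hF
  obtain ⟨g, hg, hg'⟩ := hG
  exact ⟨fun n => Nat.pair (f n) (g n), Primrec₂.natPair.comp hf hg, fun x => by
    simp only [hf', hg']; rfl⟩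

@[fun_prop]
theorem fst {F : X → Y × Z} (hF : Tracked c F) : Tracked c fun x => (F x).1 := by
  obtain ⟨f, hf, hf'⟩ := hF
  exact ⟨fun n => (f n).unpair.1, Primrec.fst.comp (Primrec.unpair.comp hf), fun x => by
    simp only [hf']; simp [rep]⟩

@[fun_prop]
theorem snd {F : X → Y × Z} (hF : Tracked c F) : Tracked c fun x => (F x).2 := by
  obtain ⟨f, hf, hf'⟩ := hF
  exact ⟨fun n => (f n).unpair.2, Primrec.snd.comp (Primrec.unpair.comp hf), fun x => by
    simp only [hf']; simp [rep]⟩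

theorem nat₂ {h : ℕ → ℕ → ℕ} (hh : Primrec₂ h) {F G : X → ℕ} (hF : Tracked c F)
    (hG : Tracked c G) : Tracked c fun x => h (F x) (G x) := by
  obtain ⟨f, hf, hf'⟩ := hF
  obtain ⟨g, hg, hg'⟩ := hG
  exact ⟨_, hh.comp hf hg, fun x => congrArg₂ h (hf' x) (hg' x)⟩

@[fun_prop]
theorem add {F G : X → ℕ} (hF : Tracked c F) (hG : Tracked c G) :
    Tracked c fun x => F x + G x := nat₂ Primrec.nat_add hF hG

@[fun_prop]
theorem sub {F G : X → ℕ} (hF : Tracked c F) (hG : Tracked c G) :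
    Tracked c fun x => F x - G x := nat₂ Primrec.nat_sub hF hG

@[fun_prop]
theorem mul {F G : X → ℕ} (hF : Tracked c F) (hG : Tracked c G) :
    Tracked c fun x => F x * G x := nat₂ Primrec.nat_mul hF hG

@[fun_prop]
theorem max {F G : X → ℕ} (hF : Tracked c F) (hG : Tracked c G) :
    Tracked c fun x => max (F x) (G x) := nat₂ Primrec.nat_max hF hG

@[fun_prop]
theorem decide_eq {F G : X → ℕ} (hF : Tracked c F) (hG : Tracked c G) :
    Tracked c fun x => decide (F x = G x) := by
  obtain ⟨f, hf, hf'⟩ := hF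
  obtain ⟨g, hg, hg'⟩ := hG
  refine ⟨fun n => if f n = g n then 1 else 0, Primrec.ite (Primrec.eq.comp hf hg)
    (Primrec.const 1) (Primrec.const 0), fun x => ?_⟩
  simp only [hf', hg']
  change (if F x = G x then 1 else 0) = (decide (F x = G x)).toNat
  split_ifs with h <;> simp [h]

@[fun_prop]
theorem boolIte {b : X → Bool} {F G : X → Y} (hb : Tracked c b) (hF : Tracked c F)
    (hG : Tracked c G) : Tracked c fun x => if b x = true then F x else G x := by
  obtain ⟨p, hp, hp'⟩ := hb
  obtain ⟨f, hf, hf'⟩ := hF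
  obtain ⟨g, hg, hg'⟩ := hG
  refine ⟨fun n => if p n = 1 then f n else g n, Primrec.ite (Primrec.eq.comp hp
    (Primrec.const 1)) hf hg, fun x => ?_⟩
  simp only [hp', hf', hg']
  cases h : b x <;> simp [rep]

@[fun_prop]
theorem ite {p : X → Prop} [DecidablePred p] {F G : X → Y} (hb : Tracked c fun x => decide (p x))
    (hF : Tracked c F) (hG : Tracked c G) : Tracked c fun x => if p x then F x else G x := by
  simpa using hb.boolIte hF hG

@[fun_prop]
theorem foldr {l : X → List Y} {h : X → Y → Z → Z} {z : X → Z} (hl : Tracked c l)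
    (hh : Tracked c fun p : X × Y × Z => h p.1 p.2.1 p.2.2) (hz : Tracked c z) :
    Tracked c fun x => (l x).foldr (h x) (z x) := by
  obtain ⟨f, hf, hf'⟩ := hl
  obtain ⟨g, hg, hg'⟩ := hh
  obtain ⟨k, hk, hk'⟩ := hz
  refine ⟨fun n => (Denumerable.ofNat (List ℕ) (f n)).foldr
    (fun a b => g (Nat.pair n (Nat.pair a b))) (k n),
    Primrec.list_foldr (h := fun n q => g (Nat.pair n (Nat.pair q.1 q.2)))
      ((Primrec.ofNat _).comp hf) hk
      (Primrec₂.mk (hg.comp (Primrec₂.natPair.comp Primrec.fst (Primrec₂.natPair.comp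
        (Primrec.fst.comp Primrec.snd) (Primrec.snd.comp Primrec.snd))))), fun x => ?_⟩
  simp only [hf', hk']
  change List.foldr _ _ (Denumerable.ofNat (List ℕ) (Encodable.encode ((l x).map (rep c)))) = _
  rw [Denumerable.ofNat_encode]
  induction l x with
  | nil => rfl
  | cons y t ih =>
    simp only [List.map_cons, List.foldr_cons, ih]
    exact hg' (x, y, t.foldr (h x) (z x))

@[fun_prop]
theorem cons {F : X → Y} {l : X → List Y} (hF : Tracked c F) (hl : Tracked c l) :
    Tracked c fun x => F x :: l x := by
  obtain ⟨f, hf, hf'⟩ := hF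
  obtain ⟨g, hg, hg'⟩ := hl
  refine ⟨fun n => Nat.succ (Nat.pair (f n) (g n)),
    Primrec.succ.comp (Primrec₂.natPair.comp hf hg), fun x => ?_⟩
  simp only [hf', hg']
  simp [rep]

@[fun_prop]
theorem append {l m : X → List Y} (hl : Tracked c l) (hm : Tracked c m) :
    Tracked c fun x => l x ++ m x := by
  simp only [← List.foldr_cons_eq_append']
  fun_prop

@[fun_prop]
theorem map {l : X → List Y} {h : X → Y → Z} (hl : Tracked c l)
    (hh : Tracked c fun p : X × Y => h p.1 p.2) : Tracked c fun x => (l x).map (h x) := by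
  simp only [List.map_eq_foldr]
  have := hh.comp (G := fun p : X × Y × List Z => (p.1, p.2.1)) (by fun_prop)
  fun_prop

@[fun_prop]
theorem flatten {l : X → List (List Y)} (hl : Tracked c l) : Tracked c fun x => (l x).flatten := by
  have (x : X) : (l x).flatten = (l x).foldr (fun y t => y ++ t) [] := by
    induction l x with
    | nil => rfl
    | cons y t ih => rw [List.flatten_cons, List.foldr_cons, ih]
  simp only [this]
  fun_prop

@[fun_prop]
theorem flatMap {l : X → List Y} {h : X → Y → List Z} (hl : Tracked c l)
    (hh : Tracked c fun p : X × Y => h p.1 p.2) : Tracked c fun x => (l x).flatMap (h x) :=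
  (hl.map hh).flatten

@[fun_prop]
theorem filter {l : X → List Y} {p : X → Y → Bool} (hl : Tracked c l)
    (hp : Tracked c fun q : X × Y => p q.1 q.2) : Tracked c fun x => (l x).filter (p x) := by
  simp only [List.filter_eq_foldr, cond_eq_ite]
  have := hp.comp (G := fun q : X × Y × List Y => (q.1, q.2.1)) (by fun_prop)
  fun_prop

@[fun_prop]
theorem length {l : X → List Y} (hl : Tracked c l) : Tracked c fun x => (l x).length := by
  have (x : X) : (l x).length = (l x).foldr (fun _ n => n + 1) 0 := by
    rw [List.foldr_const]
    simp
  simp only [this]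
  fun_prop

@[fun_prop]
theorem decide_eq_nil {F : X → List Y} (hF : Tracked c F) :
    Tracked c fun x => decide (F x = []) := by
  simp only [← List.length_eq_zero_iff]
  fun_prop

@[fun_prop]
theorem decide_not {p : X → Prop} [DecidablePred p] (hp : Tracked c fun x => decide (p x)) :
    Tracked c fun x => decide (¬ p x) := by
  have (x : X) : decide (¬ p x) = if p x then false else true := by by_cases h : p x <;> simp [h]
  simp only [this]
  fun_prop

@[fun_prop]
theorem decide_forall_mem {l : X → List Y} {p : X → Y → Prop} [∀ x y, Decidable (p x y)]
    (hl : Tracked c l) (hp : Tracked c fun q : X × Y => decide (p q.1 q.2)) :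
    Tracked c fun x => decide (∀ y ∈ l x, p x y) := by
  have (x : X) : decide (∀ y ∈ l x, p x y) = decide ((l x).filter (fun y => ¬ p x y) = []) := by
    simp [List.filter_eq_nil_iff]
  simp only [this]
  fun_prop

@[fun_prop]
theorem decide_mem {l : X → List ℕ} {F : X → ℕ} (hl : Tracked c l) (hF : Tracked c F) :
    Tracked c fun x => decide (F x ∈ l x) := by
  have (x : X) : decide (F x ∈ l x) = decide (¬ ∀ y ∈ l x, ¬ F x = y) := by simp
  simp only [this]
  fun_prop

theorem of_nat_list {g : ℕ → List ℕ} (hg : Primrec g) {F : X → ℕ} (hF : Tracked c F) :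
    Tracked c fun x => g (F x) := by
  obtain ⟨f, hf, hf'⟩ := hF
  exact ⟨_, Primrec.encode.comp (hg.comp hf), fun x => by simp [hf', rep]⟩

@[fun_prop]
theorem range {F : X → ℕ} (hF : Tracked c F) : Tracked c fun x => List.range (F x) :=
  of_nat_list Primrec.list_range hF

@[fun_prop]
theorem range' {F G : X → ℕ} (hF : Tracked c F) (hG : Tracked c G) :
    Tracked c fun x => List.range' (F x) (G x) := by
  simp only [List.range'_eq_map_range]
  fun_prop

@[fun_prop]
theorem listBound {F : X → List ℕ} (hF : Tracked c F) : Tracked c fun x => listBound (F x) := by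
  unfold _root_.listBound
  fun_prop

theorem map_const {ι : Type*} (L : List ι) {h : ι → X → Y} (hh : ∀ i, Tracked c (h i)) :
    Tracked c fun x => L.map fun i => h i x := by
  induction L with
  | nil => exact const []
  | cons i L ih => exact (hh i).cons ih

theorem of_rep {F : X → Y} (f : ℕ → Z) (hf : Tracked c f)
    (h : ∀ x, rep c (f (rep c x)) = rep c (F x)) : Tracked c F := by
  obtain ⟨g, hg, hg'⟩ := hf
  exact ⟨g, hg, fun x => (hg' (rep c x)).trans (h x)⟩

@[fun_prop]
theorem rep_comp {F : X → Y} (hF : Tracked c F) : Tracked c fun x => rep c (F x) := hF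

@[fun_prop]
theorem unpair_fst {F : X → ℕ} (hF : Tracked c F) : Tracked c fun x => (F x).unpair.1 :=
  Tracked.comp (F := fun n : ℕ => n.unpair.1)
    ⟨_, Primrec.fst.comp Primrec.unpair, fun _ => rfl⟩ hF

@[fun_prop]
theorem unpair_snd {F : X → ℕ} (hF : Tracked c F) : Tracked c fun x => (F x).unpair.2 :=
  Tracked.comp (F := fun n : ℕ => n.unpair.2)
    ⟨_, Primrec.snd.comp Primrec.unpair, fun _ => rfl⟩ hF

@[fun_prop]
theorem natPair {F G : X → ℕ} (hF : Tracked c F) (hG : Tracked c G) :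
    Tracked c fun x => Nat.pair (F x) (G x) := nat₂ Primrec₂.natPair hF hG

@[fun_prop]
theorem ofNat_list {F : X → ℕ} (hF : Tracked c F) :
    Tracked c fun x => Denumerable.ofNat (List ℕ) (F x) :=
  of_nat_list (Primrec.ofNat _) hF

theorem getD (l : List ℕ) {F : X → ℕ} (hF : Tracked c F) : Tracked c fun x => l.getD (F x) 0 :=
  Tracked.comp (F := fun n : ℕ => l.getD n 0)
    ⟨_, (Primrec.list_getD 0).comp (Primrec.const l) Primrec.id, fun _ => rfl⟩ hF

/-- The second component of an argument holds parameters, which may change in a recursive call. -/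
theorem recursion {F : X × P → Y} (calls : X × P → List (X × P)) (G : (X × P) × List Y → Y)
    (hcalls : Tracked c calls) (hG : Tracked c G)
    (hlt : ∀ q, ∀ q' ∈ calls q, rep c q'.1 < rep c q.1)
    (hF : ∀ q, F q = G (q, (calls q).map F)) : Tracked c F := by
  obtain ⟨l, hl, hl'⟩ := hcalls
  obtain ⟨g, hg, hg'⟩ := hG
  have hdecode (q : X × P) :
      Denumerable.ofNat (List ℕ) (l (rep c q)) = (calls q).map (rep c) := by
    rw [hl']
    exact Denumerable.ofNat_encode _
  have hkeep (q : X × P) : ((calls q).map (rep c)).filter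
      (fun m => m.unpair.1 < (rep c q).unpair.1) = (calls q).map (rep c) := by
    refine List.filter_eq_self.2 (List.forall_mem_map.2 fun q' hq' => ?_)
    simpa [rep] using hlt q q' hq'
  refine ⟨codeRec (fun n => Denumerable.ofNat (List ℕ) (l n)) g,
    primrec_codeRec ((Primrec.ofNat _).comp hl) hg, fun q => ?_⟩
  induction hn : rep c q.1 using Nat.strong_induction_on generalizing q with
  | _ n ih =>
    subst hn
    have hcode : rep c (q, (calls q).map F) = Nat.pair (rep c q)
        (Encodable.encode ((calls q).map fun q' => rep c (F q'))) := by
      rw [← Function.comp_def, ← List.map_map]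
      rfl
    rw [codeRec_eq, hdecode, hkeep, List.map_map, hF q, ← hg', hcode]
    congr 3
    exact List.map_congr_left fun q' hq' => ih _ (hlt q q' hq') q' rfl

end Tracked

/-! ### Access to the syntax tree -/

theorem lt_natPair {a : ℕ} (b : ℕ) (ha : 0 < a) : b < Nat.pair a b := by
  unfold Nat.pair
  split_ifs <;> nlinarith

namespace WFormula

variable {V : Vocabulary.{u, v, w}} {c : SymbolCoding V}

/-- The outermost constructor. -/
def tag : WFormula V → ℕ
  | eq _ _ => 0
  | rel _ _ => 1
  | wtEq _ _ _ => 2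
  | not _ => 3
  | or _ _ => 4
  | ex _ _ => 5
  | sumEq _ _ _ _ _ => 6
  | pred _ _ _ => 7

/-- The immediate subformulas. -/
def children : WFormula V → List (WFormula V)
  | not φ => [φ]
  | or φ ψ => [φ, ψ]
  | ex _ φ => [φ]
  | sumEq _ _ _ _ φ => [φ]
  | _ => []

/-- The variables bound by the outermost constructor. -/
def boundVars : WFormula V → List ℕ
  | ex y _ => [y]
  | sumEq _ _ _ ys _ => List.ofFn ys
  | _ => []

/-- The variables of an atomic formula that is not of the form `P(…)`. -/
def plainVars : WFormula V → List ℕ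
  | eq x y => [x, y]
  | rel _ xs => List.ofFn xs
  | wtEq _ _ xs => List.ofFn xs
  | _ => []

/-- The terms of an atomic formula `P(…)`. -/
def predArgs : WFormula V → List (Σ i, WTerm V i)
  | pred _ ts _ => List.ofFn fun j => ⟨_, ts j⟩
  | _ => []

theorem leafVars_eq (φ : WFormula V) :
    φ.leafVars = φ.plainVars ++ φ.predArgs.flatMap fun t => t.2.vars := by
  cases φ <;> simp [leafVars, plainVars, predArgs, Function.comp_def, List.flatMap]

theorem code_lt_of_mem_children {φ ψ : WFormula V} (h : ψ ∈ φ.children) :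
    c.code ψ < c.code φ := by
  cases φ with
  | not φ =>
    obtain rfl := List.mem_singleton.1 h
    exact lt_natPair _ three_pos
  | or φ χ =>
    refine lt_of_le_of_lt ?_ (lt_natPair _ four_pos)
    obtain rfl | h := List.mem_cons.1 h
    · exact Nat.left_le_pair _ _
    · obtain rfl := List.mem_singleton.1 h
      exact Nat.right_le_pair _ _
  | ex y φ =>
    obtain rfl := List.mem_singleton.1 h
    exact (Nat.right_le_pair _ _).trans_lt (lt_natPair _ (by norm_num))
  | sumEq a hfin s ys φ =>
    obtain rfl := List.mem_singleton.1 h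
    exact ((Nat.right_le_pair _ _).trans ((Nat.right_le_pair _ _).trans
      (Nat.right_le_pair _ _))).trans_lt (lt_natPair _ (by norm_num))
  | _ => simp [children] at h

theorem conj_eq_foldr (l : List (WFormula V)) :
    conj l = (l.foldr (fun φ (s : Bool × WFormula V) =>
      (false, if s.1 = true then φ else φ.and s.2)) (true, tt)).2 := by
  induction l with
  | nil => rfl
  | cons φ l ih =>
    cases l with
    | nil => rfl
    | cons ψ l => rw [conj, ih]; rfl

theorem farApart_eq_foldr (δ : ℕ → ℕ → WFormula V) (l : List ℕ) :
    (l, farApart δ l) = l.foldr (fun y (s : List ℕ × List (WFormula V)) =>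
      (y :: s.1, s.1.map (fun z => (δ y z).not) ++ s.2)) ([], []) := by
  induction l with
  | nil => rfl
  | cons y l ih => rw [List.foldr_cons, ← ih]; rfl

end WFormula

namespace WTerm

variable {V : Vocabulary.{u, v, w}} {c : SymbolCoding V}

/-- The outermost constructor. -/
def tag : (Σ i, WTerm V i) → ℕ
  | ⟨_, const _⟩ => 0
  | ⟨_, wt _ _⟩ => 1
  | ⟨_, add _ _⟩ => 2
  | ⟨_, sub _ _⟩ => 3
  | ⟨_, mul _ _ _⟩ => 4

/-- The immediate subterms. -/
def children : (Σ i, WTerm V i) → List (Σ i, WTerm V i)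
  | ⟨_, const _⟩ => []
  | ⟨_, wt _ _⟩ => []
  | ⟨_, add t₁ t₂⟩ => [⟨_, t₁⟩, ⟨_, t₂⟩]
  | ⟨_, sub t₁ t₂⟩ => [⟨_, t₁⟩, ⟨_, t₂⟩]
  | ⟨_, mul _ t₁ t₂⟩ => [⟨_, t₁⟩, ⟨_, t₂⟩]

/-- The variables of a term `w(x)`. -/
def wtVars : (Σ i, WTerm V i) → List ℕ
  | ⟨_, wt _ xs⟩ => List.ofFn xs
  | _ => []

theorem termCode_lt_of_mem_children {t t' : Σ i, WTerm V i} (h : t' ∈ children t) :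
    c.termCode t'.2 < c.termCode t.2 := by
  have hpair {i : V.Ix} {k : ℕ} (t₁ t₂ : WTerm V i) (hk : 0 < k)
      (h : t' ∈ ([⟨_, t₁⟩, ⟨_, t₂⟩] : List (Σ i, WTerm V i))) :
      c.termCode t'.2 < Nat.pair k (Nat.pair (c.termCode t₁) (c.termCode t₂)) := by
    refine lt_of_le_of_lt ?_ (lt_natPair _ hk)
    obtain rfl | h := List.mem_cons.1 h
    · exact Nat.left_le_pair _ _
    · obtain rfl := List.mem_singleton.1 h
      exact Nat.right_le_pair _ _
  obtain ⟨i, t⟩ := t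
  cases t with
  | add t₁ t₂ => exact hpair t₁ t₂ two_pos h
  | sub t₁ t₂ => exact hpair t₁ t₂ three_pos h
  | mul _ t₁ t₂ => exact hpair t₁ t₂ four_pos h
  | _ => simp [children] at h

end WTerm

namespace Tracked

variable {V : Vocabulary.{u, v, w}} {c : SymbolCoding V} {X Y P : Type*} [Coded V X] [Coded V Y]
  [Coded V P] {F G : X → WFormula V} {t : X → Σ i, WTerm V i}

@[fun_prop]
theorem tag (hF : Tracked c F) : Tracked c fun x => (F x).tag := by
  refine Tracked.comp (of_rep (fun n => n.unpair.1) (by fun_prop) fun φ => ?_) hF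
  cases φ <;> simp [rep, SymbolCoding.code, WFormula.tag]

@[fun_prop]
theorem children (hF : Tracked c F) : Tracked c fun x => (F x).children := by
  refine Tracked.comp (of_rep (fun n => if n.unpair.1 = 3 then [n.unpair.2] else
    if n.unpair.1 = 4 then [n.unpair.2.unpair.1, n.unpair.2.unpair.2] else
    if n.unpair.1 = 5 then [n.unpair.2.unpair.2] else
    if n.unpair.1 = 6 then [n.unpair.2.unpair.2.unpair.2.unpair.2] else [])
    (by fun_prop) fun φ => ?_) hF
  cases φ <;> simp [rep, SymbolCoding.code, WFormula.children]

@[fun_prop]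
theorem boundVars (hF : Tracked c F) : Tracked c fun x => (F x).boundVars := by
  refine Tracked.comp (of_rep (fun n => if n.unpair.1 = 5 then [n.unpair.2.unpair.1] else
    if n.unpair.1 = 6 then
      Denumerable.ofNat (List ℕ) n.unpair.2.unpair.2.unpair.2.unpair.1 else [])
    (by fun_prop) fun φ => ?_) hF
  cases φ <;> simp [rep, SymbolCoding.code, WFormula.boundVars]

@[fun_prop]
theorem plainVars (hF : Tracked c F) : Tracked c fun x => (F x).plainVars := by
  refine Tracked.comp (of_rep (fun n =>
    if n.unpair.1 = 0 then [n.unpair.2.unpair.1, n.unpair.2.unpair.2] else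
    if n.unpair.1 = 1 then Denumerable.ofNat (List ℕ) n.unpair.2.unpair.2 else
    if n.unpair.1 = 2 then Denumerable.ofNat (List ℕ) n.unpair.2.unpair.2.unpair.2 else [])
    (by fun_prop) fun φ => ?_) hF
  cases φ <;> simp [rep, SymbolCoding.code, WFormula.plainVars]

@[fun_prop]
theorem predArgs (hF : Tracked c F) : Tracked c fun x => (F x).predArgs := by
  refine Tracked.comp (of_rep (fun n =>
    if n.unpair.1 = 7 then Denumerable.ofNat (List ℕ) n.unpair.2.unpair.2 else [])
    (by fun_prop) fun φ => ?_) hF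
  cases φ <;> simp [rep, SymbolCoding.code, WFormula.predArgs, Function.comp_def]

@[fun_prop]
theorem setBody (hF : Tracked c F) (hG : Tracked c G) :
    Tracked c fun x => (F x).setBody (G x) := by
  refine Tracked.comp (F := fun p : WFormula V × WFormula V => p.1.setBody p.2)
    (of_rep (fun n =>
      if n.unpair.1.unpair.1 = 3 then Nat.pair 3 n.unpair.2 else
      if n.unpair.1.unpair.1 = 5 then
        Nat.pair 5 (Nat.pair n.unpair.1.unpair.2.unpair.1 n.unpair.2) else
      if n.unpair.1.unpair.1 = 6 then
        Nat.pair 6 (Nat.pair n.unpair.1.unpair.2.unpair.1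
          (Nat.pair n.unpair.1.unpair.2.unpair.2.unpair.1
            (Nat.pair n.unpair.1.unpair.2.unpair.2.unpair.2.unpair.1 n.unpair.2))) else
      n.unpair.1)
    (by fun_prop) fun p => ?_) (hF.prodMk hG)
  obtain ⟨φ, ψ⟩ := p
  cases φ <;> simp [rep, SymbolCoding.code, WFormula.setBody]

theorem of_code {F : X → WFormula V} (h : Tracked c fun x => c.code (F x)) : Tracked c F := h

@[fun_prop]
theorem eq {F G : X → ℕ} (hF : Tracked c F) (hG : Tracked c G) :
    Tracked c fun x => (WFormula.eq (F x) (G x) : WFormula V) :=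
  of_code (by simp only [SymbolCoding.code]; fun_prop)

/-! ### Building formulas -/

@[fun_prop]
theorem not (hF : Tracked c F) : Tracked c fun x => (F x).not :=
  of_code (by simp only [SymbolCoding.code]; exact natPair (const 3) hF)

@[fun_prop]
theorem or (hF : Tracked c F) (hG : Tracked c G) : Tracked c fun x => (F x).or (G x) :=
  of_code (by simp only [SymbolCoding.code]; exact natPair (const 4) (natPair hF hG))

@[fun_prop]
theorem and (hF : Tracked c F) (hG : Tracked c G) : Tracked c fun x => (F x).and (G x) := by
  unfold WFormula.and
  fun_prop

@[fun_prop]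
theorem ex {y : X → ℕ} (hy : Tracked c y) (hF : Tracked c F) :
    Tracked c fun x => WFormula.ex (y x) (F x) :=
  of_code (by simp only [SymbolCoding.code]; exact natPair (const 5) (natPair hy hF))

@[fun_prop]
theorem exs {l : X → List ℕ} (hl : Tracked c l) (hF : Tracked c F) :
    Tracked c fun x => WFormula.exs (l x) (F x) := by
  unfold WFormula.exs
  exact foldr (h := fun _ => WFormula.ex) hl (by fun_prop) hF

@[fun_prop]
theorem disj {l : X → List (WFormula V)} (hl : Tracked c l) :
    Tracked c fun x => WFormula.disj (l x) := by
  unfold WFormula.disj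
  exact foldr (h := fun _ => WFormula.or) hl (by fun_prop) (const _)

@[fun_prop]
theorem conj {l : X → List (WFormula V)} (hl : Tracked c l) :
    Tracked c fun x => WFormula.conj (l x) := by
  simp only [WFormula.conj_eq_foldr]
  fun_prop

theorem farApart {δ : X → ℕ → ℕ → WFormula V} {l : X → List ℕ}
    (hδ : Tracked c fun p : X × ℕ × ℕ => δ p.1 p.2.1 p.2.2) (hl : Tracked c l) :
    Tracked c fun x => WFormula.farApart (δ x) (l x) := by
  have h : ∀ x, WFormula.farApart (δ x) (l x) =
      ((l x).foldr (fun y (s : List ℕ × List (WFormula V)) =>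
        (y :: s.1, s.1.map (fun z => (δ x y z).not) ++ s.2)) ([], [])).2 := fun x => by
    rw [← WFormula.farApart_eq_foldr]
  simp only [h]
  have := hδ.comp (G := fun p : (X × ℕ × List ℕ × List (WFormula V)) × ℕ => (p.1.1, p.1.2.1, p.2))
    (by fun_prop)
  fun_prop

@[fun_prop]
theorem encode_list {l : X → List ℕ} (hl : Tracked c l) :
    Tracked c fun x => Encodable.encode (l x) := by
  obtain ⟨f, hf, hf'⟩ := hl
  exact ⟨f, hf, fun x => (hf' x).trans (by simp [rep])⟩

theorem rel_add (R : Fin V.numRel) {F : X → ℕ} (hF : Tracked c F) :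
    Tracked c fun x => (WFormula.rel R fun l => F x + l : WFormula V) := by
  have : ∀ x, (List.ofFn fun l : Fin (V.relArity R) => F x + l) =
      (List.range (V.relArity R)).map fun l => F x + l := fun x => by
    rw [← List.map_coe_finRange_eq_range, List.map_map, List.ofFn_eq_map]; rfl
  refine of_code ?_
  simp only [SymbolCoding.code, this]
  fun_prop

theorem link (R : Fin V.numRel) {F G : X → ℕ} (hF : Tracked c F) (hG : Tracked c G) :
    Tracked c fun x => (WFormula.link R (F x) (G x) : WFormula V) := by
  unfold WFormula.link
  have := rel_add (V := V) (c := c) R (F := fun x => F x + G x + 1) (by fun_prop)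
  fun_prop

@[fun_prop]
theorem distLEOne {F G : X → ℕ} (hF : Tracked c F) (hG : Tracked c G) :
    Tracked c fun x => (WFormula.distLEOne (F x) (G x) : WFormula V) := by
  unfold WFormula.distLEOne
  have := map_const (c := c) (List.finRange V.numRel) (h := fun R x => WFormula.link R (F x) (G x))
    fun R => link R hF hG
  fun_prop

@[fun_prop]
theorem distLE {r F G : X → ℕ} (hr : Tracked c r) (hF : Tracked c F) (hG : Tracked c G) :
    Tracked c fun x => (WFormula.distLE (r x) (F x) (G x) : WFormula V) := by
  refine Tracked.comp (F := fun q : ℕ × ℕ × ℕ => (WFormula.distLE q.1 q.2.1 q.2.2 : WFormula V))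
    (recursion (fun q => if q.1 = 0 then [] else [(q.1 - 1, q.2.1, q.2.1 + q.2.2 + 1)])
      (fun q => if q.1.1 = 0 then WFormula.eq q.1.2.1 q.1.2.2 else
        WFormula.ex (q.1.2.1 + q.1.2.2 + 1) ((q.2.foldr (fun ψ _ => ψ) WFormula.ff).and
          (WFormula.distLEOne (q.1.2.1 + q.1.2.2 + 1) q.1.2.2)))
      (by fun_prop) (by fun_prop) ?_ ?_) (hr.prodMk (hF.prodMk hG))
  · rintro ⟨_ | r, x, y⟩ q' hq'
    · simp at hq'
    · simp only [Nat.add_one_ne_zero, if_false, List.mem_singleton] at hq'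
      subst hq'
      simp [rep]
  · rintro ⟨_ | r, x, y⟩
    · rfl
    · rfl

@[fun_prop]
theorem near {r F : X → ℕ} {l : X → List ℕ} (hr : Tracked c r) (hl : Tracked c l)
    (hF : Tracked c F) : Tracked c fun x => (WFormula.near (r x) (l x) (F x) : WFormula V) := by
  unfold WFormula.near
  fun_prop

@[fun_prop]
theorem allNear {r : X → ℕ} {S T : X → List ℕ} (hr : Tracked c r) (hS : Tracked c S)
    (hT : Tracked c T) :
    Tracked c fun x => (WFormula.allNear (r x) (S x) (T x) : WFormula V) := by
  unfold WFormula.allNear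
  fun_prop

/-! ### Recursion on formulas and terms -/

/-- The first two entries of a list, with a default value. -/
def firstTwo (y : Y) (l : List Y) : Y × Y := l.foldr (fun z s => (z, s.1)) (y, y)

@[fun_prop]
theorem apply_firstTwo {y : X → Y} {l : X → List Y} (hy : Tracked c y) (hl : Tracked c l) :
    Tracked c fun x => firstTwo (y x) (l x) := by
  unfold firstTwo
  fun_prop

/-- Recursion on formulas. Quantifiers and aggregation change the parameters in two ways, and
`binder` combines both results. -/
theorem formulaRec {F : WFormula V × P → Y} (leaf : WFormula V × P → Y)
    (neg : (WFormula V × P) × Y → Y) (disj : (WFormula V × P) × Y × Y → Y)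
    (binder : (WFormula V × P) × Y × Y → Y) (p₁ p₂ : WFormula V × P → P)
    (hleaf : Tracked c leaf) (hneg : Tracked c neg) (hdisj : Tracked c disj)
    (hbinder : Tracked c binder) (hp₁ : Tracked c p₁) (hp₂ : Tracked c p₂)
    (hF : ∀ φ p, F (φ, p) = match φ with
      | .not ψ => neg ((φ, p), F (ψ, p))
      | .or ψ χ => disj ((φ, p), F (ψ, p), F (χ, p))
      | .ex _ ψ => binder ((φ, p), F (ψ, p₁ (φ, p)), F (ψ, p₂ (φ, p)))
      | .sumEq _ _ _ _ ψ => binder ((φ, p), F (ψ, p₁ (φ, p)), F (ψ, p₂ (φ, p)))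
      | _ => leaf (φ, p)) : Tracked c F := by
  refine recursion (fun q =>
      if q.1.tag = 5 then q.1.children.flatMap fun ψ => [(ψ, p₁ q), (ψ, p₂ q)] else
      if q.1.tag = 6 then q.1.children.flatMap fun ψ => [(ψ, p₁ q), (ψ, p₂ q)] else
      q.1.children.map fun ψ => (ψ, q.2))
    (fun z => if z.1.1.tag = 3 then neg (z.1, (firstTwo (leaf z.1) z.2).1) else
      if z.1.1.tag = 4 then disj (z.1, firstTwo (leaf z.1) z.2) else
      if z.1.1.tag = 5 then binder (z.1, firstTwo (leaf z.1) z.2) else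
      if z.1.1.tag = 6 then binder (z.1, firstTwo (leaf z.1) z.2) else leaf z.1)
    (by fun_prop) (by fun_prop) (fun q q' hq' => ?_) (fun q => ?_)
  · suffices q'.1 ∈ q.1.children from WFormula.code_lt_of_mem_children this
    grind
  · obtain ⟨φ, p⟩ := q
    rw [hF]
    cases φ <;> rfl

@[fun_prop]
theorem termTag (ht : Tracked c t) : Tracked c fun x => WTerm.tag (t x) := by
  refine Tracked.comp (of_rep (fun n => n.unpair.1) (by fun_prop) fun t => ?_) ht
  obtain ⟨i, t⟩ := t
  cases t <;> simp [rep, SymbolCoding.termCode, WTerm.tag]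

@[fun_prop]
theorem termChildren (ht : Tracked c t) : Tracked c fun x => WTerm.children (t x) := by
  refine Tracked.comp (of_rep (fun n => if n.unpair.1 = 0 then [] else
    if n.unpair.1 = 1 then [] else [n.unpair.2.unpair.1, n.unpair.2.unpair.2])
    (by fun_prop) fun t => ?_) ht
  obtain ⟨i, t⟩ := t
  cases t <;> simp [rep, SymbolCoding.termCode, WTerm.children]

@[fun_prop]
theorem wtVars (ht : Tracked c t) : Tracked c fun x => WTerm.wtVars (t x) := by
  refine Tracked.comp (of_rep (fun n => if n.unpair.1 = 1 then
    Denumerable.ofNat (List ℕ) n.unpair.2.unpair.2 else [])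
    (by fun_prop) fun t => ?_) ht
  obtain ⟨i, t⟩ := t
  cases t <;> simp [rep, SymbolCoding.termCode, WTerm.wtVars]

theorem termRec {F : (Σ i, WTerm V i) × P → Y} (G : ((Σ i, WTerm V i) × P) × List Y → Y)
    (hG : Tracked c G)
    (hF : ∀ t p, F (t, p) = G ((t, p), (WTerm.children t).map fun t' => F (t', p))) :
    Tracked c F := by
  refine recursion (fun q => (WTerm.children q.1).map fun t' => (t', q.2)) G (by fun_prop) hG
    (fun q q' hq' => ?_) (fun q => ?_)
  · obtain ⟨t', ht', rfl⟩ := List.mem_map.1 hq'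
    exact WTerm.termCode_lt_of_mem_children ht'
  · rw [hF, List.map_map]
    rfl

@[fun_prop]
theorem swap_apply {x y v : X → ℕ} (hx : Tracked c x) (hy : Tracked c y) (hv : Tracked c v) :
    Tracked c fun z => Equiv.swap (x z) (y z) (v z) := by
  simp only [Equiv.swap_apply_def]
  fun_prop

@[fun_prop]
theorem vars (ht : Tracked c t) : Tracked c fun x => (t x).2.vars := by
  refine Tracked.comp (F := fun q : (Σ i, WTerm V i) × ℕ => q.1.2.vars)
    (termRec (fun z => WTerm.wtVars z.1.1 ++ z.2.flatten) (by fun_prop) ?_) (ht.prodMk (const 0))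
  rintro ⟨i, t⟩ p
  cases t <;> simp [WTerm.vars, WTerm.wtVars, WTerm.children]

theorem termRename {x y : X → ℕ} (ht : Tracked c t) (hx : Tracked c x) (hy : Tracked c y) :
    Tracked c fun z => c.termCode ((t z).2.rename (Equiv.swap (x z) (y z))) := by
  refine Tracked.comp (F := fun q : (Σ i, WTerm V i) × ℕ × ℕ =>
      c.termCode (q.1.2.rename (Equiv.swap q.2.1 q.2.2)))
    (termRec (fun z => if WTerm.tag z.1.1 = 0 then rep c z.1.1 else
      if WTerm.tag z.1.1 = 1 then Nat.pair 1 (Nat.pair (rep c z.1.1).unpair.2.unpair.1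
        (Encodable.encode ((WTerm.wtVars z.1.1).map (Equiv.swap z.1.2.1 z.1.2.2)))) else
      Nat.pair (WTerm.tag z.1.1) (Nat.pair (firstTwo 0 z.2).1 (firstTwo 0 z.2).2))
      (by fun_prop) ?_) (ht.prodMk (hx.prodMk hy))
  rintro ⟨i, t⟩ p
  cases t with
  | const s => rfl
  | wt a xs =>
    simp [WTerm.rename, WTerm.tag, WTerm.wtVars, rep, SymbolCoding.termCode, Function.comp_def]
  | add t₁ t₂ => rfl
  | sub t₁ t₂ => rfl
  | mul h t₁ t₂ => rfl

@[fun_prop]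
theorem leafVars (hF : Tracked c F) : Tracked c fun x => (F x).leafVars := by
  simp only [WFormula.leafVars_eq]
  fun_prop

@[fun_prop]
theorem freeList (hF : Tracked c F) : Tracked c fun x => (F x).freeList := by
  refine Tracked.comp (F := fun q : WFormula V × ℕ => q.1.freeList)
    (formulaRec (fun q => q.1.leafVars) (fun z => z.2) (fun z => z.2.1 ++ z.2.2)
      (fun z => z.2.1.filter fun x => decide (x ∉ z.1.1.boundVars)) (fun q => q.2) (fun q => q.2)
      (by fun_prop) (by fun_prop) (by fun_prop) (by fun_prop) (by fun_prop) (by fun_prop)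
      fun φ _ => by cases φ <;> rfl) (hF.prodMk (const 0))

@[fun_prop]
theorem bound (hF : Tracked c F) : Tracked c fun x => (F x).bound := by
  refine Tracked.comp (F := fun q : WFormula V × ℕ => q.1.bound)
    (formulaRec (fun q => _root_.listBound q.1.leafVars) (fun z => z.2)
      (fun z => Max.max z.2.1 z.2.2)
      (fun z => Max.max (_root_.listBound z.1.1.boundVars) z.2.1) (fun q => q.2) (fun q => q.2)
      (by fun_prop) (by fun_prop) (by fun_prop) (by fun_prop) (by fun_prop) (by fun_prop)
      fun φ _ => by cases φ <;> rfl) (hF.prodMk (const 0))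

@[fun_prop]
theorem relat {l : X → List ℕ} {r : X → ℕ} (hl : Tracked c l) (hr : Tracked c r)
    (hF : Tracked c F) : Tracked c fun x => (F x).relat (l x) (r x) := by
  refine Tracked.comp (F := fun q : WFormula V × List ℕ × ℕ => q.1.relat q.2.1 q.2.2)
    (formulaRec (fun q => q.1) (fun z => z.2.not) (fun z => z.2.1.or z.2.2)
      (fun z => z.1.1.setBody
        ((WFormula.allNear z.1.2.2 z.1.2.1 z.1.1.boundVars).and z.2.1))
      (fun q => q.2) (fun q => q.2)
      (by fun_prop) (by fun_prop) (by fun_prop) (by fun_prop) (by fun_prop) (by fun_prop)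
      fun φ _ => by cases φ <;> rfl) (hF.prodMk (hl.prodMk hr))

end Tracked

/-! ### Computability of the normal form -/

theorem SymbolCoding.exists_list_getD_const_eq {V : Vocabulary.{u, v, w}} (c : SymbolCoding V)
    (g : ∀ a, Finite (V.Elem (V.wtType a)) → V.Elem (V.wtType a) → ℕ) : ∃ l : List ℕ,
      ∀ a hfin (s : V.Elem (V.wtType a)), l.getD (Nat.pair a (c.const _ s)) 0 = g a hfin s := by
  have _ (a : {a // Finite (V.Elem (V.wtType a))}) : Finite (V.Elem (V.wtType a)) := a.2
  obtain ⟨l, hl⟩ := exists_list_getD_eq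
    (fun k : Σ a : {a // Finite (V.Elem (V.wtType a))}, V.Elem (V.wtType a) =>
      Nat.pair k.1.1 (c.const _ k.2)) (fun k => g k.1.1 k.1.2 k.2) (by
    rintro ⟨⟨a, ha⟩, s⟩ ⟨⟨b, hb⟩, t⟩ h
    obtain ⟨hab, hst⟩ := Nat.pair_eq_pair.1 h
    obtain rfl : a = b := Fin.ext hab
    obtain rfl : s = t := c.const_injective _ ha hst
    rfl)
  exact ⟨l, fun a hfin s => hl ⟨⟨a, hfin⟩, s⟩⟩

/-- Replaces the value `s` in the code of a formula `s = ∑ w(y). φ` by the one with code `k`. -/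
def setValueCode (n k : ℕ) : ℕ :=
  Nat.pair 6 (Nat.pair n.unpair.2.unpair.1 (Nat.pair k n.unpair.2.unpair.2.unpair.2))

namespace Tracked

variable {V : Vocabulary.{u, v, w}} {c : SymbolCoding V} {X : Type*} [Coded V X]
  {F G : X → WFormula V} {r : X → ℕ} {S T : X → List ℕ}

@[fun_prop]
theorem rename {x y : X → ℕ} (hF : Tracked c F) (hx : Tracked c x) (hy : Tracked c y) :
    Tracked c fun z => (F z).rename (Equiv.swap (x z) (y z)) := by
  have hrename := termRename (c := c) (V := V) (X := (WFormula V × ℕ × ℕ) × Σ i, WTerm V i)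
    (t := fun z => z.2) (x := fun z => z.1.2.1) (y := fun z => z.1.2.2)
    (by fun_prop) (by fun_prop) (by fun_prop)
  refine of_code (Tracked.comp
    (F := fun q : WFormula V × ℕ × ℕ => c.code (q.1.rename (Equiv.swap q.2.1 q.2.2)))
    (formulaRec
      (fun q =>
        if q.1.tag = 0 then Nat.pair 0 (Nat.pair
          (Equiv.swap q.2.1 q.2.2 (rep c q.1).unpair.2.unpair.1)
          (Equiv.swap q.2.1 q.2.2 (rep c q.1).unpair.2.unpair.2)) else
        if q.1.tag = 1 then Nat.pair 1 (Nat.pair (rep c q.1).unpair.2.unpair.1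
          (Encodable.encode (q.1.plainVars.map (Equiv.swap q.2.1 q.2.2)))) else
        if q.1.tag = 2 then Nat.pair 2 (Nat.pair (rep c q.1).unpair.2.unpair.1
          (Nat.pair (rep c q.1).unpair.2.unpair.2.unpair.1
            (Encodable.encode (q.1.plainVars.map (Equiv.swap q.2.1 q.2.2))))) else
        Nat.pair 7 (Nat.pair (rep c q.1).unpair.2.unpair.1
          (Encodable.encode (q.1.predArgs.map fun t =>
            c.termCode (t.2.rename (Equiv.swap q.2.1 q.2.2))))))
      (fun z => Nat.pair 3 z.2) (fun z => Nat.pair 4 (Nat.pair z.2.1 z.2.2))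
      (fun z =>
        if z.1.1.tag = 5 then Nat.pair 5 (Nat.pair
          (Equiv.swap z.1.2.1 z.1.2.2 (rep c z.1.1).unpair.2.unpair.1) z.2.1) else
        Nat.pair 6 (Nat.pair (rep c z.1.1).unpair.2.unpair.1
          (Nat.pair (rep c z.1.1).unpair.2.unpair.2.unpair.1 (Nat.pair
            (Encodable.encode (z.1.1.boundVars.map (Equiv.swap z.1.2.1 z.1.2.2))) z.2.1))))
      (fun q => q.2) (fun q => q.2)
      (by fun_prop) (by fun_prop) (by fun_prop) (by fun_prop) (by fun_prop) (by fun_prop)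
      fun φ _ => ?_) (hF.prodMk (hx.prodMk hy)))
  cases φ <;> simp [WFormula.rename, WFormula.tag, WFormula.plainVars, WFormula.boundVars,
    WFormula.predArgs, rep, SymbolCoding.code, Function.comp_def]

@[fun_prop]
theorem withCopies {N : X → ℕ} (hS : Tracked c S) (hN : Tracked c N) (hF : Tracked c F) :
    Tracked c fun x => (F x).withCopies (S x) (N x) := by
  unfold WFormula.withCopies
  fun_prop

@[fun_prop]
theorem inBall (hr : Tracked c r) (hS : Tracked c S) (hF : Tracked c F) :
    Tracked c fun x => (F x).inBall (r x) (S x) := by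
  unfold WFormula.inBall
  fun_prop

section Cases

open WFormula (Cases)

variable {l m : X → Cases V}

@[fun_prop]
theorem expand (hF : Tracked c F) (hl : Tracked c l) :
    Tracked c fun x => (l x).expand (F x) := by
  unfold WFormula.Cases.expand
  fun_prop

@[fun_prop]
theorem swap (hl : Tracked c l) : Tracked c fun x => (l x).swap := by
  unfold WFormula.Cases.swap
  fun_prop

@[fun_prop]
theorem neg (hl : Tracked c l) : Tracked c fun x => (l x).neg := by
  unfold WFormula.Cases.neg
  fun_prop

@[fun_prop]
theorem combine {op : WFormula V → WFormula V → WFormula V}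
    (hop : Tracked c fun p : WFormula V × WFormula V => op p.1 p.2) (hl : Tracked c l)
    (hm : Tracked c m) : Tracked c fun x => Cases.combine op (l x) (m x) := by
  unfold WFormula.Cases.combine
  have := hop.comp (G := fun p : (X × WFormula V × WFormula V) × WFormula V × WFormula V =>
    (p.1.2.2, p.2.2)) (by fun_prop)
  fun_prop

@[fun_prop]
theorem both (hl : Tracked c l) (hm : Tracked c m) : Tracked c fun x => (l x).both (m x) := by
  unfold WFormula.Cases.both
  fun_prop

@[fun_prop]
theorem either (hl : Tracked c l) (hm : Tracked c m) : Tracked c fun x => (l x).either (m x) := by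
  unfold WFormula.Cases.either
  fun_prop

@[fun_prop]
theorem any {ls : X → List (Cases V)} (hl : Tracked c ls) :
    Tracked c fun x => WFormula.Cases.any (ls x) := by
  unfold WFormula.Cases.any
  exact foldr (h := fun _ => WFormula.Cases.either) hl (by fun_prop) (const _)

@[fun_prop]
theorem mapBody {f : X → WFormula V → WFormula V}
    (hf : Tracked c fun p : X × WFormula V => f p.1 p.2)
    (hl : Tracked c l) : Tracked c fun x => (l x).mapBody (f x) := by
  unfold WFormula.Cases.mapBody
  have := hf.comp (G := fun p : X × WFormula V × WFormula V => (p.1, p.2.2)) (by fun_prop)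
  fun_prop

@[fun_prop]
theorem mapGuard {f : X → WFormula V → WFormula V}
    (hf : Tracked c fun p : X × WFormula V => f p.1 p.2)
    (hl : Tracked c l) : Tracked c fun x => (l x).mapGuard (f x) := by
  unfold WFormula.Cases.mapGuard
  fun_prop

@[fun_prop]
theorem bind {f : X → WFormula V → Cases V} (hf : Tracked c fun p : X × WFormula V => f p.1 p.2)
    (hl : Tracked c l) : Tracked c fun x => (l x).bind (f x) := by
  unfold WFormula.Cases.bind
  have := hf.comp (G := fun p : X × WFormula V × WFormula V => (p.1, p.2.2)) (by fun_prop)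
  fun_prop

end Cases

@[fun_prop]
theorem apply_setValueCode {F G : X → ℕ} (hF : Tracked c F) (hG : Tracked c G) :
    Tracked c fun x => setValueCode (F x) (G x) := by
  unfold setValueCode
  fun_prop

@[fun_prop]
theorem sumSplits (hF : Tracked c F) : Tracked c fun x => (F x).sumSplits := by
  obtain ⟨l, hl⟩ := c.exists_list_getD_const_eq fun a hfin s =>
    have := Fintype.ofFinite (V.Elem (V.wtType a))
    Encodable.encode (Finset.univ.toList.map fun s₁ : V.Elem (V.wtType a) =>
      Nat.pair (c.const _ s₁) (c.const _ (s - s₁)))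
  have hget := getD (c := c) l (F := fun n : ℕ => Nat.pair n.unpair.2.unpair.1
    n.unpair.2.unpair.2.unpair.1) (by fun_prop)
  refine Tracked.comp (of_rep (fun n => if n.unpair.1 = 6 then
    (Denumerable.ofNat (List ℕ) (l.getD (Nat.pair n.unpair.2.unpair.1
      n.unpair.2.unpair.2.unpair.1) 0)).map fun p =>
        (setValueCode n p.unpair.1, setValueCode n p.unpair.2) else [])
    (by fun_prop) fun φ => ?_) hF
  cases φ with
  | sumEq a hfin s ys φ =>
    simp [rep, SymbolCoding.code, setValueCode, WFormula.sumSplits, hl _ hfin s,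
      Function.comp_def, -List.getD_eq_getElem?_getD]
  | _ => simp [rep, SymbolCoding.code, WFormula.sumSplits]

@[fun_prop]
theorem sumTriples (hF : Tracked c F) : Tracked c fun x => (F x).sumTriples := by
  obtain ⟨l, hl⟩ := c.exists_list_getD_const_eq fun a hfin s =>
    have := Fintype.ofFinite (V.Elem (V.wtType a))
    Encodable.encode (Finset.univ.toList.flatMap fun s₁ : V.Elem (V.wtType a) =>
      Finset.univ.toList.map fun s₂ : V.Elem (V.wtType a) =>
        Nat.pair (c.const _ s₁) (Nat.pair (c.const _ s₂) (c.const _ (s - s₁ + s₂))))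
  have hget := getD (c := c) l (F := fun n : ℕ => Nat.pair n.unpair.2.unpair.1
    n.unpair.2.unpair.2.unpair.1) (by fun_prop)
  refine Tracked.comp (of_rep (fun n => if n.unpair.1 = 6 then
    (Denumerable.ofNat (List ℕ) (l.getD (Nat.pair n.unpair.2.unpair.1
      n.unpair.2.unpair.2.unpair.1) 0)).map fun p =>
        (setValueCode n p.unpair.1, setValueCode n p.unpair.2.unpair.1,
          setValueCode n p.unpair.2.unpair.2) else [])
    (by fun_prop) fun φ => ?_) hF
  cases φ with
  | sumEq a hfin s ys φ =>
    simp [rep, SymbolCoding.code, setValueCode, WFormula.sumTriples, hl _ hfin s,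
      Function.comp_def, List.map_flatMap, -List.getD_eq_getElem?_getD]
  | _ => simp [rep, SymbolCoding.code, WFormula.sumTriples]

@[fun_prop]
theorem isWtEqZero (hF : Tracked c F) : Tracked c fun x => (F x).isWtEqZero := by
  obtain ⟨l, hl⟩ := exists_list_getD_eq (fun a : Fin V.numWt => (a : ℕ))
    (fun a => c.const (V.wtType a) 0) Fin.val_injective
  have hget := getD (c := c) l (F := fun n : ℕ => n.unpair.2.unpair.1) (by fun_prop)
  refine Tracked.comp (of_rep (fun n => if n.unpair.1 = 2 then
    decide (n.unpair.2.unpair.2.unpair.1 = l.getD n.unpair.2.unpair.1 0) else false)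
    (by fun_prop) fun φ => ?_) hF
  cases φ with
  | wtEq a s xs =>
    have h : c.const _ s = c.const (V.wtType a) 0 ↔ s = 0 :=
      ⟨c.const_zero _ s, fun h => h ▸ rfl⟩
    by_cases hs : s = 0 <;>
      simp [rep, SymbolCoding.code, WFormula.isWtEqZero, hl, h, hs,
        -List.getD_eq_getElem?_getD]
  | _ => simp [rep, SymbolCoding.code, WFormula.isWtEqZero]

@[fun_prop]
theorem splitLeaf (hS : Tracked c S) (hF : Tracked c F) :
    Tracked c fun x => (F x).splitLeaf (S x) := by
  unfold WFormula.splitLeaf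
  fun_prop

section

variable {l m : X → WFormula.Cases V}

@[fun_prop]
theorem splitEx (hF : Tracked c F) (hl : Tracked c l) (hm : Tracked c m) :
    Tracked c fun x => (F x).splitEx (l x) (m x) := by
  unfold WFormula.splitEx
  fun_prop

@[fun_prop]
theorem splitSum (hF : Tracked c F) (hl : Tracked c l) (hm : Tracked c m) :
    Tracked c fun x => (F x).splitSum (l x) (m x) := by
  unfold WFormula.splitSum
  fun_prop

end

@[fun_prop]
theorem split (hF : Tracked c F) (hS : Tracked c S) : Tracked c fun x => (F x).split (S x) := by
  refine Tracked.comp (F := fun q : WFormula V × List ℕ => q.1.split q.2)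
    (formulaRec (fun q => q.1.splitLeaf q.2) (fun z => z.2.neg) (fun z => z.2.1.either z.2.2)
      (fun z => if z.1.1.tag = 5 then z.1.1.splitEx z.2.1 z.2.2 else
        z.1.1.splitSum z.2.1 z.2.2)
      (fun q => q.1.boundVars ++ q.2) (fun q => q.2.filter fun x => decide (x ∉ q.1.boundVars))
      (by fun_prop) (by fun_prop) (by fun_prop) (by fun_prop) (by fun_prop) (by fun_prop)
      fun φ _ => by cases φ <;> rfl) (hF.prodMk hS)

@[fun_prop]
theorem splitBalls (hr : Tracked c r) (hS : Tracked c S) (hT : Tracked c T) (hF : Tracked c F) :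
    Tracked c fun x => (F x).splitBalls (r x) (S x) (T x) := by
  unfold WFormula.splitBalls
  fun_prop

@[fun_prop]
theorem scatteredBody {y : X → ℕ} (hr : Tracked c r) (hF : Tracked c F) (hy : Tracked c y)
    (hS : Tracked c S) : Tracked c fun x => (F x).scatteredBody (r x) (y x) (S x) := by
  unfold WFormula.scatteredBody
  have := farApart (c := c) (δ := fun x => WFormula.distLE (2 * r x)) (l := S)
    (by fun_prop) hS
  fun_prop

@[fun_prop]
theorem scattered {y N k : X → ℕ} (hr : Tracked c r) (hF : Tracked c F) (hy : Tracked c y)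
    (hN : Tracked c N) (hk : Tracked c k) :
    Tracked c fun x => (F x).scattered (r x) (y x) (N x) (k x) := by
  unfold WFormula.scattered
  fun_prop

@[fun_prop]
theorem scatteredNear {y N k : X → ℕ} (hr : Tracked c r) (hS : Tracked c S) (hF : Tracked c F)
    (hy : Tracked c y) (hN : Tracked c N) (hk : Tracked c k) :
    Tracked c fun x => (F x).scatteredNear (r x) (S x) (y x) (N x) (k x) := by
  unfold WFormula.scatteredNear
  fun_prop

@[fun_prop]
theorem exStep {y : X → ℕ} (hr : Tracked c r) (hS : Tracked c S) (hy : Tracked c y)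
    (hF : Tracked c F) : Tracked c fun x => (F x).exStep (r x) (S x) (y x) := by
  unfold WFormula.exStep
  fun_prop

@[fun_prop]
theorem sumStep (hr : Tracked c r) (hS : Tracked c S) (hT : Tracked c T) (hF : Tracked c F)
    (hG : Tracked c G) : Tracked c fun x => (F x).sumStep (r x) (S x) (T x) (G x) := by
  unfold WFormula.sumStep
  fun_prop

@[fun_prop]
theorem nextRadius (hr : Tracked c r) : Tracked c fun x => WFormula.nextRadius (r x) := by
  unfold WFormula.nextRadius
  fun_prop

@[fun_prop]
theorem gnf (hF : Tracked c F) : Tracked c fun x => (F x).gnf := by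
  refine Tracked.comp (F := fun q : WFormula V × ℕ => q.1.gnf)
    (formulaRec (fun q => (0, [(WFormula.tt, q.1)])) (fun z => (z.2.1, z.2.2.neg))
      (fun z => (Max.max z.2.1.1 z.2.2.1, z.2.1.2.either z.2.2.2))
      (fun z => (WFormula.nextRadius z.2.1.1, if z.1.1.tag = 5 then
        z.2.1.2.bind (fun φ =>
          φ.exStep z.2.1.1 z.1.1.freeList (z.1.1.boundVars.foldr (fun y _ => y) 0)) else
        z.2.1.2.bind (fun φ => z.1.1.sumStep z.2.1.1 z.1.1.freeList z.1.1.boundVars φ)))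
      (fun q => q.2) (fun q => q.2)
      (by fun_prop) (by fun_prop) (by fun_prop) (by fun_prop) (by fun_prop) (by fun_prop)
      fun φ _ => by cases φ <;> rfl) (hF.prodMk (const 0))

@[fun_prop]
theorem pad (hS : Tracked c S) (hF : Tracked c F) : Tracked c fun x => (F x).pad (S x) := by
  unfold WFormula.pad
  fun_prop

theorem gaifmanNF (c : SymbolCoding V) : Tracked c (WFormula.gaifmanNF (V := V)) := by
  unfold WFormula.gaifmanNF
  fun_prop

end Tracked

theorem mainTheorem4 (V : Vocabulary.{u, v, w}) :
    ∃ Γ : WFormula V → WFormula V,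
      (∀ φ : WFormula V,
        (Γ φ).IsGaifmanNF ∧ φ.Equivalent (Γ φ) ∧ (Γ φ).free = φ.free) ∧
      ∀ c : SymbolCoding V, ∃ f : ℕ → ℕ, Computable f ∧
        ∀ φ : WFormula V, f (c.code φ) = c.code (Γ φ) := by
  refine ⟨WFormula.gaifmanNF, fun φ =>
    ⟨φ.isGaifmanNF_gaifmanNF, φ.equivalent_gaifmanNF, φ.free_gaifmanNF⟩, fun c => ?_⟩
  obtain ⟨f, hf, hfcode⟩ := Tracked.gaifmanNF c
  exact ⟨f, hf.to_comp, hfcode⟩
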